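/- **Setting.** Let $\mathcal G$ be a directed graph without self-loops on $\{1,\dots,N\}$, $N\ge1$; let $\mathcal V_i=\{j:(j,i)\in\mathcal E\}$, listed in ascending order $j_1<\dots<j_{p_i}$, let $p_i=|\mathcal V_i|$ be the in-degree and $q_i$ the out-degree of node $i$. Let $0=t_0<t_1<\dots$, $t_k\to\infty$, be sampling instants, put $t_k=0$ for $k<0$, and assume that $\tau_i=\sup_{k\ge0}(t_{k+1}-t_{k-p_i+1})$ is finite for all $i$; $\tau=\max_i\tau_i$. Let $\Pi\{j_1,\dots,j_p\}=\{j_p,j_1,\dots,j_{p-1}\}$ and let $\nu_j=\nu_j^{k,i}\in\{1,\dots,p_i\}$ be the position of $j$ in $\Pi^k(\mathcal V_i)$. Consider the plant and measurements $$\dot x=Ax+B_2w,\quad x(t)=x_0\ (t\le0),\qquad y_i=C_ix+D_{2i}w+\bar D_{2i}v_i,$$ with $x(t)\in\mathbf R^n$, $\xi_i=[w'\ v_i']'\in L_2[0,\infty)$, $\xi=[\xi_1'\dots\xi_N']'$, and the observers, for $t\in[t_k,t_{k+1})$, $k\ge 0$, $$\dot{\hat x}_i=A\hat x_i+L_i(y_i-C_i\hat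 x_i)+K_i\sum_{j\in\mathcal V_i}H_i\bigl(\hat x_j(t_{k-\nu_j+1})-\hat x_i(t_{k-\nu_j+1})\bigr),\quad \hat x_i(t)=0\ (t\le0).$$ With $B=[B_2\ 0]$, $D_i=[D_{2i}\ \bar D_{2i}]$, the errors $e_i=x-\hat x_i$ satisfy on $[t_k,t_{k+1})$ $$\dot e_i=(A-L_iC_i)e_i+(B-L_iD_i)\xi_i+K_iH_i\sum_{j\in\mathcal V_i}\bigl(e_j(t_{k-\nu_j+1})-e_i(t_{k-\nu_j+1})\bigr).\tag{1}$$ Differential equations are understood in the Carathéodory sense. Let $J(\xi)=\frac1N\int_0^\infty\sum_i\sum_{j\in\mathcal V_i}\|\hat x_j-\hat x_i\|^2dt$. **Problem.** Given $\gamma>0$, the gains $K_i,L_i$ *solve the estimation problem with the matrix $P=P'>0$* if (i) (1) with $\xi=0$ is exponentially stable, i.e. there are $M,\lambda>0$ such that for every $s_0\ge0$ and every solution of (1) with $\xi=0$ on $[s_0,\infty)$ with a history satisfying $\|e_j(s)\|\le\beta$ for all $j$ and $s\in[s_0-\tau,s_0]$, one has $\|e_i(t)\|\le Me^{-\lambda(t-s_0)}\beta$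 for all $i$ and $t\ge s_0$; and (ii) $$\sup_{(x_0,\xi)\ne0}\frac{J(\xi)}{x_0'Px_0+\frac1N\|\xi\|_2^2}\le\gamma^2 .$$ **Matrices.** Let $Y_i,X_i,Z_i,Q_i,W_i,S_i,R_i,G_i$ be real $n\times n$ matrices and $\alpha_i,\pi_i$ real numbers. Let $\Psi_i$ be the matrix of $(p_i+1)\times(p_i+1)$ blocks with diagonal blocks $R_i$ and all other blocks $\frac12(G_i+G_i')$; let $T_i$ map $(z_0,\dots,z_{p_i+1})$, $z_\nu\in\mathbf R^n$, to $(z_0-z_1,z_1-z_2,\dots,z_{p_i}-z_{p_i+1})$; let $\bar\Psi_i=e^{-2\alpha_i\tau_i}T_i'\Psi_iT_i$, partitioned into $3\times3$ blocks of sizes $n,p_in,n$; let $\tilde\Psi_{i,11}=\bar\Psi_{i,11}-2\alpha_iY_i^{-1}-S_i$, $\tilde\Psi_{i,33}=\bar\Psi_{i,33}+e^{-2\alpha_i\tau_i}S_i$ and $\tilde\Psi_{i,\mu\nu}=\bar\Psi_{i,\mu\nu}$ otherwise. Let $\bar\Phi_{i,11}$ and $\bar\Phi_{i,22}$ be block diagonal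 with blocks $\pi_{j_\nu}Y_{j_\nu}^{-1}+\frac{\pi^2}4W_{j_\nu}$ and $\frac{\pi^2}4W_{j_\nu}$, $\nu=1,\dots,p_i$, and $\bar\Phi_{i,12}=-\bar\Phi_{i,22}$. With $\mathbf 1=\mathbf 1_{p_i}$ the column of ones and $\bar A_i=A-L_iC_i$, $\bar B_i=B-L_iD_i$, let $\Xi_i$ be the symmetric matrix $$\Xi_i=\begin{bmatrix} \Xi_{aa}&\Xi_{ab}&-Z_i'(\mathbf 1'\otimes K_iH_i)&0&0&\mathbf 1'\otimes(-Q_i+Z_i'K_iH_i)&Z_i'\bar B_i\\ \star&\Xi_{bb}&-\tilde\Psi_{i,12}-\mathbf 1'\otimes X_i'K_iH_i&-\tilde\Psi_{i,13}&-\frac1{\gamma^2}\mathbf 1'\otimes I&\mathbf 1'\otimes(X_i'K_iH_i+\bar A_i'Q_i)&X_i'\bar B_i\\ \star&\star&-\tilde\Psi_{i,22}&-\tilde\Psi_{i,23}&0&-\mathbf 1\mathbf 1'\otimes H_i'K_i'Q_i&0\\ \star&\star&\star&-\tilde\Psi_{i,33}&0&0&0\\ \star&\star&\star&\star&-\bar\Phi_{i,11}&-\bar\Phi_{i,12}&0\\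 \star&\star&\star&\star&\star&\Xi_{ff}&\mathbf 1\otimes Q_i'\bar B_i\\ \star&\star&\star&\star&\star&\star&-I\end{bmatrix},$$ $\Xi_{aa}=\tau_i^2R_i+\bigl(\sum_{j:\,i\in\mathcal V_j}\tau_j^2\bigr)W_i-Z_i-Z_i'$, $\ \Xi_{ab}=Y_i^{-1}-X_i+Z_i'\bar A_i$, $\ \Xi_{bb}=\frac{p_i+q_i}{\gamma^2}I-\tilde\Psi_{i,11}+X_i'\bar A_i+\bar A_i'X_i$, $\ \Xi_{ff}=\mathbf 1\mathbf 1'\otimes(Q_i'K_iH_i+H_i'K_i'Q_i)-\bar\Phi_{i,22}$. **Theorem.** Let $\gamma>0$. Suppose that matrices $Y_i=Y_i'>0$, $X_i$, $Z_i$, $Q_i$, $W_i=W_i'\ge0$, $S_i=S_i'\ge0$, $R_i=R_i'\ge0$, $G_i$, constants $\alpha_i>0$, $\pi_i\ge0$ with $q_i\pi_i<2\alpha_i$, and gains $K_i$, $L_i$ satisfy, for all $i=1,\dots,N$, $$\begin{bmatrix}R_i&G_i\\G_i'&R_i\end{bmatrix}\ge0,\qquad \Xi_i<0 .$$ Then the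 gains $K_i,L_i$ solve the estimation problem with the (positive definite) matrix $$P=\frac1N\sum_{i=1}^N\Bigl(Y_i^{-1}+\frac{1-e^{-2\alpha_i\tau_i}}{2\alpha_i}S_i\Bigr).$$ -/

import Mathlib

open MeasureTheory Matrix Set
open scoped Kronecker ENNReal

namespace RoundRobin

noncomputable section

/-- The Euclidean norm of a plain coordinate vector. -/
def eucl {ι : Type} [Fintype ι] (v : ι → ℝ) : ℝ := ‖WithLp.toLp 2 v‖

/-! ### Graph and round-robin ordering -/

/-- The neighbourhood of `i`: the nodes `j` with an edge from `j` to `i`. -/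
def nbhd {N : ℕ} (G : Digraph (Fin N)) (i : Fin N) : Finset (Fin N) :=
  open scoped Classical in Finset.univ.filter fun j => G.Adj j i

/-- The in-degree `p_i`. -/
def inDeg {N : ℕ} (G : Digraph (Fin N)) (i : Fin N) : ℕ := (nbhd G i).card

/-- The nodes that receive information from `i`. -/
def outNbhd {N : ℕ} (G : Digraph (Fin N)) (i : Fin N) : Finset (Fin N) :=
  Finset.univ.filter fun j => i ∈ nbhd G j

/-- The out-degree `q_i`. -/
def outDeg {N : ℕ} (G : Digraph (Fin N)) (i : Fin N) : ℕ := (outNbhd G i).card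

/-- The neighbours of `i` in ascending order. -/
def nbr {N : ℕ} (G : Digraph (Fin N)) (i : Fin N) (ν : Fin (inDeg G i)) : Fin N :=
  (nbhd G i).orderEmbOfFin rfl ν

/-- The shift permutation `{j₁, …, j_{p-1}, j_p} ↦ {j_p, j₁, …, j_{p-1}}`. -/
def shiftPerm {V : Type} (l : List V) : List V := l.rotateRight 1

/-- The ordered neighbourhood of `i` (ascending order) after `k` shift permutations. -/
def pollOrder {N : ℕ} (G : Digraph (Fin N)) (i : Fin N) (k : ℕ) : List (Fin N) :=
  shiftPerm^[k] ((nbhd G i).sort (· ≤ ·))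

/-- The index, counted from one, of `j` in the ordered neighbourhood of `i` after `k` shifts. -/
def pollIndex {N : ℕ} (G : Digraph (Fin N)) (i : Fin N) (k : ℕ) (j : Fin N) : ℕ :=
  (pollOrder G i k).idxOf j + 1

/-! ### Plant, measurements, sampling instants -/

/-- The data of the plant, of the measurements, of the communication graph and of the sampling
schedule; `r i` is the dimension of the `i`-th measurement and `h i` the number of rows of `H i`. -/
structure Network (N n mw mv : ℕ) where
  graph : Digraph (Fin N)
  loopless : ∀ i, ¬ graph.Adj i i
  A : Matrix (Fin n) (Fin n) ℝ
  B₂ : Matrix (Fin n) (Fin mw) ℝ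
  r : Fin N → ℕ
  C : ∀ i, Matrix (Fin (r i)) (Fin n) ℝ
  D₂ : ∀ i, Matrix (Fin (r i)) (Fin mw) ℝ
  Dbar₂ : ∀ i, Matrix (Fin (r i)) (Fin mv) ℝ
  h : Fin N → ℕ
  H : ∀ i, Matrix (Fin (h i)) (Fin n) ℝ
  t : ℕ → ℝ
  t_zero : t 0 = 0
  t_strictMono : StrictMono t
  t_tendsto : Filter.Tendsto t Filter.atTop Filter.atTop

variable {N n mw mv : ℕ}

namespace Network

/-- Sampling instants with integer index. No sampling takes place before time zero, where all
signals are constant, so instants of negative index are placed at `t₀ = 0`. -/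
def tExt (S : Network N n mw mv) (k : ℤ) : ℝ := S.t k.toNat

/-- The in-degree `p_i`. -/
abbrev p (S : Network N n mw mv) (i : Fin N) : ℕ := inDeg S.graph i

/-- The out-degree `q_i`. -/
abbrev q (S : Network N n mw mv) (i : Fin N) : ℕ := outDeg S.graph i

/-- The times between consecutive polls of a channel of node `i`, `t_{k+1} - t_{k-p_i+1}`. -/
def pollGap (S : Network N n mw mv) (i : Fin N) (k : ℕ) : ℝ :=
  S.t (k + 1) - S.tExt ((k : ℤ) - (S.p i : ℤ) + 1)

/-- The maximum communication delay `τ_i` at node `i`. -/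
def τ (S : Network N n mw mv) (i : Fin N) : ℝ := ⨆ k : ℕ, S.pollGap i k

/-- The largest communication delay in the network. -/
def τmax (S : Network N n mw mv) : ℝ := ⨆ i : Fin N, S.τ i

/-- The instant `t_{k-ν+1}` at which the sample of channel `j → i` in use on `[t_k, t_{k+1})`
was taken, `ν` being the index of `j` in the current polling order of node `i`. -/
def sampleTime (S : Network N n mw mv) (i : Fin N) (k : ℕ) (j : Fin N) : ℝ :=
  S.tExt ((k : ℤ) - (pollIndex S.graph i k j : ℤ) + 1)

/-- `B = [B₂ 0]`. -/
def B (S : Network N n mw mv) : Matrix (Fin n) (Fin mw ⊕ Fin mv) ℝ := fromCols S.B₂ 0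

/-- `D_i = [D₂ᵢ D̄₂ᵢ]`. -/
def D (S : Network N n mw mv) (i : Fin N) : Matrix (Fin (S.r i)) (Fin mw ⊕ Fin mv) ℝ :=
  fromCols (S.D₂ i) (S.Dbar₂ i)

end Network

/-- The gains of the observers: coupling gains `K i` and observer gains `L i`. -/
structure Gains (S : Network N n mw mv) where
  K : ∀ i, Matrix (Fin n) (Fin (S.h i)) ℝ
  L : ∀ i, Matrix (Fin n) (Fin (S.r i)) ℝ

/-! ### Trajectories -/

/-- The measurement `y_i = C_i x + D₂ᵢ w + D̄₂ᵢ v_i`. -/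
def measurement (S : Network N n mw mv) (x : ℝ → Fin n → ℝ) (w : ℝ → Fin mw → ℝ)
    (v : Fin N → ℝ → Fin mv → ℝ) (i : Fin N) (s : ℝ) : Fin (S.r i) → ℝ :=
  S.C i *ᵥ x s + S.D₂ i *ᵥ w s + S.Dbar₂ i *ᵥ v i s

/-- `x` and `xh` are the (Carathéodory) solutions of the plant equation with initial state `x₀`
and of the observer equations with zero initial state, under the disturbances `w`, `v`. -/
structure IsTrajectory (S : Network N n mw mv) (g : Gains S) (x₀ : Fin n → ℝ)
    (w : ℝ → Fin mw → ℝ) (v : Fin N → ℝ → Fin mv → ℝ)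
    (x : ℝ → Fin n → ℝ) (xh : Fin N → ℝ → Fin n → ℝ) : Prop where
  plant_cont : Continuous x
  plant_init : ∀ t ≤ 0, x t = x₀
  plant_eq : ∀ t, 0 ≤ t → x t = x₀ + ∫ s in (0 : ℝ)..t, (S.A *ᵥ x s + S.B₂ *ᵥ w s)
  obs_cont : ∀ i, Continuous (xh i)
  obs_init : ∀ i, ∀ t ≤ 0, xh i t = 0
  obs_eq : ∀ i, ∀ k : ℕ, ∀ t ∈ Icc (S.t k) (S.t (k + 1)),
    xh i t = xh i (S.t k) + ∫ s in (S.t k)..t,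
      (S.A *ᵥ xh i s + g.L i *ᵥ (measurement S x w v i s - S.C i *ᵥ xh i s)
        + g.K i *ᵥ ∑ j ∈ nbhd S.graph i,
            S.H i *ᵥ (xh j (S.sampleTime i k j) - xh i (S.sampleTime i k j)))

/-- `e` is a (Carathéodory) solution of the error dynamics on `[s₀, ∞)` under the perturbations
`ξ`; its values before `s₀` are the initial history and are unrestricted here. -/
structure IsErrorTrajectory (S : Network N n mw mv) (g : Gains S) (s₀ : ℝ)
    (ξ : Fin N → ℝ → Fin mw ⊕ Fin mv → ℝ) (e : Fin N → ℝ → Fin n → ℝ) : Prop where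
  cont : ∀ i, ContinuousOn (e i) (Ici s₀)
  eq : ∀ i, ∀ k : ℕ, ∀ a b : ℝ, s₀ ≤ a → S.t k ≤ a → a ≤ b → b ≤ S.t (k + 1) →
    e i b = e i a + ∫ s in a..b,
      ((S.A - g.L i * S.C i) *ᵥ e i s + (S.B - g.L i * S.D i) *ᵥ ξ i s
        + (g.K i * S.H i) *ᵥ ∑ j ∈ nbhd S.graph i,
            (e j (S.sampleTime i k j) - e i (S.sampleTime i k j)))

/-! ### The distributed estimation problem -/

/-- Uniform exponential stability of the unperturbed error dynamics: every solution that starts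
at a time `s₀ ≥ 0` from a history bounded by `β` on `[s₀ - τ, s₀]` decays exponentially, with
constants that depend neither on `s₀` nor on the solution. -/
def ExponentiallyStable (S : Network N n mw mv) (g : Gains S) : Prop :=
  ∃ M > (0 : ℝ), ∃ rate > (0 : ℝ), ∀ s₀ : ℝ, 0 ≤ s₀ → ∀ e : Fin N → ℝ → Fin n → ℝ,
    IsErrorTrajectory S g s₀ 0 e →
    ∀ β : ℝ, (∀ i, ∀ s ∈ Icc (s₀ - S.τmax) s₀, eucl (e i s) ≤ β) →
    ∀ i, ∀ t, s₀ ≤ t → eucl (e i t) ≤ M * Real.exp (-rate * (t - s₀)) * β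

/-- The cost of disagreement between the observers, with values in `[0, ∞]`. -/
def disagreement (S : Network N n mw mv) (xh : Fin N → ℝ → Fin n → ℝ) : ℝ≥0∞ :=
  (N : ℝ≥0∞)⁻¹ * ∫⁻ t in Ioi (0 : ℝ),
    ∑ i, ∑ j ∈ nbhd S.graph i, ENNReal.ofReal (eucl (xh j t - xh i t) ^ 2)

/-- The perturbation `ξ_i = [w' v_i']'`. -/
def pert (w : ℝ → Fin mw → ℝ) (v : Fin N → ℝ → Fin mv → ℝ) (i : Fin N) (t : ℝ) :
    Fin mw ⊕ Fin mv → ℝ :=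
  Sum.elim (w t) (v i t)

/-- The squared `L₂` norm of `ξ = [ξ_1' … ξ_N']'`. -/
def pertNormSq (w : ℝ → Fin mw → ℝ) (v : Fin N → ℝ → Fin mv → ℝ) : ℝ≥0∞ :=
  ∫⁻ t in Ioi (0 : ℝ), ∑ i, ENNReal.ofReal (eucl (pert w v i t) ^ 2)

/-- The perturbations belong to `L₂[0, ∞)`. -/
def IsL2 (w : ℝ → Fin mw → ℝ) (v : Fin N → ℝ → Fin mv → ℝ) : Prop :=
  ∀ i, MemLp (pert w v i) 2 (volume.restrict (Ioi 0))

/-- `(x₀, ξ)` is not zero, `ξ` being regarded as an element of `L₂[0, ∞)`. -/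
def NonzeroInput (x₀ : Fin n → ℝ) (w : ℝ → Fin mw → ℝ) (v : Fin N → ℝ → Fin mv → ℝ) : Prop :=
  x₀ ≠ 0 ∨ ¬ ∀ᵐ t ∂(volume.restrict (Ioi (0 : ℝ))), ∀ i, pert w v i t = 0

/-- The guaranteed level of transient consensus performance. -/
def ConsensusPerformance (S : Network N n mw mv) (g : Gains S) (γ : ℝ)
    (P : Matrix (Fin n) (Fin n) ℝ) : Prop :=
  (⨆ (x₀ : Fin n → ℝ) (w : ℝ → Fin mw → ℝ) (v : Fin N → ℝ → Fin mv → ℝ)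
      (x : ℝ → Fin n → ℝ) (xh : Fin N → ℝ → Fin n → ℝ)
      (_ : IsL2 w v) (_ : NonzeroInput x₀ w v) (_ : IsTrajectory S g x₀ w v x xh),
    disagreement S xh /
      (ENNReal.ofReal (x₀ ⬝ᵥ P *ᵥ x₀) + (N : ℝ≥0∞)⁻¹ * pertNormSq w v))
    ≤ ENNReal.ofReal (γ ^ 2)

/-- The gains `g` solve the distributed estimation problem with performance level `γ` and
weight `P` of the initial state. -/
structure SolvesEstimationProblem (S : Network N n mw mv) (g : Gains S) (γ : ℝ)
    (P : Matrix (Fin n) (Fin n) ℝ) : Prop where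
  posDef : P.PosDef
  stable : ExponentiallyStable S g
  performance : ConsensusPerformance S g γ P

/-! ### The matrix inequalities -/

/-- The unknown matrices and constants of the matrix inequalities; `ϖ i` is the constant
`π_i`. -/
structure LMIVars (N n : ℕ) where
  (Y X Z Q W S R G : Fin N → Matrix (Fin n) (Fin n) ℝ)
  (α ϖ : Fin N → ℝ)

section Blocks

variable {p : ℕ}

/-- `1_p' ⊗ M`. -/
def rowRep {m m' : Type} (p : ℕ) (M : Matrix m m' ℝ) : Matrix m (Fin p × m') ℝ :=
  of fun a b => M a b.2

/-- `1_p ⊗ M`. -/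
def colRep {m m' : Type} (p : ℕ) (M : Matrix m m' ℝ) : Matrix (Fin p × m) m' ℝ :=
  of fun a b => M a.2 b

/-- `1_p 1_p' ⊗ M`. -/
def sqRep {m m' : Type} (p : ℕ) (M : Matrix m m' ℝ) : Matrix (Fin p × m) (Fin p × m') ℝ :=
  of fun a b => M a.2 b.2

/-- The block diagonal matrix with the blocks `M 0, …, M (p - 1)`. -/
def diagBlocks (M : Fin p → Matrix (Fin n) (Fin n) ℝ) :
    Matrix (Fin p × Fin n) (Fin p × Fin n) ℝ :=
  of fun a b => if a.1 = b.1 then M a.1 a.2 b.2 else 0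

/-- The symmetric block matrix whose lower left block is the transpose of the upper right one. -/
def symBlock {m m' : Type} (E : Matrix m m ℝ) (F : Matrix m m' ℝ) (D : Matrix m' m' ℝ) :
    Matrix (m ⊕ m') (m ⊕ m') ℝ :=
  fromBlocks E F Fᵀ D

/-- `(p+1) × (p+1)` blocks, `R` on the diagonal and `(G + G')/2` elsewhere. -/
def Psi (p : ℕ) (R G : Matrix (Fin n) (Fin n) ℝ) :
    Matrix (Fin (p + 1) × Fin n) (Fin (p + 1) × Fin n) ℝ :=
  of fun a b => if a.1 = b.1 then R a.2 b.2 else ((1 / 2 : ℝ) • (G + Gᵀ)) a.2 b.2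

/-- The matrix of successive differences, `(T z)_ν = z_ν - z_{ν+1}` for `ν = 0, …, p`, which maps
`(e_i(t), e_i(t_k), …, e_i(t_{k-p+1}), e_i(t-τ_i))` to
`(e_i(t) - e_i(t_k), …, e_i(t_{k-p+1}) - e_i(t-τ_i))`. -/
def T (p n : ℕ) : Matrix (Fin (p + 1) × Fin n) (Fin (p + 2) × Fin n) ℝ :=
  (of fun (a : Fin (p + 1)) (b : Fin (p + 2)) =>
    if b = a.castSucc then (1 : ℝ) else if b = a.succ then -1 else 0) ⊗ₖ
      (1 : Matrix (Fin n) (Fin n) ℝ)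

/-- First block of the partition `n, p n, n` of the index set of size `(p + 2) n`. -/
def blk₁ (p : ℕ) (a : Fin n) : Fin (p + 2) × Fin n := (0, a)

/-- Second block of the partition. -/
def blk₂ (p : ℕ) (a : Fin p × Fin n) : Fin (p + 2) × Fin n := (a.1.castSucc.succ, a.2)

/-- Third block of the partition. -/
def blk₃ (p : ℕ) (a : Fin n) : Fin (p + 2) × Fin n := (Fin.last (p + 1), a)

end Blocks

section Xi

variable (S : Network N n mw mv) (g : Gains S) (γ : ℝ) (V : LMIVars N n) (i : Fin N)

/-- `Ψ̄_i = e^{-2 α_i τ_i} T_i' Ψ_i T_i`. -/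
def PsiBar : Matrix (Fin (S.p i + 2) × Fin n) (Fin (S.p i + 2) × Fin n) ℝ :=
  Real.exp (-2 * V.α i * S.τ i) • ((T (S.p i) n)ᵀ * Psi (S.p i) (V.R i) (V.G i) * T (S.p i) n)

def PsiTilde₁₁ : Matrix (Fin n) (Fin n) ℝ :=
  (PsiBar S V i).submatrix (blk₁ _) (blk₁ _) - (2 * V.α i) • (V.Y i)⁻¹ - V.S i

def PsiTilde₁₂ : Matrix (Fin n) (Fin (S.p i) × Fin n) ℝ :=
  (PsiBar S V i).submatrix (blk₁ _) (blk₂ _)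

def PsiTilde₁₃ : Matrix (Fin n) (Fin n) ℝ :=
  (PsiBar S V i).submatrix (blk₁ _) (blk₃ _)

def PsiTilde₂₂ : Matrix (Fin (S.p i) × Fin n) (Fin (S.p i) × Fin n) ℝ :=
  (PsiBar S V i).submatrix (blk₂ _) (blk₂ _)

def PsiTilde₂₃ : Matrix (Fin (S.p i) × Fin n) (Fin n) ℝ :=
  (PsiBar S V i).submatrix (blk₂ _) (blk₃ _)

def PsiTilde₃₃ : Matrix (Fin n) (Fin n) ℝ :=
  (PsiBar S V i).submatrix (blk₃ _) (blk₃ _) + Real.exp (-2 * V.α i * S.τ i) • V.S i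

def PhiBar₁₁ : Matrix (Fin (S.p i) × Fin n) (Fin (S.p i) × Fin n) ℝ :=
  diagBlocks fun ν => V.ϖ (nbr S.graph i ν) • (V.Y (nbr S.graph i ν))⁻¹
    + (Real.pi ^ 2 / 4) • V.W (nbr S.graph i ν)

def PhiBar₂₂ : Matrix (Fin (S.p i) × Fin n) (Fin (S.p i) × Fin n) ℝ :=
  diagBlocks fun ν => (Real.pi ^ 2 / 4) • V.W (nbr S.graph i ν)

def PhiBar₁₂ : Matrix (Fin (S.p i) × Fin n) (Fin (S.p i) × Fin n) ℝ := -PhiBar₂₂ S V i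

def XiAA : Matrix (Fin n) (Fin n) ℝ :=
  (S.τ i ^ 2) • V.R i + (∑ j ∈ outNbhd S.graph i, S.τ j ^ 2) • V.W i - V.Z i - (V.Z i)ᵀ

def XiAB : Matrix (Fin n) (Fin n) ℝ :=
  (V.Y i)⁻¹ - V.X i + (V.Z i)ᵀ * (S.A - g.L i * S.C i)

def XiAC : Matrix (Fin n) (Fin (S.p i) × Fin n) ℝ :=
  -((V.Z i)ᵀ * rowRep (S.p i) (g.K i * S.H i))

def XiAF : Matrix (Fin n) (Fin (S.p i) × Fin n) ℝ :=
  rowRep (S.p i) (-V.Q i + (V.Z i)ᵀ * g.K i * S.H i)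

def XiAG : Matrix (Fin n) (Fin mw ⊕ Fin mv) ℝ :=
  (V.Z i)ᵀ * (S.B - g.L i * S.D i)

def XiBB : Matrix (Fin n) (Fin n) ℝ :=
  (((S.p i : ℝ) + (S.q i : ℝ)) / γ ^ 2) • (1 : Matrix (Fin n) (Fin n) ℝ) - PsiTilde₁₁ S V i
    + (V.X i)ᵀ * (S.A - g.L i * S.C i) + (S.A - g.L i * S.C i)ᵀ * V.X i

def XiBC : Matrix (Fin n) (Fin (S.p i) × Fin n) ℝ :=
  -PsiTilde₁₂ S V i - rowRep (S.p i) ((V.X i)ᵀ * g.K i * S.H i)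

def XiBE : Matrix (Fin n) (Fin (S.p i) × Fin n) ℝ :=
  -((1 / γ ^ 2) • rowRep (S.p i) (1 : Matrix (Fin n) (Fin n) ℝ))

def XiBF : Matrix (Fin n) (Fin (S.p i) × Fin n) ℝ :=
  rowRep (S.p i) ((V.X i)ᵀ * g.K i * S.H i + (S.A - g.L i * S.C i)ᵀ * V.Q i)

def XiBG : Matrix (Fin n) (Fin mw ⊕ Fin mv) ℝ :=
  (V.X i)ᵀ * (S.B - g.L i * S.D i)

def XiCF : Matrix (Fin (S.p i) × Fin n) (Fin (S.p i) × Fin n) ℝ :=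
  -sqRep (S.p i) ((S.H i)ᵀ * (g.K i)ᵀ * V.Q i)

def XiFF : Matrix (Fin (S.p i) × Fin n) (Fin (S.p i) × Fin n) ℝ :=
  sqRep (S.p i) ((V.Q i)ᵀ * g.K i * S.H i + (S.H i)ᵀ * (g.K i)ᵀ * V.Q i) - PhiBar₂₂ S V i

def XiFG : Matrix (Fin (S.p i) × Fin n) (Fin mw ⊕ Fin mv) ℝ :=
  colRep (S.p i) ((V.Q i)ᵀ * (S.B - g.L i * S.D i))

/-- The index set of `Ξ_i`, with the seven blocks `a, …, g`. -/
abbrev XiIndex : Type :=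
  Fin n ⊕ Fin n ⊕ (Fin (S.p i) × Fin n) ⊕ Fin n ⊕ (Fin (S.p i) × Fin n) ⊕
    (Fin (S.p i) × Fin n) ⊕ (Fin mw ⊕ Fin mv)

/-- The symmetric matrix `Ξ_i`, given by the diagonal block and the part to the right of the
diagonal of each of its seven block rows. -/
def Xi : Matrix (XiIndex S i) (XiIndex S i) ℝ :=
  symBlock (XiAA S V i)
    (fromCols (XiAB S g V i) <| fromCols (XiAC S g V i) <| fromCols 0 <| fromCols 0 <|
      fromCols (XiAF S g V i) (XiAG S g V i)) <|
  symBlock (XiBB S g γ V i)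
    (fromCols (XiBC S g V i) <| fromCols (-PsiTilde₁₃ S V i) <| fromCols (XiBE S γ i) <|
      fromCols (XiBF S g V i) (XiBG S g V i)) <|
  symBlock (-PsiTilde₂₂ S V i)
    (fromCols (-PsiTilde₂₃ S V i) <| fromCols 0 <| fromCols (XiCF S g V i) 0) <|
  symBlock (-PsiTilde₃₃ S V i)
    (fromCols 0 <| fromCols 0 0) <|
  symBlock (-PhiBar₁₁ S V i)
    (fromCols (-PhiBar₁₂ S V i) 0) <|
  symBlock (XiFF S g V i)
    (XiFG S g V i)
    (-1)

/-- `P = (1/N) ∑_i (Y_i⁻¹ + (1 - e^{-2 α_i τ_i}) / (2 α_i) S_i)`. -/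
def weightP : Matrix (Fin n) (Fin n) ℝ :=
  (1 / (N : ℝ)) • ∑ i, ((V.Y i)⁻¹ +
    ((1 - Real.exp (-2 * V.α i * S.τ i)) / (2 * V.α i)) • V.S i)

end Xi

end

end RoundRobin

/-!
The errors obey linear equations driven by delayed samples, and stability and performance come from
one Lyapunov–Krasovskii functional `𝓥`. It consists of the quadratic terms `e_i' Y_i⁻¹ e_i`, of
delay terms, namely the integral of `e_i' S_i e_i` over the last `τ_i` time units and a double
integral of `f_i' R_i f_i`, where `f_i` is the derivative of `e_i`, and, for each edge `(j, i)`, of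
the difference between `τ_i² ∫ f_j' W_j f_j` and `π²/4 ∫ (e_j - e_j(s))' W_j (e_j - e_j(s))`, both
integrals starting at the instant `s` of the sample of `e_j` that `i` is using. Wirtinger's
inequality makes the edge terms nonnegative; as they start afresh from `0` when `j` is polled, `𝓥`
does not increase at the sampling instants. Between them, evaluating `Ξ_i < 0` along the motion and
summing over `i` bounds the derivative of `𝓥` by
`∑ ‖ξ_i‖² - γ⁻² ∑ ‖e_j - e_i‖² - ε ∑ (‖e_i‖² + ‖f_i‖²)`.

Integrating from `0`, where `𝓥 ≤ N x₀' P x₀` because `τ e^{-2ατ} ≤ (1 - e^{-2ατ}) / (2α)`, gives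
the performance bound. For `ξ = 0`, `𝓥` is bounded by the integral of the dissipated quantity over
a window of fixed length, and this forces that integral to contract from one window to the next.
A delayed Grönwall inequality covers the initial interval, on which the history need not be
differentiable.
-/

namespace RoundRobin

noncomputable section

/-! ### Quadratic forms -/

section QuadraticForm

variable {m m' : Type*} [Fintype m] [Fintype m']

lemma dotProduct_mulVec_transpose_comm (M : Matrix m m' ℝ) (u : m → ℝ) (v : m' → ℝ) :
    v ⬝ᵥ Mᵀ *ᵥ u = u ⬝ᵥ M *ᵥ v := by
  rw [mulVec_transpose, dotProduct_comm, ← dotProduct_mulVec]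

lemma dotProduct_mulVec_comm_of_isHermitian {M : Matrix m m ℝ} (hM : M.IsHermitian)
    (u v : m → ℝ) : u ⬝ᵥ M *ᵥ v = v ⬝ᵥ M *ᵥ u := by
  conv_lhs => rw [← (conjTranspose_eq_transpose_of_trivial M).symm.trans hM]
  exact dotProduct_mulVec_transpose_comm M v u

lemma dotProduct_mulVec_self_nonneg {M : Matrix m m ℝ} (hM : M.PosSemidef) (v : m → ℝ) :
    0 ≤ v ⬝ᵥ M *ᵥ v := by
  simpa using hM.dotProduct_mulVec_nonneg v

lemma dotProduct_self_nonneg (v : m → ℝ) : 0 ≤ v ⬝ᵥ v := by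
  simpa using dotProduct_self_star_nonneg v

lemma dotProduct_mulVec_eq_sum (M : Matrix m m' ℝ) (u : m → ℝ) (v : m' → ℝ) :
    u ⬝ᵥ M *ᵥ v = ∑ a, ∑ b, M a b * (u a * v b) := by
  simp only [dotProduct, mulVec, Finset.mul_sum, mul_left_comm]

lemma sub_dotProduct_mulVec_sub {M : Matrix m m ℝ} (hM : M.IsHermitian) (u v : m → ℝ) :
    (u - v) ⬝ᵥ M *ᵥ (u - v) = u ⬝ᵥ M *ᵥ u - 2 * (u ⬝ᵥ M *ᵥ v) + v ⬝ᵥ M *ᵥ v := by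
  simp only [mulVec_sub, sub_dotProduct, dotProduct_sub,
    dotProduct_mulVec_comm_of_isHermitian hM v u]
  ring

lemma two_mul_dotProduct_mulVec_le {M : Matrix m m ℝ} (hM : M.PosSemidef) (u v : m → ℝ) :
    2 * (u ⬝ᵥ M *ᵥ v) ≤ u ⬝ᵥ M *ᵥ u + v ⬝ᵥ M *ᵥ v := by
  linarith [dotProduct_mulVec_self_nonneg hM (u - v), sub_dotProduct_mulVec_sub hM.1 u v]

lemma two_mul_dotProduct_le (u v : m → ℝ) : 2 * (u ⬝ᵥ v) ≤ u ⬝ᵥ u + v ⬝ᵥ v := by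
  classical simpa using two_mul_dotProduct_mulVec_le (M := 1) PosSemidef.one u v

lemma two_mul_dotProduct_mulVec_le_of_fromBlocks {R G : Matrix m m ℝ}
    (hRG : (fromBlocks R G Gᵀ R).PosSemidef) (u v : m → ℝ) :
    2 * (u ⬝ᵥ G *ᵥ v) ≤ u ⬝ᵥ R *ᵥ u + v ⬝ᵥ R *ᵥ v := by
  have h := dotProduct_mulVec_self_nonneg hRG (Sum.elim u (-v))
  simp only [fromBlocks_mulVec, Sum.elim_comp_inl, Sum.elim_comp_inr, sumElim_dotProduct_sumElim,
    dotProduct_add, mulVec_neg, dotProduct_neg, neg_dotProduct, neg_neg,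
    dotProduct_mulVec_transpose_comm] at h
  linarith

lemma two_mul_dotProduct_symmetrized_mulVec_le {R G : Matrix m m ℝ}
    (hRG : (fromBlocks R G Gᵀ R).PosSemidef) (u v : m → ℝ) :
    2 * (u ⬝ᵥ ((1 / 2 : ℝ) • (G + Gᵀ)) *ᵥ v) ≤ u ⬝ᵥ R *ᵥ u + v ⬝ᵥ R *ᵥ v := by
  rw [smul_mulVec, dotProduct_smul, smul_eq_mul, add_mulVec, dotProduct_add,
    dotProduct_mulVec_transpose_comm]
  linarith [two_mul_dotProduct_mulVec_le_of_fromBlocks hRG u v,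
    two_mul_dotProduct_mulVec_le_of_fromBlocks hRG v u]

lemma exists_dotProduct_mulVec_self_le (M : Matrix m m ℝ) :
    ∃ c : ℝ, 0 ≤ c ∧ ∀ v, v ⬝ᵥ M *ᵥ v ≤ c * (v ⬝ᵥ v) := by
  classical
  let L := toEuclideanCLM (n := m) (𝕜 := ℝ) M
  have hinner (u v : m → ℝ) : u ⬝ᵥ v = inner ℝ (WithLp.toLp 2 v) (WithLp.toLp 2 u) := rfl
  refine ⟨‖L‖, norm_nonneg L, fun v => ?_⟩
  rw [hinner v v, real_inner_self_eq_norm_mul_norm, hinner, ← mul_assoc]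
  calc inner ℝ (L (WithLp.toLp 2 v)) (WithLp.toLp 2 v)
    _ ≤ ‖L (WithLp.toLp 2 v)‖ * ‖WithLp.toLp 2 v‖ := real_inner_le_norm _ _
    _ ≤ _ := by gcongr; exact L.le_opNorm _

open scoped MatrixOrder in
lemma exists_smul_dotProduct_le_dotProduct_mulVec {M : Matrix m m ℝ} (hM : M.PosDef) :
    ∃ ε : ℝ, 0 < ε ∧ ∀ v, ε * (v ⬝ᵥ v) ≤ v ⬝ᵥ M *ᵥ v := by
  classical
  rcases isEmpty_or_nonempty m with hm | hm
  · exact ⟨1, one_pos, fun v => by simp [dotProduct]⟩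
  obtain ⟨ε, hε, hle⟩ := (CFC.exists_pos_algebraMap_le_iff hM.1).2
    fun x hx => hM.isStrictlyPositive.spectrum_pos hx
  refine ⟨ε, hε, fun v => ?_⟩
  have h := dotProduct_mulVec_self_nonneg (Matrix.le_iff.1 hle) v
  rw [Algebra.algebraMap_eq_smul_one, sub_mulVec, smul_mulVec, one_mulVec, dotProduct_sub,
    dotProduct_smul, smul_eq_mul] at h
  linarith

lemma exists_smul_dotProduct_le_dotProduct_mulVec_family {ι : Type*} [Finite ι] {m : ι → Type*}
    [∀ i, Fintype (m i)] {M : ∀ i, Matrix (m i) (m i) ℝ} (hM : ∀ i, (M i).PosDef) :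
    ∃ ε : ℝ, 0 < ε ∧ ∀ i v, ε * (v ⬝ᵥ v) ≤ v ⬝ᵥ M i *ᵥ v := by
  choose ε hε hle using fun i => exists_smul_dotProduct_le_dotProduct_mulVec (hM i)
  obtain ⟨⟨δ, hδ⟩, hδε⟩ := Finite.exists_ge fun i => (⟨ε i, hε i⟩ : Ioi (0 : ℝ))
  exact ⟨δ, hδ, fun i v => (mul_le_mul_of_nonneg_right (Subtype.coe_le_coe.2 (hδε i))
    (dotProduct_self_nonneg v)).trans (hle i v)⟩

end QuadraticForm

/-! ### Absolutely continuous functions -/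

lemma intervalIntegrable_fun_sum {E κ : Type*} [NormedAddCommGroup E] {s : Finset κ}
    {f : κ → ℝ → E} {a b : ℝ} (h : ∀ k ∈ s, IntervalIntegrable (f k) volume a b) :
    IntervalIntegrable (fun t => ∑ k ∈ s, f k t) volume a b := by
  simpa only [Finset.sum_fn] using IntervalIntegrable.sum s h

/-- `F` is an absolutely continuous function with the locally integrable derivative `f`, expressed
through the fundamental theorem of calculus. -/
structure IsPrimitive {E : Type*} [NormedAddCommGroup E] [NormedSpace ℝ E] (F f : ℝ → E) :
    Prop where
  intervalIntegrable : ∀ a b, IntervalIntegrable f volume a b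
  integral_eq_sub : ∀ a b, ∫ s in a..b, f s = F b - F a

lemma integral_mul_add_mul_of_primitive {F G f g : ℝ → ℝ} {a b : ℝ}
    (hf : IntervalIntegrable f volume a b) (hg : IntervalIntegrable g volume a b)
    (hF : ∀ x ∈ uIcc a b, F x = F a + ∫ s in a..x, f s)
    (hG : ∀ x ∈ uIcc a b, G x = G a + ∫ s in a..x, g s) :
    ∫ x in a..b, (f x * G x + F x * g x) = F b * G b - F a * G a := by
  have hac (c : ℝ) {h : ℝ → ℝ} (hh : IntervalIntegrable h volume a b) :
      AbsolutelyContinuousOnInterval (fun x => c + ∫ s in a..x, h s) a b :=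
    ((LipschitzWith.const c).lipschitzOnWith.absolutelyContinuousOnInterval (K := 0)).fun_add
      (hh.absolutelyContinuousOnInterval_intervalIntegral left_mem_uIcc)
  have key := (hac (F a) hf).integral_deriv_mul_eq_sub (hac (G a) hg)
  simp only [intervalIntegral.integral_same, add_zero] at key
  rw [hF b right_mem_uIcc, hG b right_mem_uIcc, ← key]
  apply intervalIntegral.integral_congr_ae
  filter_upwards [hf.ae_hasDerivAt_integral, hg.ae_hasDerivAt_integral] with x h1 h2 hx
  have hx' := uIoc_subset_uIcc hx
  rw [((h1 hx' a left_mem_uIcc).const_add (F a)).deriv,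
    ((h2 hx' a left_mem_uIcc).const_add (G a)).deriv, ← hF x hx', ← hG x hx']

namespace IsPrimitive

section Normed

variable {E E' : Type*} [NormedAddCommGroup E] [NormedSpace ℝ E] [NormedAddCommGroup E']
  [NormedSpace ℝ E'] {F G f g : ℝ → E} {F₁ G₁ f₁ g₁ : ℝ → ℝ}

lemma eq_add_integral (h : IsPrimitive F f) (a b : ℝ) : F b = F a + ∫ s in a..b, f s := by
  rw [h.integral_eq_sub, add_sub_cancel]

lemma continuous (h : IsPrimitive F f) : Continuous F := by
  rw [funext (h.eq_add_integral 0)]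
  exact continuous_const.add (intervalIntegral.continuous_primitive h.intervalIntegrable 0)

protected lemma integral (hf : ∀ a b, IntervalIntegrable f volume a b) (c : ℝ) :
    IsPrimitive (fun t => ∫ s in c..t, f s) f where
  intervalIntegrable := hf
  integral_eq_sub a b := by
    rw [intervalIntegral.integral_interval_sub_left (hf c b) (hf c a)]

protected lemma id : IsPrimitive (fun t : ℝ => t) fun _ => 1 where
  intervalIntegrable _ _ := intervalIntegrable_const
  integral_eq_sub a b := by simp

lemma add (hF : IsPrimitive F f) (hG : IsPrimitive G g) :
    IsPrimitive (fun t => F t + G t) fun t => f t + g t where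
  intervalIntegrable a b := (hF.intervalIntegrable a b).add (hG.intervalIntegrable a b)
  integral_eq_sub a b := by
    rw [intervalIntegral.integral_add (hF.intervalIntegrable a b) (hG.intervalIntegrable a b),
      hF.integral_eq_sub, hG.integral_eq_sub]
    abel

lemma const_smul (hF : IsPrimitive F f) (c : ℝ) :
    IsPrimitive (fun t => c • F t) fun t => c • f t where
  intervalIntegrable a b := (hF.intervalIntegrable a b).smul c
  integral_eq_sub a b := by
    rw [intervalIntegral.integral_smul, hF.integral_eq_sub, smul_sub]

lemma sub (hF : IsPrimitive F f) (hG : IsPrimitive G g) :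
    IsPrimitive (fun t => F t - G t) fun t => f t - g t := by
  simpa only [neg_one_smul, ← sub_eq_add_neg] using hF.add (hG.const_smul (-1))

lemma sub_const (hF : IsPrimitive F f) (v : E) : IsPrimitive (fun t => F t - v) f where
  intervalIntegrable := hF.intervalIntegrable
  integral_eq_sub a b := by rw [hF.integral_eq_sub, sub_sub_sub_cancel_right]

protected lemma sum {κ : Type*} {s : Finset κ} {F f : κ → ℝ → E}
    (h : ∀ k ∈ s, IsPrimitive (F k) (f k)) :
    IsPrimitive (fun t => ∑ k ∈ s, F k t) fun t => ∑ k ∈ s, f k t where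
  intervalIntegrable a b :=
    intervalIntegrable_fun_sum fun k hk => (h k hk).intervalIntegrable a b
  integral_eq_sub a b := by
    rw [intervalIntegral.integral_finsetSum fun k hk => (h k hk).intervalIntegrable a b,
      ← Finset.sum_sub_distrib]
    exact Finset.sum_congr rfl fun k hk => (h k hk).integral_eq_sub a b

lemma comp_sub_right (h : IsPrimitive F f) (c : ℝ) :
    IsPrimitive (fun t => F (t - c)) fun t => f (t - c) where
  intervalIntegrable a b := by
    simpa using (h.intervalIntegrable (a - c) (b - c)).comp_sub_right c
  integral_eq_sub a b := by
    rw [intervalIntegral.integral_comp_sub_right, h.integral_eq_sub]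

lemma clm_comp [CompleteSpace E] [CompleteSpace E'] (h : IsPrimitive F f) (L : E →L[ℝ] E') :
    IsPrimitive (fun t => L (F t)) fun t => L (f t) where
  intervalIntegrable a b := ⟨L.integrable_comp (h.intervalIntegrable a b).1,
    L.integrable_comp (h.intervalIntegrable a b).2⟩
  integral_eq_sub a b := by
    rw [L.intervalIntegral_comp_comm (h.intervalIntegrable a b), h.integral_eq_sub, map_sub]

lemma slidingIntegral {φ : ℝ → ℝ} (hφ : Continuous φ) (τ : ℝ) :
    IsPrimitive (fun t => ∫ s in (t - τ)..t, φ s) fun t => φ t - φ (t - τ) := by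
  have hi := hφ.intervalIntegrable (μ := volume)
  have h := IsPrimitive.integral hi 0
  have hwindow (t : ℝ) : ∫ s in (t - τ)..t, φ s =
      (∫ s in (0 : ℝ)..t, φ s) - ∫ s in (0 : ℝ)..(t - τ), φ s :=
    (intervalIntegral.integral_interval_sub_left (hi _ _) (hi _ _)).symm
  simpa only [← hwindow] using h.sub (h.comp_sub_right τ)

lemma mul (hF : IsPrimitive F₁ f₁) (hG : IsPrimitive G₁ g₁) :
    IsPrimitive (fun t => F₁ t * G₁ t) fun t => f₁ t * G₁ t + F₁ t * g₁ t where
  intervalIntegrable a b :=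
    ((hF.intervalIntegrable a b).mul_continuousOn hG.continuous.continuousOn).add
      ((hG.intervalIntegrable a b).continuousOn_mul hF.continuous.continuousOn)
  integral_eq_sub a b :=
    integral_mul_add_mul_of_primitive (hF.intervalIntegrable a b) (hG.intervalIntegrable a b)
      (fun x _ => hF.eq_add_integral a x) fun x _ => hG.eq_add_integral a x

lemma sub_le_sub_of_le (hF : IsPrimitive F₁ f₁) (hG : IsPrimitive G₁ g₁) {a b : ℝ} (hab : a ≤ b)
    (h : ∀ t, f₁ t ≤ g₁ t) : F₁ b - F₁ a ≤ G₁ b - G₁ a := by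
  rw [← hF.integral_eq_sub, ← hG.integral_eq_sub]
  exact intervalIntegral.integral_mono_on hab (hF.intervalIntegrable a b)
    (hG.intervalIntegrable a b) fun t _ => h t

lemma monotone_of_nonneg (hF : IsPrimitive F₁ f₁) (h : ∀ t, 0 ≤ f₁ t) : Monotone F₁ :=
  fun a b hab => by
    have := intervalIntegral.integral_nonneg (μ := volume) hab fun t _ => h t
    rw [hF.integral_eq_sub] at this
    linarith

end Normed

section Vector

variable {ι ι' : Type*} [Fintype ι] [Fintype ι'] {z f : ℝ → ι → ℝ} {z' f' : ℝ → ι → ℝ}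

lemma mulVec (h : IsPrimitive z f) (M : Matrix ι' ι ℝ) :
    IsPrimitive (fun t => M *ᵥ z t) fun t => M *ᵥ f t :=
  h.clm_comp (LinearMap.toContinuousLinearMap M.mulVecLin)

lemma eval (h : IsPrimitive z f) (c : ι) : IsPrimitive (fun t => z t c) fun t => f t c :=
  h.clm_comp (ContinuousLinearMap.proj (R := ℝ) (φ := fun _ : ι => ℝ) c)

lemma dotProduct (h : IsPrimitive z f) (h' : IsPrimitive z' f') :
    IsPrimitive (fun t => z t ⬝ᵥ z' t) fun t => f t ⬝ᵥ z' t + z t ⬝ᵥ f' t := by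
  simpa only [_root_.dotProduct, ← Finset.sum_add_distrib] using
    IsPrimitive.sum (s := Finset.univ) fun c _ => (h.eval c).mul (h'.eval c)

lemma const_dotProduct (h : IsPrimitive z f) (v : ι → ℝ) :
    IsPrimitive (fun t => v ⬝ᵥ z t) fun t => v ⬝ᵥ f t := by
  simpa only [_root_.dotProduct, smul_eq_mul] using
    IsPrimitive.sum (s := Finset.univ) fun c _ => (h.eval c).const_smul (v c)

lemma quadraticForm (h : IsPrimitive z f) {M : Matrix ι ι ℝ} (hM : M.IsHermitian) :
    IsPrimitive (fun t => z t ⬝ᵥ M *ᵥ z t) fun t => 2 * (z t ⬝ᵥ M *ᵥ f t) := by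
  simpa only [dotProduct_mulVec_comm_of_isHermitian hM (f _) (z _), ← two_mul] using
    h.dotProduct (h.mulVec M)

end Vector

end IsPrimitive

/-! ### Wirtinger's inequality -/

section Wirtinger

variable {ι : Type*} [Fintype ι] {z f : ℝ → ι → ℝ} {W : Matrix ι ι ℝ} {a b c : ℝ}

lemma hasDerivAt_mul_tan_mul_sub {t : ℝ} (h : Real.cos (c * (b - t)) ≠ 0) :
    HasDerivAt (fun t => c * Real.tan (c * (b - t)))
      (-c ^ 2 - (c * Real.tan (c * (b - t))) ^ 2) t := by
  refine (((Real.hasDerivAt_tan h).comp t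
    (((hasDerivAt_id t).const_sub b).const_mul c)).const_mul c).congr_deriv ?_
  rw [← Real.inv_one_add_tan_sq h, one_div, inv_inv]
  ring

lemma riccati_quadraticForm_le (hW : W.PosSemidef) (c r : ℝ) (u v : ι → ℝ) :
    (-c ^ 2 - r ^ 2) * (u ⬝ᵥ W *ᵥ u) + r * (2 * (u ⬝ᵥ W *ᵥ v)) ≤
      v ⬝ᵥ W *ᵥ v - c ^ 2 * (u ⬝ᵥ W *ᵥ u) := by
  have h := dotProduct_mulVec_self_nonneg hW (v - r • u)
  rw [sub_dotProduct_mulVec_sub hW.1] at h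
  simp only [mulVec_smul, smul_dotProduct, dotProduct_smul, smul_eq_mul,
    dotProduct_mulVec_comm_of_isHermitian hW.1 v u] at h
  linarith

namespace IsPrimitive

lemma sq_mul_integral_le_of_riccati (h : IsPrimitive z f) (hW : W.PosSemidef)
    (hf : IntervalIntegrable (fun t => f t ⬝ᵥ W *ᵥ f t) volume a b) (hab : a ≤ b) {φ : ℝ → ℝ}
    (hφ : ∀ t ∈ uIcc a b, HasDerivAt φ (-c ^ 2 - φ t ^ 2) t) (hb : φ b = 0) (ha : z a = 0) :
    c ^ 2 * ∫ t in a..b, z t ⬝ᵥ W *ᵥ z t ≤ ∫ t in a..b, f t ⬝ᵥ W *ᵥ f t := by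
  have hφc : ContinuousOn φ (uIcc a b) := fun t ht => (hφ t ht).continuousAt.continuousWithinAt
  have hφ'c : ContinuousOn (fun t => -c ^ 2 - φ t ^ 2) (uIcc a b) := by fun_prop
  have hq := h.quadraticForm hW.1
  have hqi := (hq.continuous.intervalIntegrable (μ := volume) a b).const_mul (c ^ 2)
  have hparts := integral_mul_add_mul_of_primitive hφ'c.intervalIntegrable
    (hq.intervalIntegrable a b)
    (fun x hx => by
      rw [intervalIntegral.integral_eq_sub_of_hasDerivAt
        (fun t ht => hφ t (uIcc_subset_uIcc_left hx ht))
        (hφ'c.mono (uIcc_subset_uIcc_left hx)).intervalIntegrable, add_sub_cancel])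
    fun x _ => hq.eq_add_integral a x
  simp only [hb, ha, mulVec_zero, dotProduct_zero, zero_mul, mul_zero, sub_zero] at hparts
  have hle := intervalIntegral.integral_mono_on hab
    ((hφ'c.fun_mul hq.continuous.continuousOn).intervalIntegrable.add
      ((hq.intervalIntegrable a b).continuousOn_mul hφc)) (hf.sub hqi)
    fun t _ => riccati_quadraticForm_le hW c (φ t) (z t) (f t)
  rw [hparts, intervalIntegral.integral_sub hf hqi, intervalIntegral.integral_const_mul] at hle
  linarith

lemma sq_mul_integral_le_of_mul_lt (h : IsPrimitive z f) (hW : W.PosSemidef)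
    (hf : IntervalIntegrable (fun t => f t ⬝ᵥ W *ᵥ f t) volume a b) (hab : a ≤ b) (hc : 0 ≤ c)
    (hcb : c * (b - a) < Real.pi / 2) (ha : z a = 0) :
    c ^ 2 * ∫ t in a..b, z t ⬝ᵥ W *ᵥ z t ≤ ∫ t in a..b, f t ⬝ᵥ W *ᵥ f t := by
  refine h.sq_mul_integral_le_of_riccati hW hf hab
    (fun t ht => hasDerivAt_mul_tan_mul_sub (b := b) (Real.cos_pos_of_mem_Ioo ⟨?_, ?_⟩).ne')
    (by simp) ha
  all_goals rw [uIcc_of_le hab] at ht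
  · linarith [mul_nonneg hc (sub_nonneg.2 ht.2), Real.pi_pos]
  · exact (mul_le_mul_of_nonneg_left (sub_le_sub_left ht.1 b) hc).trans_lt hcb

/-- The sharp constant is `π / (2 (b - a))`, the first blow-up of the Riccati solution, and is
reached as the limit `r → 1`. -/
lemma wirtinger (h : IsPrimitive z f) (hW : W.PosSemidef)
    (hf : IntervalIntegrable (fun t => f t ⬝ᵥ W *ᵥ f t) volume a b) (hab : a ≤ b) (ha : z a = 0) :
    Real.pi ^ 2 / 4 * ∫ t in a..b, z t ⬝ᵥ W *ᵥ z t ≤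
      (b - a) ^ 2 * ∫ t in a..b, f t ⬝ᵥ W *ᵥ f t := by
  rcases hab.eq_or_lt with rfl | hlt
  · simp
  have hL : 0 < b - a := sub_pos.2 hlt
  set c : ℝ := Real.pi / (2 * (b - a)) with hc
  have hcL : c * (b - a) = Real.pi / 2 := by rw [hc]; field_simp
  have hc0 : 0 < c := div_pos Real.pi_pos (mul_pos two_pos hL)
  have hsharp : (1 * c) ^ 2 * ∫ t in a..b, z t ⬝ᵥ W *ᵥ z t ≤ ∫ t in a..b, f t ⬝ᵥ W *ᵥ f t := by
    refine le_of_tendsto ((Continuous.tendsto (f := fun r : ℝ =>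
      (r * c) ^ 2 * ∫ t in a..b, z t ⬝ᵥ W *ᵥ z t) (by fun_prop) 1).mono_left
      (nhdsWithin_le_nhds (s := Iio 1))) ?_
    filter_upwards [Ioo_mem_nhdsLT (zero_lt_one' ℝ)] with r hr
    refine h.sq_mul_integral_le_of_mul_lt hW hf hab (mul_nonneg hr.1.le hc0.le) ?_ ha
    rw [mul_assoc, hcL]
    exact mul_lt_of_lt_one_left (by positivity) hr.2
  calc Real.pi ^ 2 / 4 * ∫ t in a..b, z t ⬝ᵥ W *ᵥ z t
      = (b - a) ^ 2 * ((1 * c) ^ 2 * ∫ t in a..b, z t ⬝ᵥ W *ᵥ z t) := by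
        rw [show Real.pi = 2 * (c * (b - a)) by rw [hcL]; ring]
        ring
    _ ≤ _ := by gcongr

end IsPrimitive

end Wirtinger

/-! ### Reciprocally convex combinations -/

namespace IsPrimitive

variable {ι : Type*} [Fintype ι] {z f : ℝ → ι → ℝ} {R G : Matrix ι ι ℝ} {E : ℝ → ℝ}

lemma two_mul_sub_dotProduct_mulVec_sub_le (h : IsPrimitive z f)
    (hE : IsPrimitive E fun t => f t ⬝ᵥ R *ᵥ f t) {M : Matrix ι ι ℝ}
    (hRM : ∀ u v, 2 * (u ⬝ᵥ M *ᵥ v) ≤ u ⬝ᵥ R *ᵥ u + v ⬝ᵥ R *ᵥ v) {a b c d : ℝ} (hab : a ≤ b)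
    (hcd : c ≤ d) :
    2 * ((z b - z a) ⬝ᵥ M *ᵥ (z d - z c)) ≤ (d - c) * (E b - E a) + (b - a) * (E d - E c) := by
  have hfirst (v : ι → ℝ) :
      2 * ((z b - z a) ⬝ᵥ M *ᵥ v) ≤ E b - E a + (b - a) * (v ⬝ᵥ R *ᵥ v) := by
    have := ((h.const_dotProduct (M *ᵥ v)).const_smul 2).sub_le_sub_of_le
      (hE.add (IsPrimitive.id.const_smul (v ⬝ᵥ R *ᵥ v))) hab fun t => by
        simpa [dotProduct_comm] using hRM (f t) v
    simp only [smul_eq_mul, dotProduct_comm (M *ᵥ v)] at this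
    rw [sub_dotProduct]
    linarith
  have := (((h.mulVec M).const_dotProduct (z b - z a)).const_smul 2).sub_le_sub_of_le
    ((IsPrimitive.id.const_smul (E b - E a)).add (hE.const_smul (b - a))) hcd fun t => by
      simpa using hfirst (f t)
  simp only [smul_eq_mul] at this
  rw [mulVec_sub, dotProduct_sub]
  linarith

/-- The reciprocally convex combination inequality of Park, Ko and Jeong for the partition
`x 0 ≥ x 1 ≥ ⋯ ≥ x (p + 1)`; `E` is a primitive of the energy density. -/
lemma sum_sub_dotProduct_mulVec_sub_le (h : IsPrimitive z f)
    (hE : IsPrimitive E fun t => f t ⬝ᵥ R *ᵥ f t) (hR : R.PosSemidef)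
    (hRG : (fromBlocks R G Gᵀ R).PosSemidef) (p : ℕ) {x : ℕ → ℝ} (hx : Antitone x) :
    ∑ a : Fin (p + 1), ∑ b : Fin (p + 1), (z (x a) - z (x (a + 1))) ⬝ᵥ
        (if a = b then R else (1 / 2 : ℝ) • (G + Gᵀ)) *ᵥ (z (x b) - z (x (b + 1))) ≤
      (x 0 - x (p + 1)) * (E (x 0) - E (x (p + 1))) := by
  have htelescope (φ : ℝ → ℝ) :
      ∑ a : Fin (p + 1), (φ (x a) - φ (x (a + 1))) = φ (x 0) - φ (x (p + 1)) := by
    rw [Fin.sum_univ_eq_sum_range fun a => φ (x a) - φ (x (a + 1)), Finset.sum_range_sub']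
  have hpair (a b : Fin (p + 1)) : (z (x a) - z (x (a + 1))) ⬝ᵥ
        (if a = b then R else (1 / 2 : ℝ) • (G + Gᵀ)) *ᵥ (z (x b) - z (x (b + 1))) ≤
      (1 / 2) * ((x b - x (b + 1)) * (E (x a) - E (x (a + 1))) +
        (x a - x (a + 1)) * (E (x b) - E (x (b + 1)))) := by
    have hM (u v : ι → ℝ) : 2 * (u ⬝ᵥ (if a = b then R else (1 / 2 : ℝ) • (G + Gᵀ)) *ᵥ v) ≤
        u ⬝ᵥ R *ᵥ u + v ⬝ᵥ R *ᵥ v := by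
      split_ifs
      exacts [two_mul_dotProduct_mulVec_le hR u v, two_mul_dotProduct_symmetrized_mulVec_le hRG u v]
    linarith [h.two_mul_sub_dotProduct_mulVec_sub_le hE hM (hx (Nat.le_succ a))
      (hx (Nat.le_succ b))]
  refine (Finset.sum_le_sum fun a _ => Finset.sum_le_sum fun b _ => hpair a b).trans_eq ?_
  rw [← htelescope E, ← htelescope fun t => t]
  simp only [← Finset.mul_sum, Finset.sum_add_distrib, ← Finset.sum_mul]
  ring

end IsPrimitive

/-! ### Square integrable derivatives -/

section HasL2Deriv

variable {ι ι' : Type*} [Fintype ι] [Fintype ι']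

lemma integrable_dotProduct_of_memLp {α : Type*} [MeasurableSpace α] {μ : Measure α}
    {u v : α → ι → ℝ} (hu : MemLp u 2 μ) (hv : MemLp v 2 μ) :
    Integrable (fun t => u t ⬝ᵥ v t) μ :=
  integrable_finsetSum _ fun c _ => (hu.eval c).integrable_mul (hv.eval c)

lemma memLp_mulVec {α : Type*} [MeasurableSpace α] {μ : Measure α} {q : ℝ≥0∞} {u : α → ι → ℝ}
    (hu : MemLp u q μ) (M : Matrix ι' ι ℝ) : MemLp (fun t => M *ᵥ u t) q μ :=
  (LinearMap.toContinuousLinearMap M.mulVecLin).comp_memLp' hu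

/-- `z` is an absolutely continuous function whose derivative `f` is locally square integrable. -/
structure HasL2Deriv (z f : ℝ → ι → ℝ) : Prop where
  memLp : ∀ a b, MemLp f 2 (volume.restrict (Ioc a b))
  integral_eq_sub : ∀ a b, ∫ s in a..b, f s = z b - z a

namespace HasL2Deriv

variable {z f : ℝ → ι → ℝ}

lemma isPrimitive (h : HasL2Deriv z f) : IsPrimitive z f where
  intervalIntegrable a b :=
    ⟨(h.memLp a b).integrable one_le_two, (h.memLp b a).integrable one_le_two⟩
  integral_eq_sub := h.integral_eq_sub

lemma continuous (h : HasL2Deriv z f) : Continuous z := h.isPrimitive.continuous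

lemma intervalIntegrable_quadraticForm (h : HasL2Deriv z f) (M : Matrix ι ι ℝ) (a b : ℝ) :
    IntervalIntegrable (fun t => f t ⬝ᵥ M *ᵥ f t) volume a b :=
  ⟨integrable_dotProduct_of_memLp (h.memLp a b) (memLp_mulVec (h.memLp a b) M),
    integrable_dotProduct_of_memLp (h.memLp b a) (memLp_mulVec (h.memLp b a) M)⟩

lemma intervalIntegrable_dotProduct_self (h : HasL2Deriv z f) (a b : ℝ) :
    IntervalIntegrable (fun t => f t ⬝ᵥ f t) volume a b := by
  classical simpa only [one_mulVec] using h.intervalIntegrable_quadraticForm 1 a b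

lemma isPrimitive_energy (h : HasL2Deriv z f) (M : Matrix ι ι ℝ) (c : ℝ) :
    IsPrimitive (fun t => ∫ s in c..t, f s ⬝ᵥ M *ᵥ f s) fun t => f t ⬝ᵥ M *ᵥ f t :=
  IsPrimitive.integral (h.intervalIntegrable_quadraticForm M) c

end HasL2Deriv

end HasL2Deriv

/-! ### The round-robin schedule -/

section Polling

lemma shiftPerm_append_singleton {V : Type} (l : List V) (x : V) :
    shiftPerm (l ++ [x]) = x :: l := by
  rcases l with _ | ⟨y, l⟩
  · rfl
  · simp [shiftPerm, List.rotateRight]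

lemma shiftPerm_perm {V : Type} (l : List V) : (shiftPerm l).Perm l := by
  rcases List.eq_nil_or_concat' l with rfl | ⟨l, x, rfl⟩
  · simp [shiftPerm, List.rotateRight]
  · rw [shiftPerm_append_singleton]
    exact (List.perm_append_singleton x l).symm

lemma idxOf_shiftPerm {V : Type} [DecidableEq V] {l : List V} (hl : l.Nodup) {x : V} (hx : x ∈ l) :
    (shiftPerm l).idxOf x = if l.idxOf x + 1 < l.length then l.idxOf x + 1 else 0 := by
  obtain ⟨l, y, rfl⟩ := (List.eq_nil_or_concat' l).resolve_left (List.ne_nil_of_mem hx)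
  rw [shiftPerm_append_singleton]
  have hl' : y ∉ l := fun h => List.disjoint_of_nodup_append hl h (List.mem_singleton_self y)
  rcases eq_or_ne y x with rfl | hxy
  · simp [List.idxOf_append_of_notMem hl']
  · have hx' : x ∈ l := (List.mem_append.1 hx).resolve_right (by simpa using hxy.symm)
    simp [List.idxOf_cons_ne _ hxy, List.idxOf_append_of_mem hx', List.idxOf_lt_length_iff.2 hx']

variable {N : ℕ} (G : Digraph (Fin N)) (i : Fin N)

lemma pollOrder_succ (k : ℕ) : pollOrder G i (k + 1) = shiftPerm (pollOrder G i k) :=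
  Function.iterate_succ_apply' _ _ _

lemma pollOrder_perm (k : ℕ) : (pollOrder G i k).Perm ((nbhd G i).sort (· ≤ ·)) := by
  induction k with
  | zero => exact List.Perm.refl _
  | succ k ih => exact pollOrder_succ G i k ▸ (shiftPerm_perm _).trans ih

lemma pollOrder_nodup (k : ℕ) : (pollOrder G i k).Nodup :=
  (pollOrder_perm G i k).nodup_iff.2 (Finset.sort_nodup _ _)

lemma mem_pollOrder (k : ℕ) {j : Fin N} : j ∈ pollOrder G i k ↔ j ∈ nbhd G i := by
  rw [(pollOrder_perm G i k).mem_iff, Finset.mem_sort]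

lemma length_pollOrder (k : ℕ) : (pollOrder G i k).length = inDeg G i := by
  rw [(pollOrder_perm G i k).length_eq, Finset.length_sort, inDeg]

lemma one_le_pollIndex (k : ℕ) (j : Fin N) : 1 ≤ pollIndex G i k j := Nat.le_add_left _ _

lemma pollIndex_le (k : ℕ) {j : Fin N} (hj : j ∈ nbhd G i) : pollIndex G i k j ≤ inDeg G i :=
  length_pollOrder G i k ▸ List.idxOf_lt_length_iff.2 ((mem_pollOrder G i k).2 hj)

lemma pollIndex_succ (k : ℕ) {j : Fin N} (hj : j ∈ nbhd G i) :
    pollIndex G i (k + 1) j = pollIndex G i k j + 1 ∨ pollIndex G i (k + 1) j = 1 := by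
  rw [pollIndex, pollOrder_succ,
    idxOf_shiftPerm (pollOrder_nodup G i k) ((mem_pollOrder G i k).2 hj)]
  split_ifs
  exacts [Or.inl rfl, Or.inr rfl]

lemma sum_pollIndex {E : Type*} [AddCommMonoid E] (k : ℕ) (φ : ℕ → E) :
    ∑ j ∈ nbhd G i, φ (pollIndex G i k j) = ∑ ν : Fin (inDeg G i), φ (ν + 1) := by
  have hn := pollOrder_nodup G i k
  have hnbhd : nbhd G i = (pollOrder G i k).toFinset := by
    ext j
    rw [List.mem_toFinset, mem_pollOrder]
  have hmap : (pollOrder G i k).map (fun j => φ (pollIndex G i k j)) =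
      List.ofFn fun ν : Fin (pollOrder G i k).length => φ (ν + 1) :=
    List.ext_getElem (by simp) fun m _ _ => by simp [pollIndex, hn.idxOf_getElem]
  rw [hnbhd, List.sum_toFinset _ hn, hmap, List.sum_ofFn, length_pollOrder]

lemma sum_nbr {E : Type*} [AddCommMonoid E] (φ : Fin N → E) :
    ∑ ν, φ (nbr G i ν) = ∑ j ∈ nbhd G i, φ j := by
  rw [← Finset.sum_coe_sort (nbhd G i) φ]
  exact Fintype.sum_equiv ((nbhd G i).orderIsoOfFin rfl).toEquiv _ _ fun _ => rfl

lemma sum_nbhd_comm {E : Type*} [AddCommMonoid E] (φ : Fin N → Fin N → E) :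
    ∑ i, ∑ j ∈ nbhd G i, φ i j = ∑ j, ∑ i ∈ outNbhd G j, φ i j :=
  Finset.sum_comm' fun i j => by simp [outNbhd]

end Polling

section Sampling

variable {N n mw mv : ℕ} (S : Network N n mw mv)

namespace Network

lemma tExt_mono : Monotone S.tExt := fun _ _ h => S.t_strictMono.monotone (Int.toNat_le_toNat h)

lemma tExt_natCast (k : ℕ) : S.tExt k = S.t k := by simp [tExt]

lemma t_nonneg (k : ℕ) : 0 ≤ S.t k := S.t_zero ▸ S.t_strictMono.monotone (Nat.zero_le k)

variable (i : Fin N)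

lemma sampleTime_le (k : ℕ) (j : Fin N) : S.sampleTime i k j ≤ S.t k := by
  rw [← S.tExt_natCast k]
  refine S.tExt_mono ?_
  have := one_le_pollIndex S.graph i k j
  omega

lemma sampleTime_nonneg (k : ℕ) (j : Fin N) : 0 ≤ S.sampleTime i k j := S.t_nonneg _

lemma sampleTime_succ (k : ℕ) {j : Fin N} (hj : j ∈ nbhd S.graph i) :
    S.sampleTime i (k + 1) j = S.sampleTime i k j ∨ S.sampleTime i (k + 1) j = S.t (k + 1) := by
  rw [sampleTime, sampleTime, ← S.tExt_natCast (k + 1)]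
  refine (pollIndex_succ S.graph i k hj).imp (fun h => ?_) fun h => ?_
  all_goals rw [h]; congr 1; push_cast; ring

lemma sum_sampleTime {E : Type*} [AddCommMonoid E] (k : ℕ) (φ : ℝ → E) :
    ∑ j ∈ nbhd S.graph i, φ (S.sampleTime i k j) =
      ∑ ν : Fin (S.p i), φ (S.tExt ((k : ℤ) - (ν : ℕ))) := by
  refine (sum_pollIndex S.graph i k fun m : ℕ => φ (S.tExt ((k : ℤ) - m + 1))).trans
    (Finset.sum_congr rfl fun ν _ => ?_)
  congr 2
  push_cast
  ring

lemma τ_le_τmax : S.τ i ≤ S.τmax := le_ciSup (Set.finite_range _).bddAbove i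

variable {i} (hτ : BddAbove (range (S.pollGap i)))

include hτ

lemma t_succ_sub_τ_le (k : ℕ) : S.t (k + 1) - S.τ i ≤ S.tExt ((k : ℤ) - S.p i + 1) :=
  sub_le_comm.1 (le_ciSup hτ k)

lemma τ_nonneg : 0 ≤ S.τ i := by
  have h := S.t_succ_sub_τ_le hτ 0
  have hle : S.tExt (((0 : ℕ) : ℤ) - S.p i + 1) ≤ S.t (0 + 1) := by
    rw [← S.tExt_natCast (0 + 1)]
    exact S.tExt_mono (by push_cast; omega)
  linarith

lemma t_succ_sub_τ_le_sampleTime (k : ℕ) {j : Fin N} (hj : j ∈ nbhd S.graph i) :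
    S.t (k + 1) - S.τ i ≤ S.sampleTime i k j := by
  refine (S.t_succ_sub_τ_le hτ k).trans (S.tExt_mono ?_)
  have := pollIndex_le S.graph i k hj
  rw [p]
  omega

omit hτ

variable (i)

/-- The partition points `t ≥ t_k ≥ t_{k-1} ≥ ⋯ ≥ t_{k-p_i+1} ≥ t - τ_i` of the delay window of
node `i` on the `k`-th sampling interval, extended by the constant `t - τ_i`. -/
def knot (k : ℕ) (t : ℝ) : ℕ → ℝ
  | 0 => t
  | m + 1 => if m < S.p i then S.tExt ((k : ℤ) - m) else t - S.τ i

lemma knot_last (k : ℕ) (t : ℝ) : S.knot i k t (S.p i + 1) = t - S.τ i := by simp [knot]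

variable {i}

lemma antitone_knot (hτ : BddAbove (range (S.pollGap i))) {k : ℕ} {t : ℝ}
    (ht : t ∈ Icc (S.t k) (S.t (k + 1))) : Antitone (S.knot i k t) := by
  refine antitone_nat_of_succ_le fun m => ?_
  have hpoll := S.t_succ_sub_τ_le hτ k
  rcases m with _ | m <;> simp only [knot]
  · split_ifs
    · simpa [tExt_natCast] using ht.1
    · linarith [S.τ_nonneg hτ]
  · split_ifs with h1 h2 h2
    · exact S.tExt_mono (by push_cast; omega)
    · omega
    · have : S.tExt ((k : ℤ) - S.p i + 1) ≤ S.tExt ((k : ℤ) - m) := S.tExt_mono (by omega)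
      linarith [ht.2]
    · exact le_rfl

end Network

end Sampling

/-! ### The quadratic form of `Ξ_i` -/

section BlockForms

variable {m m' m'' κ κ' : Type} [Fintype m'] {p n : ℕ}

/-- The block vector with the blocks `v ν`, on which the matrices of `1_p' ⊗ M` type act. -/
def stack (v : κ → m → ℝ) (a : κ × m) : ℝ := v a.1 a.2

lemma rowRep_mulVec_stack (M : Matrix m m' ℝ) (v : Fin p → m' → ℝ) :
    rowRep p M *ᵥ stack v = M *ᵥ ∑ ν, v ν := by
  ext a
  simp only [mulVec, dotProduct, rowRep, of_apply, stack, Fintype.sum_prod_type, Finset.sum_apply,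
    Finset.mul_sum]
  exact Finset.sum_comm

variable [Fintype m] [Fintype κ] [Fintype κ']

lemma dotProduct_symBlock_mulVec (E : Matrix m m ℝ) (F : Matrix m m' ℝ) (D : Matrix m' m' ℝ)
    (u : m → ℝ) (v : m' → ℝ) :
    Sum.elim u v ⬝ᵥ symBlock E F D *ᵥ Sum.elim u v =
      u ⬝ᵥ E *ᵥ u + 2 * (u ⬝ᵥ F *ᵥ v) + v ⬝ᵥ D *ᵥ v := by
  simp only [symBlock, fromBlocks_mulVec, Sum.elim_comp_inl, Sum.elim_comp_inr,
    sumElim_dotProduct_sumElim, dotProduct_add, dotProduct_mulVec_transpose_comm]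
  ring

lemma dotProduct_colRep_mulVec (M : Matrix m m' ℝ) (u : Fin p → m → ℝ) (v : m' → ℝ) :
    stack u ⬝ᵥ colRep p M *ᵥ v = (∑ ν, u ν) ⬝ᵥ M *ᵥ v := by
  have : colRep p M = (rowRep p Mᵀ)ᵀ := rfl
  rw [this, dotProduct_mulVec_transpose_comm, rowRep_mulVec_stack,
    dotProduct_mulVec_transpose_comm]

lemma dotProduct_sqRep_mulVec (M : Matrix m m' ℝ) (u : Fin p → m → ℝ) (v : Fin p → m' → ℝ) :
    stack u ⬝ᵥ sqRep p M *ᵥ stack v = (∑ ν, u ν) ⬝ᵥ M *ᵥ ∑ ν, v ν := by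
  have : sqRep p M = colRep p (rowRep p M) := rfl
  rw [this, dotProduct_colRep_mulVec, rowRep_mulVec_stack]

lemma dotProduct_mulVec_stack (M : Matrix m (κ × m') ℝ) (u : m → ℝ) (v : κ → m' → ℝ) :
    u ⬝ᵥ M *ᵥ stack v = ∑ b, u ⬝ᵥ M.submatrix id (Prod.mk b) *ᵥ v b := by
  simp only [dotProduct_mulVec_eq_sum, Fintype.sum_prod_type, stack, submatrix_apply, id_eq]
  exact Finset.sum_comm

lemma stack_dotProduct_mulVec (M : Matrix (κ × m) m' ℝ) (u : κ → m → ℝ) (v : m' → ℝ) :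
    stack u ⬝ᵥ M *ᵥ v = ∑ a, u a ⬝ᵥ M.submatrix (Prod.mk a) id *ᵥ v := by
  simp only [dotProduct_mulVec_eq_sum, Fintype.sum_prod_type, stack, submatrix_apply, id_eq]

lemma stack_dotProduct_mulVec_stack (M : Matrix (κ × m) (κ' × m') ℝ) (u : κ → m → ℝ)
    (v : κ' → m' → ℝ) :
    stack u ⬝ᵥ M *ᵥ stack v =
      ∑ a, ∑ b, u a ⬝ᵥ M.submatrix (Prod.mk a) (Prod.mk b) *ᵥ v b := by
  simp only [stack_dotProduct_mulVec, dotProduct_mulVec_stack, submatrix_submatrix,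
    Function.comp_id, Function.id_comp]
  exact Finset.sum_comm

lemma dotProduct_diagBlocks_mulVec (M : Fin p → Matrix (Fin n) (Fin n) ℝ)
    (u v : Fin p → Fin n → ℝ) :
    stack u ⬝ᵥ diagBlocks M *ᵥ stack v = ∑ ν, u ν ⬝ᵥ M ν *ᵥ v ν := by
  have hblock : ∀ a b, (diagBlocks M).submatrix (Prod.mk a) (Prod.mk b) =
      if a = b then M a else 0 := by
    intro a b
    ext x y
    by_cases h : a = b <;> simp [diagBlocks, h]
  simp only [stack_dotProduct_mulVec_stack, hblock]
  refine Finset.sum_congr rfl fun a _ => ?_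
  rw [Finset.sum_eq_single a (fun b _ hb => by simp [hb.symm]) (by simp), if_pos rfl]

lemma dotProduct_Psi_mulVec (R G : Matrix (Fin n) (Fin n) ℝ) (u : Fin (p + 1) → Fin n → ℝ) :
    stack u ⬝ᵥ Psi p R G *ᵥ stack u =
      ∑ a, ∑ b, u a ⬝ᵥ (if a = b then R else (1 / 2 : ℝ) • (G + Gᵀ)) *ᵥ u b := by
  have hblock : ∀ a b, (Psi p R G).submatrix (Prod.mk a) (Prod.mk b) =
      if a = b then R else (1 / 2 : ℝ) • (G + Gᵀ) := by
    intro a b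
    ext x y
    by_cases h : a = b <;> simp [Psi, h]
  simp only [stack_dotProduct_mulVec_stack, hblock]

lemma Psi_isHermitian {R : Matrix (Fin n) (Fin n) ℝ} (hR : R.IsHermitian)
    (G : Matrix (Fin n) (Fin n) ℝ) : (Psi p R G).IsHermitian := by
  ext ⟨a, x⟩ ⟨b, y⟩
  have hxy : R y x = R x y := by simpa using hR.apply x y
  by_cases h : a = b
  · subst h
    simp [Psi, hxy]
  · simp [Psi, h, Ne.symm h, add_comm]

lemma T_mulVec_stack (z : Fin (p + 2) → Fin n → ℝ) :
    T p n *ᵥ stack z = stack fun a : Fin (p + 1) => z a.castSucc - z a.succ := by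
  ext ⟨a, x⟩
  have hne : a.succ ≠ a.castSucc := by simp [Fin.ext_iff]
  simp only [mulVec, dotProduct, T, kroneckerMap_apply, of_apply, stack, Fintype.sum_prod_type,
    one_apply, mul_ite, mul_one, mul_zero, ite_mul, zero_mul, Finset.sum_ite_eq, Finset.mem_univ,
    if_true, one_mul, neg_mul, Pi.sub_apply]
  rw [Finset.sum_eq_add_of_mem a.castSucc a.succ (Finset.mem_univ _) (Finset.mem_univ _) hne.symm]
  · simp [hne, sub_eq_add_neg]
  · rintro b - ⟨h1, h2⟩
    simp [h1, h2]

/-- The sequence `b, c 0, …, c (p - 1), d`, in the proof the values of an error at the instants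
`t`, `t_k`, …, `t_{k-p+1}`, `t - τ`. -/
def chain (b : m → ℝ) (c : Fin p → m → ℝ) (d : m → ℝ) : Fin (p + 2) → m → ℝ :=
  Fin.cons b (Fin.snoc c d : Fin (p + 1) → m → ℝ)

lemma chain_dotProduct_mulVec_chain
    {M : Matrix (Fin (p + 2) × Fin n) (Fin (p + 2) × Fin n) ℝ} (hM : M.IsHermitian)
    (b : Fin n → ℝ) (c : Fin p → Fin n → ℝ) (d : Fin n → ℝ) :
    stack (chain b c d) ⬝ᵥ M *ᵥ stack (chain b c d) =
      b ⬝ᵥ M.submatrix (blk₁ p) (blk₁ p) *ᵥ b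
      + stack c ⬝ᵥ M.submatrix (blk₂ p) (blk₂ p) *ᵥ stack c
      + d ⬝ᵥ M.submatrix (blk₃ p) (blk₃ p) *ᵥ d
      + 2 * (b ⬝ᵥ M.submatrix (blk₁ p) (blk₂ p) *ᵥ stack c)
      + 2 * (b ⬝ᵥ M.submatrix (blk₁ p) (blk₃ p) *ᵥ d)
      + 2 * (stack c ⬝ᵥ M.submatrix (blk₂ p) (blk₃ p) *ᵥ d) := by
  have hsymm : ∀ (x y : Fin (p + 2)) (u v : Fin n → ℝ),
      u ⬝ᵥ M.submatrix (Prod.mk x) (Prod.mk y) *ᵥ v =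
        v ⬝ᵥ M.submatrix (Prod.mk y) (Prod.mk x) *ᵥ u := by
    intro x y u v
    rw [← dotProduct_mulVec_transpose_comm, transpose_submatrix,
      ← conjTranspose_eq_transpose_of_trivial, hM]
  have h₁ : blk₁ p = Prod.mk (β := Fin n) 0 := rfl
  have h₃ : blk₃ p = Prod.mk (β := Fin n) (Fin.last (p + 1)) := rfl
  have h₂ : ∀ ν : Fin p, blk₂ p ∘ Prod.mk ν = Prod.mk (β := Fin n) ν.castSucc.succ :=
    fun ν => rfl
  simp only [dotProduct_mulVec_stack, stack_dotProduct_mulVec, submatrix_submatrix,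
    Function.comp_id, Function.id_comp, h₁, h₂, h₃, chain, Fin.sum_univ_succ (n := p + 1),
    Fin.sum_univ_castSucc (n := p), Fin.cons_zero, Fin.cons_succ, Fin.snoc_castSucc, Fin.snoc_last,
    Fin.succ_last, Finset.sum_add_distrib, hsymm (Fin.last (p + 1)), hsymm _ 0 _ b]
  ring

lemma dotProduct_transpose_mul_mulVec {l : Type} [Fintype l] (M : Matrix l m ℝ)
    (M' : Matrix l m' ℝ) (u : m → ℝ) (v : m' → ℝ) :
    u ⬝ᵥ (Mᵀ * M') *ᵥ v = (M *ᵥ u) ⬝ᵥ (M' *ᵥ v) := by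
  rw [← mulVec_mulVec, dotProduct_mulVec_transpose_comm, dotProduct_comm]

end BlockForms

section XiForm

variable {N n mw mv : ℕ} (S : Network N n mw mv) (g : Gains S) (γ : ℝ) (V : LMIVars N n)
  (i : Fin N)

lemma PsiBar_isHermitian (hR : (V.R i).IsHermitian) : (PsiBar S V i).IsHermitian := by
  have hT := isHermitian_conjTranspose_mul_mul (T (S.p i) n) (Psi_isHermitian hR (V.G i))
  rw [conjTranspose_eq_transpose_of_trivial] at hT
  exact hT.smul (IsSelfAdjoint.all _)

lemma dotProduct_PsiBar_mulVec (z : Fin (S.p i + 2) → Fin n → ℝ) :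
    stack z ⬝ᵥ PsiBar S V i *ᵥ stack z =
      Real.exp (-2 * V.α i * S.τ i) * ∑ x : Fin (S.p i + 1), ∑ y : Fin (S.p i + 1),
        (z x.castSucc - z x.succ) ⬝ᵥ
          (if x = y then V.R i else (1 / 2 : ℝ) • (V.G i + (V.G i)ᵀ)) *ᵥ
            (z y.castSucc - z y.succ) := by
  rw [PsiBar, smul_mulVec, dotProduct_smul, smul_eq_mul, Matrix.mul_assoc,
    dotProduct_transpose_mul_mulVec, ← mulVec_mulVec, T_mulVec_stack, dotProduct_Psi_mulVec]

/-- The block vector `(a, b, c, d, e, f, w)` on which `Ξ_i` acts. -/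
def xiVec (a b : Fin n → ℝ) (c : Fin (S.p i) → Fin n → ℝ) (d : Fin n → ℝ)
    (e f : Fin (S.p i) → Fin n → ℝ) (w : Fin mw ⊕ Fin mv → ℝ) : XiIndex S i → ℝ :=
  Sum.elim a <| Sum.elim b <| Sum.elim (stack c) <| Sum.elim d <| Sum.elim (stack e) <|
    Sum.elim (stack f) w

-- Testing the dynamics against `Z a + X b + Q ∑ f` (the descriptor method) cancels `Z`, `X`, `Q`.
lemma xiVec_dotProduct_Xi_mulVec (hR : (V.R i).IsHermitian) {a b : Fin n → ℝ}
    {c : Fin (S.p i) → Fin n → ℝ} {d : Fin n → ℝ} {e f : Fin (S.p i) → Fin n → ℝ}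
    {w : Fin mw ⊕ Fin mv → ℝ}
    (ha : a = (S.A - g.L i * S.C i) *ᵥ b + (S.B - g.L i * S.D i) *ᵥ w
      + (g.K i * S.H i) *ᵥ (∑ ν, f ν - ∑ ν, c ν)) :
    xiVec S i a b c d e f w ⬝ᵥ Xi S g γ V i *ᵥ xiVec S i a b c d e f w =
      2 * (a ⬝ᵥ (V.Y i)⁻¹ *ᵥ b) + S.τ i ^ 2 * (a ⬝ᵥ V.R i *ᵥ a)
      + (∑ j ∈ outNbhd S.graph i, S.τ j ^ 2) * (a ⬝ᵥ V.W i *ᵥ a)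
      + ((S.p i : ℝ) + S.q i) / γ ^ 2 * (b ⬝ᵥ b) + 2 * V.α i * (b ⬝ᵥ (V.Y i)⁻¹ *ᵥ b)
      + b ⬝ᵥ V.S i *ᵥ b - Real.exp (-2 * V.α i * S.τ i) * (d ⬝ᵥ V.S i *ᵥ d)
      - stack (chain b c d) ⬝ᵥ PsiBar S V i *ᵥ stack (chain b c d)
      - 2 / γ ^ 2 * (b ⬝ᵥ ∑ ν, e ν)
      - ∑ ν, (V.ϖ (nbr S.graph i ν) * (e ν ⬝ᵥ (V.Y (nbr S.graph i ν))⁻¹ *ᵥ e ν)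
        + Real.pi ^ 2 / 4 * (e ν ⬝ᵥ V.W (nbr S.graph i ν) *ᵥ e ν
          - 2 * (e ν ⬝ᵥ V.W (nbr S.graph i ν) *ᵥ f ν)
          + f ν ⬝ᵥ V.W (nbr S.graph i ν) *ᵥ f ν))
      - w ⬝ᵥ w := by
  simp only [Xi, xiVec, XiAA, XiAB, XiAC, XiAF, XiAG, XiBB, XiBC, XiBE, XiBF, XiBG, XiCF, XiFF,
    XiFG, PsiTilde₁₁, PsiTilde₁₂, PsiTilde₁₃, PsiTilde₂₂, PsiTilde₂₃, PsiTilde₃₃, PhiBar₁₁,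
    PhiBar₁₂, PhiBar₂₂, chain_dotProduct_mulVec_chain (PsiBar_isHermitian S V i hR)]
  have hKH : (S.H i)ᵀ * (g.K i)ᵀ = (g.K i * S.H i)ᵀ := by rw [transpose_mul]
  simp only [hKH, Matrix.mul_assoc _ (g.K i) (S.H i)]
  generalize S.A - g.L i * S.C i = A, S.B - g.L i * S.D i = B, g.K i * S.H i = KH at ha ⊢
  have hdyn : ∀ y : Fin n → ℝ, y ⬝ᵥ a = y ⬝ᵥ A *ᵥ b + y ⬝ᵥ B *ᵥ w
      + (y ⬝ᵥ KH *ᵥ (∑ ν, f ν) - y ⬝ᵥ KH *ᵥ (∑ ν, c ν)) := by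
    intro y
    conv_lhs => rw [ha]
    rw [dotProduct_add, dotProduct_add, mulVec_sub, dotProduct_sub]
  simp only [dotProduct_symBlock_mulVec, fromCols_mulVec_sumElim, zero_mulVec, dotProduct_zero,
    add_mulVec, sub_mulVec, neg_mulVec, smul_mulVec, one_mulVec, dotProduct_add, dotProduct_sub,
    dotProduct_neg, dotProduct_smul, smul_eq_mul, dotProduct_sqRep_mulVec,
    dotProduct_colRep_mulVec, dotProduct_diagBlocks_mulVec,
    dotProduct_transpose_mul_mulVec, dotProduct_mulVec_transpose_comm, rowRep_mulVec_stack,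
    Finset.sum_add_distrib, Finset.sum_sub_distrib, mul_add, mul_sub, ← Finset.mul_sum]
  rw [dotProduct_comm a (V.Z i *ᵥ a), dotProduct_comm a (V.X i *ᵥ b),
    dotProduct_comm a (V.Q i *ᵥ ∑ ν, f ν), dotProduct_comm (A *ᵥ b) (V.X i *ᵥ b),
    dotProduct_comm (A *ᵥ b) (V.Q i *ᵥ ∑ ν, f ν),
    dotProduct_comm (KH *ᵥ ∑ ν, c ν) (V.Q i *ᵥ ∑ ν, f ν),
    dotProduct_comm (KH *ᵥ ∑ ν, f ν) (V.Q i *ᵥ ∑ ν, f ν)]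
  linear_combination (-2) * hdyn (V.Z i *ᵥ a) - 2 * hdyn (V.X i *ᵥ b)
    - 2 * hdyn (V.Q i *ᵥ ∑ ν, f ν)

end XiForm

/-! ### The Lyapunov–Krasovskii functional -/

section Functional

variable {N n mw mv : ℕ} (S : Network N n mw mv) (V : LMIVars N n)
  (e f : Fin N → ℝ → Fin n → ℝ)

/-- The factor `e^{-2 α_i τ_i}` by which the functional discounts the delayed terms of node
`i`. -/
def decayWeight (i : Fin N) : ℝ := Real.exp (-2 * V.α i * S.τ i)

/-- The integral of the quadratic form `R_i` of the derivative `f_i` from `0` to `t`. -/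
def derivEnergy (i : Fin N) (t : ℝ) : ℝ := ∫ s in (0 : ℝ)..t, f i s ⬝ᵥ V.R i *ᵥ f i s

/-- The part of the functional that belongs to node `i`. The usual double integral of the
quadratic form `R_i` over the delay window is written in terms of `derivEnergy`, so that its
derivative can be read off. -/
def nodeFunctional (i : Fin N) (t : ℝ) : ℝ :=
  e i t ⬝ᵥ (V.Y i)⁻¹ *ᵥ e i t
    + decayWeight S V i * (∫ s in (t - S.τ i)..t, e i s ⬝ᵥ V.S i *ᵥ e i s)
    + decayWeight S V i * S.τ i *
      (S.τ i * derivEnergy V f i t - ∫ s in (t - S.τ i)..t, derivEnergy V f i s)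

/-- The derivative of `nodeFunctional`. -/
def nodeFunctionalDeriv (i : Fin N) (t : ℝ) : ℝ :=
  2 * (e i t ⬝ᵥ (V.Y i)⁻¹ *ᵥ f i t)
    + decayWeight S V i * (e i t ⬝ᵥ V.S i *ᵥ e i t
      - e i (t - S.τ i) ⬝ᵥ V.S i *ᵥ e i (t - S.τ i))
    + decayWeight S V i * S.τ i * (S.τ i * (f i t ⬝ᵥ V.R i *ᵥ f i t)
      - (derivEnergy V f i t - derivEnergy V f i (t - S.τ i)))

/-- The part of the functional that belongs to the channel from `j` to `i`, when the sample in
use was taken at time `s`. It is nonnegative by Wirtinger's inequality. -/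
def edgeFunctional (i j : Fin N) (s t : ℝ) : ℝ :=
  S.τ i ^ 2 * (∫ u in s..t, f j u ⬝ᵥ V.W j *ᵥ f j u)
    - Real.pi ^ 2 / 4 * ∫ u in s..t, (e j u - e j s) ⬝ᵥ V.W j *ᵥ (e j u - e j s)

/-- The derivative of `edgeFunctional` with respect to the current time `t`. -/
def edgeFunctionalDeriv (i j : Fin N) (s t : ℝ) : ℝ :=
  S.τ i ^ 2 * (f j t ⬝ᵥ V.W j *ᵥ f j t)
    - Real.pi ^ 2 / 4 * ((e j t - e j s) ⬝ᵥ V.W j *ᵥ (e j t - e j s))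

/-- The Lyapunov–Krasovskii functional on `[t_k, t_{k+1}]`. -/
def lyapunov (k : ℕ) (t : ℝ) : ℝ :=
  ∑ i, nodeFunctional S V e f i t
    + ∑ i, ∑ j ∈ nbhd S.graph i, edgeFunctional S V e f i j (S.sampleTime i k j) t

/-- The derivative of `lyapunov`. -/
def lyapunovDeriv (k : ℕ) (t : ℝ) : ℝ :=
  ∑ i, nodeFunctionalDeriv S V e f i t
    + ∑ i, ∑ j ∈ nbhd S.graph i, edgeFunctionalDeriv S V e f i j (S.sampleTime i k j) t

lemma decayWeight_pos (i : Fin N) : 0 < decayWeight S V i := Real.exp_pos _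

variable {S V e f} {i j : Fin N}

lemma decayWeight_le_one (hα : 0 ≤ V.α i) (hτ : 0 ≤ S.τ i) : decayWeight S V i ≤ 1 :=
  Real.exp_le_one_iff.2 (by nlinarith)

lemma isPrimitive_derivEnergy (h : HasL2Deriv (e i) (f i)) :
    IsPrimitive (derivEnergy V f i) fun t => f i t ⬝ᵥ V.R i *ᵥ f i t :=
  h.isPrimitive_energy (V.R i) 0

lemma monotone_derivEnergy (h : HasL2Deriv (e i) (f i)) (hR : (V.R i).PosSemidef) :
    Monotone (derivEnergy V f i) :=
  (isPrimitive_derivEnergy h).monotone_of_nonneg fun _ => dotProduct_mulVec_self_nonneg hR _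

lemma isPrimitive_nodeFunctional (h : HasL2Deriv (e i) (f i)) (hY : (V.Y i).IsHermitian) :
    IsPrimitive (nodeFunctional S V e f i) (nodeFunctionalDeriv S V e f i) :=
  have hE := isPrimitive_derivEnergy (V := V) h
  have hS : Continuous fun t => e i t ⬝ᵥ V.S i *ᵥ e i t :=
    h.continuous.dotProduct (continuous_const.matrix_mulVec h.continuous)
  ((h.isPrimitive.quadraticForm hY.inv).add ((IsPrimitive.slidingIntegral hS _).const_smul _)).add
    (((hE.const_smul _).sub (IsPrimitive.slidingIntegral hE.continuous _)).const_smul _)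

lemma isPrimitive_edgeFunctional (h : HasL2Deriv (e j) (f j)) (i : Fin N) (s : ℝ) :
    IsPrimitive (edgeFunctional S V e f i j s) (edgeFunctionalDeriv S V e f i j s) :=
  have hd : Continuous fun u => e j u - e j s := h.continuous.sub continuous_const
  have hW : Continuous fun u => (e j u - e j s) ⬝ᵥ V.W j *ᵥ (e j u - e j s) :=
    hd.dotProduct (continuous_const.matrix_mulVec hd)
  ((h.isPrimitive_energy (V.W j) s).const_smul _).sub
    ((IsPrimitive.integral (fun a b => hW.intervalIntegrable a b) s).const_smul _)

lemma isPrimitive_lyapunov (h : ∀ i, HasL2Deriv (e i) (f i)) (hY : ∀ i, (V.Y i).IsHermitian)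
    (k : ℕ) : IsPrimitive (lyapunov S V e f k) (lyapunovDeriv S V e f k) :=
  (IsPrimitive.sum fun i _ => isPrimitive_nodeFunctional (h i) (hY i)).add
    (IsPrimitive.sum fun i _ => IsPrimitive.sum fun j _ => isPrimitive_edgeFunctional (h j) i _)

lemma edgeFunctional_self (i j : Fin N) (s : ℝ) : edgeFunctional S V e f i j s s = 0 := by
  simp [edgeFunctional]

lemma edgeFunctional_nonneg (h : HasL2Deriv (e j) (f j)) (hW : (V.W j).PosSemidef) {s t : ℝ}
    (hst : s ≤ t) (ht : t - s ≤ S.τ i) : 0 ≤ edgeFunctional S V e f i j s t := by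
  have hwirtinger := (h.isPrimitive.sub_const (e j s)).wirtinger hW
    (h.intervalIntegrable_quadraticForm (V.W j) s t) hst (sub_self _)
  have henergy : 0 ≤ ∫ u in s..t, f j u ⬝ᵥ V.W j *ᵥ f j u :=
    intervalIntegral.integral_nonneg hst fun u _ => dotProduct_mulVec_self_nonneg hW _
  have hsq : (t - s) ^ 2 ≤ S.τ i ^ 2 := pow_le_pow_left₀ (sub_nonneg.2 hst) ht 2
  exact sub_nonneg.2 (hwirtinger.trans (mul_le_mul_of_nonneg_right hsq henergy))

lemma edgeFunctional_sampleTime_nonneg (h : HasL2Deriv (e j) (f j)) (hW : (V.W j).PosSemidef)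
    (hτ : BddAbove (range (S.pollGap i))) (hj : j ∈ nbhd S.graph i) {k : ℕ} {t : ℝ}
    (ht : t ∈ Icc (S.t k) (S.t (k + 1))) :
    0 ≤ edgeFunctional S V e f i j (S.sampleTime i k j) t :=
  edgeFunctional_nonneg h hW ((S.sampleTime_le i k j).trans ht.1)
    (by linarith [S.t_succ_sub_τ_le_sampleTime hτ k hj, ht.2])

-- A channel polled at `t_{k+1}` restarts its nonnegative edge functional at zero.
lemma lyapunov_succ_le (h : ∀ i, HasL2Deriv (e i) (f i)) (hW : ∀ i, (V.W i).PosSemidef)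
    (hτ : ∀ i, BddAbove (range (S.pollGap i))) (k : ℕ) :
    lyapunov S V e f (k + 1) (S.t (k + 1)) ≤ lyapunov S V e f k (S.t (k + 1)) := by
  rw [lyapunov, lyapunov]
  gcongr with i _ j hj
  rcases S.sampleTime_succ i k hj with hs | hs
  · rw [hs]
  · rw [hs, edgeFunctional_self]
    exact edgeFunctional_sampleTime_nonneg (h j) (hW j) (hτ i) hj
      (right_mem_Icc.2 (S.t_strictMono k.lt_succ_self).le)

lemma le_nodeFunctional (h : HasL2Deriv (e i) (f i)) (hS : (V.S i).PosSemidef)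
    (hR : (V.R i).PosSemidef) (hτ : 0 ≤ S.τ i) (t : ℝ) :
    e i t ⬝ᵥ (V.Y i)⁻¹ *ᵥ e i t ≤ nodeFunctional S V e f i t := by
  have hw := (decayWeight_pos S V i).le
  have hstate : 0 ≤ ∫ s in (t - S.τ i)..t, e i s ⬝ᵥ V.S i *ᵥ e i s :=
    intervalIntegral.integral_nonneg (by linarith) fun s _ => dotProduct_mulVec_self_nonneg hS _
  have henergy : ∫ s in (t - S.τ i)..t, derivEnergy V f i s ≤ S.τ i * derivEnergy V f i t := by
    simpa using intervalIntegral.integral_mono_on (μ := volume) (by linarith : t - S.τ i ≤ t)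
      ((isPrimitive_derivEnergy h).continuous.intervalIntegrable _ _)
      (intervalIntegrable_const (c := derivEnergy V f i t))
      fun s hs => monotone_derivEnergy h hR hs.2
  rw [nodeFunctional, add_assoc]
  exact le_add_of_nonneg_right (add_nonneg (mul_nonneg hw hstate)
    (mul_nonneg (mul_nonneg hw hτ) (sub_nonneg.2 henergy)))

lemma sum_le_lyapunov (h : ∀ i, HasL2Deriv (e i) (f i)) (hS : ∀ i, (V.S i).PosSemidef)
    (hR : ∀ i, (V.R i).PosSemidef) (hW : ∀ i, (V.W i).PosSemidef)
    (hτ : ∀ i, BddAbove (range (S.pollGap i))) {k : ℕ} {t : ℝ}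
    (ht : t ∈ Icc (S.t k) (S.t (k + 1))) :
    ∑ i, e i t ⬝ᵥ (V.Y i)⁻¹ *ᵥ e i t ≤ lyapunov S V e f k t :=
  (Finset.sum_le_sum fun i _ =>
    le_nodeFunctional (h i) (hS i) (hR i) (S.τ_nonneg (hτ i)) t).trans <|
    le_add_of_nonneg_right <| Finset.sum_nonneg fun i _ => Finset.sum_nonneg fun j hj =>
      edgeFunctional_sampleTime_nonneg (h j) (hW j) (hτ i) hj ht

end Functional

/-! ### The dissipation inequality -/

section Dissipation

variable {N n mw mv : ℕ}

/-- `e` satisfies the error dynamics from time `a₀` on, and is absolutely continuous with locally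
square integrable derivative `f` on the whole line. -/
structure IsMotion (S : Network N n mw mv) (g : Gains S) (a₀ : ℝ)
    (ξ : Fin N → ℝ → Fin mw ⊕ Fin mv → ℝ) (e f : Fin N → ℝ → Fin n → ℝ) : Prop where
  hasL2Deriv : ∀ i, HasL2Deriv (e i) (f i)
  eq : ∀ i, ∀ k : ℕ, ∀ t, a₀ ≤ t → t ∈ Ico (S.t k) (S.t (k + 1)) →
    f i t = (S.A - g.L i * S.C i) *ᵥ e i t + (S.B - g.L i * S.D i) *ᵥ ξ i t
      + (g.K i * S.H i) *ᵥ ∑ j ∈ nbhd S.graph i,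
          (e j (S.sampleTime i k j) - e i (S.sampleTime i k j))

/-- A solution of the matrix inequalities, with `Ξ_i < 0` in the quantitative form
`Ξ_i ≤ -ε I`. -/
structure Feasible (S : Network N n mw mv) (g : Gains S) (γ : ℝ) (V : LMIVars N n) (ε : ℝ) :
    Prop where
  bddAbove_pollGap : ∀ i, BddAbove (range (S.pollGap i))
  posDef_Y : ∀ i, (V.Y i).PosDef
  posSemidef_W : ∀ i, (V.W i).PosSemidef
  posSemidef_S : ∀ i, (V.S i).PosSemidef
  α_pos : ∀ i, 0 < V.α i
  mul_ϖ_le : ∀ i, (S.q i : ℝ) * V.ϖ i ≤ 2 * V.α i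
  posSemidef_fromBlocks : ∀ i, (fromBlocks (V.R i) (V.G i) (V.G i)ᵀ (V.R i)).PosSemidef
  ε_pos : 0 < ε
  dotProduct_Xi_mulVec_le : ∀ i v, v ⬝ᵥ Xi S g γ V i *ᵥ v ≤ -(ε * (v ⬝ᵥ v))

/-- The disagreement `∑_i ∑_{j ∈ V_i} ‖e_j - e_i‖²` at time `t`. -/
def disagreementRate (S : Network N n mw mv) (e : Fin N → ℝ → Fin n → ℝ) (t : ℝ) : ℝ :=
  ∑ i, ∑ j ∈ nbhd S.graph i, (e j t - e i t) ⬝ᵥ (e j t - e i t)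

/-- The sum of the squares of the errors and of their derivatives at time `t`; its integral
controls the Lyapunov–Krasovskii functional. -/
def sqRate (e f : Fin N → ℝ → Fin n → ℝ) (t : ℝ) : ℝ :=
  ∑ i, (e i t ⬝ᵥ e i t + f i t ⬝ᵥ f i t)

/-- The upper bound of the derivative of the functional in the dissipation inequality. -/
def supplyRate (S : Network N n mw mv) (γ ε : ℝ) (ξ : Fin N → ℝ → Fin mw ⊕ Fin mv → ℝ)
    (e f : Fin N → ℝ → Fin n → ℝ) (t : ℝ) : ℝ :=
  ∑ i, ξ i t ⬝ᵥ ξ i t - 1 / γ ^ 2 * disagreementRate S e t - ε * sqRate e f t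

/-- The vector at which the form `Ξ_i` is evaluated at time `t`. -/
def motionVec (S : Network N n mw mv) (ξ : Fin N → ℝ → Fin mw ⊕ Fin mv → ℝ)
    (e f : Fin N → ℝ → Fin n → ℝ) (i : Fin N) (k : ℕ) (t : ℝ) : XiIndex S i → ℝ :=
  xiVec S i (f i t) (e i t) (fun ν => e i (S.tExt ((k : ℤ) - (ν : ℕ)))) (e i (t - S.τ i))
    (fun ν => e (nbr S.graph i ν) t)
    (fun ν => e (nbr S.graph i ν) (S.sampleTime i k (nbr S.graph i ν))) (ξ i t)

variable {S : Network N n mw mv} {g : Gains S} {γ ε : ℝ} {V : LMIVars N n}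
  {ξ : Fin N → ℝ → Fin mw ⊕ Fin mv → ℝ} {e f : Fin N → ℝ → Fin n → ℝ} {a₀ : ℝ} {i : Fin N}

lemma posSemidef_of_fromBlocks {R G G' R' : Matrix (Fin n) (Fin n) ℝ}
    (h : (fromBlocks R G G' R').PosSemidef) : R.PosSemidef :=
  h.submatrix Sum.inl

lemma Feasible.posSemidef_R (hF : Feasible S g γ V ε) (i : Fin N) : (V.R i).PosSemidef :=
  posSemidef_of_fromBlocks (hF.posSemidef_fromBlocks i)

lemma Feasible.τ_nonneg (hF : Feasible S g γ V ε) (i : Fin N) : 0 ≤ S.τ i :=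
  S.τ_nonneg (hF.bddAbove_pollGap i)

lemma chain_knot (z : ℝ → Fin n → ℝ) (i : Fin N) (k : ℕ) (t : ℝ) (x : Fin (S.p i + 2)) :
    chain (z t) (fun ν : Fin (S.p i) => z (S.tExt ((k : ℤ) - (ν : ℕ)))) (z (t - S.τ i)) x =
      z (S.knot i k t x) := by
  induction x using Fin.cases with
  | zero => rfl
  | succ x =>
    rw [chain, Fin.cons_succ, Fin.val_succ]
    induction x using Fin.lastCases with
    | last => rw [Fin.snoc_last, Fin.val_last, S.knot_last]
    | cast ν => simp only [Fin.snoc_castSucc, Fin.val_castSucc, Network.knot, ν.is_lt, if_true]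

lemma chain_dotProduct_PsiBar_mulVec_le (h : HasL2Deriv (e i) (f i))
    (hRG : (fromBlocks (V.R i) (V.G i) (V.G i)ᵀ (V.R i)).PosSemidef)
    (hτ : BddAbove (range (S.pollGap i))) {k : ℕ} {t : ℝ} (ht : t ∈ Icc (S.t k) (S.t (k + 1)))
    {z : Fin (S.p i + 2) → Fin n → ℝ}
    (hz : z = chain (e i t) (fun ν => e i (S.tExt ((k : ℤ) - (ν : ℕ)))) (e i (t - S.τ i))) :
    stack z ⬝ᵥ PsiBar S V i *ᵥ stack z ≤ decayWeight S V i * S.τ i *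
      (derivEnergy V f i t - derivEnergy V f i (t - S.τ i)) := by
  have hpark := h.isPrimitive.sum_sub_dotProduct_mulVec_sub_le (isPrimitive_derivEnergy h)
    (posSemidef_of_fromBlocks hRG) hRG (S.p i) (S.antitone_knot hτ ht)
  rw [S.knot_last, show S.knot i k t 0 = t from rfl, sub_sub_cancel] at hpark
  rw [dotProduct_PsiBar_mulVec, ← decayWeight, mul_assoc]
  refine mul_le_mul_of_nonneg_left ?_ (decayWeight_pos S V i).le
  simpa only [hz, chain_knot, Fin.val_castSucc, Fin.val_succ] using hpark

lemma sum_edgeFunctionalDeriv (hW : ∀ j, (V.W j).IsHermitian) (k : ℕ) (t : ℝ) :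
    ∑ j ∈ nbhd S.graph i, edgeFunctionalDeriv S V e f i j (S.sampleTime i k j) t =
      ∑ j ∈ nbhd S.graph i, S.τ i ^ 2 * (f j t ⬝ᵥ V.W j *ᵥ f j t)
      - ∑ j ∈ nbhd S.graph i, Real.pi ^ 2 / 4 * (e j t ⬝ᵥ V.W j *ᵥ e j t
          - 2 * (e j t ⬝ᵥ V.W j *ᵥ e j (S.sampleTime i k j))
          + e j (S.sampleTime i k j) ⬝ᵥ V.W j *ᵥ e j (S.sampleTime i k j)) := by
  simp only [edgeFunctionalDeriv, sub_dotProduct_mulVec_sub (hW _), Finset.sum_sub_distrib]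

-- The terms in `e_i`, `e_j`, `f_j` on the right cancel in the sum over all nodes, except for the
-- disagreement.
lemma nodeFunctionalDeriv_add_sum_le (hF : Feasible S g γ V ε) (hm : IsMotion S g a₀ ξ e f)
    {k : ℕ} {t : ℝ} (ha : a₀ ≤ t) (ht : t ∈ Ico (S.t k) (S.t (k + 1))) (i : Fin N) :
    nodeFunctionalDeriv S V e f i t
      + ∑ j ∈ nbhd S.graph i, edgeFunctionalDeriv S V e f i j (S.sampleTime i k j) t ≤
    motionVec S ξ e f i k t ⬝ᵥ Xi S g γ V i *ᵥ motionVec S ξ e f i k t + ξ i t ⬝ᵥ ξ i t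
      - (∑ j ∈ outNbhd S.graph i, S.τ j ^ 2) * (f i t ⬝ᵥ V.W i *ᵥ f i t)
      + ∑ j ∈ nbhd S.graph i, S.τ i ^ 2 * (f j t ⬝ᵥ V.W j *ᵥ f j t)
      - ((S.p i : ℝ) + S.q i) / γ ^ 2 * (e i t ⬝ᵥ e i t)
      - 2 * V.α i * (e i t ⬝ᵥ (V.Y i)⁻¹ *ᵥ e i t)
      + ∑ j ∈ nbhd S.graph i, V.ϖ j * (e j t ⬝ᵥ (V.Y j)⁻¹ *ᵥ e j t)
      + 2 / γ ^ 2 * ∑ j ∈ nbhd S.graph i, e i t ⬝ᵥ e j t := by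
  have hdyn := hm.eq i k t ha ht
  rw [Finset.sum_sub_distrib, S.sum_sampleTime i k (e i),
    ← sum_nbr S.graph i fun j => e j (S.sampleTime i k j)] at hdyn
  rw [motionVec, xiVec_dotProduct_Xi_mulVec S g γ V i (hF.posSemidef_R i).1 hdyn
      (d := e i (t - S.τ i)) (e := fun ν => e (nbr S.graph i ν) t),
    sum_edgeFunctionalDeriv fun j => (hF.posSemidef_W j).1,
    sum_nbr S.graph i fun j => V.ϖ j * (e j t ⬝ᵥ (V.Y j)⁻¹ *ᵥ e j t)
        + Real.pi ^ 2 / 4 * (e j t ⬝ᵥ V.W j *ᵥ e j t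
          - 2 * (e j t ⬝ᵥ V.W j *ᵥ e j (S.sampleTime i k j))
          + e j (S.sampleTime i k j) ⬝ᵥ V.W j *ᵥ e j (S.sampleTime i k j)),
    sum_nbr S.graph i fun j => e j t, dotProduct_sum, Finset.sum_add_distrib, nodeFunctionalDeriv,
    ← dotProduct_mulVec_comm_of_isHermitian (hF.posDef_Y i).inv.1 (f i t) (e i t)]
  have hw1 := decayWeight_le_one (hF.α_pos i).le (hF.τ_nonneg i)
  have hstate := mul_le_mul_of_nonneg_right hw1
    (dotProduct_mulVec_self_nonneg (hF.posSemidef_S i) (e i t))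
  have hderiv := mul_le_mul_of_nonneg_right hw1 (mul_nonneg (sq_nonneg (S.τ i))
    (dotProduct_mulVec_self_nonneg (hF.posSemidef_R i) (f i t)))
  have hPsi := chain_dotProduct_PsiBar_mulVec_le (hm.hasL2Deriv i) (hF.posSemidef_fromBlocks i)
    (hF.bddAbove_pollGap i) (Ico_subset_Icc_self ht) rfl
  rw [← decayWeight]
  linarith

lemma le_motionVec_dotProduct_self (i : Fin N) (k : ℕ) (t : ℝ) :
    e i t ⬝ᵥ e i t + f i t ⬝ᵥ f i t ≤ motionVec S ξ e f i k t ⬝ᵥ motionVec S ξ e f i k t := by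
  simp only [motionVec, xiVec, sumElim_dotProduct_sumElim]
  linarith [dotProduct_self_nonneg (stack fun ν : Fin (S.p i) => e i (S.tExt ((k : ℤ) - (ν : ℕ)))),
    dotProduct_self_nonneg (e i (t - S.τ i)),
    dotProduct_self_nonneg (stack fun ν => e (nbr S.graph i ν) t),
    dotProduct_self_nonneg
      (stack fun ν => e (nbr S.graph i ν) (S.sampleTime i k (nbr S.graph i ν))),
    dotProduct_self_nonneg (ξ i t)]

lemma sum_motionVec_dotProduct_Xi_mulVec_le (hF : Feasible S g γ V ε) (k : ℕ) (t : ℝ) :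
    ∑ i, motionVec S ξ e f i k t ⬝ᵥ Xi S g γ V i *ᵥ motionVec S ξ e f i k t ≤
      -(ε * sqRate e f t) := by
  rw [sqRate, Finset.mul_sum, ← Finset.sum_neg_distrib]
  exact Finset.sum_le_sum fun i _ => (hF.dotProduct_Xi_mulVec_le i _).trans <|
    neg_le_neg (mul_le_mul_of_nonneg_left (le_motionVec_dotProduct_self i k t) hF.ε_pos.le)

lemma sum_sum_ϖ_mul_le (hF : Feasible S g γ V ε) (t : ℝ) :
    ∑ i, ∑ j ∈ nbhd S.graph i, V.ϖ j * (e j t ⬝ᵥ (V.Y j)⁻¹ *ᵥ e j t) ≤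
      ∑ i, 2 * V.α i * (e i t ⬝ᵥ (V.Y i)⁻¹ *ᵥ e i t) := by
  rw [sum_nbhd_comm]
  refine Finset.sum_le_sum fun i _ => ?_
  rw [Finset.sum_const, nsmul_eq_mul, ← mul_assoc]
  exact mul_le_mul_of_nonneg_right (hF.mul_ϖ_le i)
    (dotProduct_mulVec_self_nonneg (hF.posDef_Y i).inv.posSemidef _)

lemma disagreementRate_eq (t : ℝ) :
    disagreementRate S e t = ∑ i, ((S.p i : ℝ) + S.q i) * (e i t ⬝ᵥ e i t)
      - 2 * ∑ i, ∑ j ∈ nbhd S.graph i, e i t ⬝ᵥ e j t := by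
  have hin : ∑ i, ∑ _j ∈ nbhd S.graph i, e i t ⬝ᵥ e i t = ∑ i, (S.p i : ℝ) * (e i t ⬝ᵥ e i t) := by
    simp [Network.p, inDeg]
  have hout : ∑ i, ∑ j ∈ nbhd S.graph i, e j t ⬝ᵥ e j t =
      ∑ i, (S.q i : ℝ) * (e i t ⬝ᵥ e i t) := by
    rw [sum_nbhd_comm]
    simp [Network.q, outDeg]
  have hsq (i j : Fin N) : (e j t - e i t) ⬝ᵥ (e j t - e i t) =
      e i t ⬝ᵥ e i t + e j t ⬝ᵥ e j t - 2 * (e i t ⬝ᵥ e j t) := by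
    simp only [sub_dotProduct, dotProduct_sub, dotProduct_comm (e j t) (e i t)]
    ring
  simp only [disagreementRate, hsq, Finset.sum_sub_distrib, Finset.sum_add_distrib, hin, hout,
    ← Finset.mul_sum, add_mul]

lemma disagreementRate_nonneg (t : ℝ) : 0 ≤ disagreementRate S e t :=
  Finset.sum_nonneg fun _ _ => Finset.sum_nonneg fun _ _ => dotProduct_self_nonneg _

lemma sqRate_nonneg (t : ℝ) : 0 ≤ sqRate e f t :=
  Finset.sum_nonneg fun _ _ => add_nonneg (dotProduct_self_nonneg _) (dotProduct_self_nonneg _)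

lemma lyapunovDeriv_le_supplyRate (hF : Feasible S g γ V ε) (hm : IsMotion S g a₀ ξ e f) {k : ℕ}
    {t : ℝ} (ha : a₀ ≤ t) (ht : t ∈ Ico (S.t k) (S.t (k + 1))) :
    lyapunovDeriv S V e f k t ≤ supplyRate S γ ε ξ e f t := by
  rw [lyapunovDeriv, ← Finset.sum_add_distrib]
  refine (Finset.sum_le_sum fun i _ => nodeFunctionalDeriv_add_sum_le hF hm ha ht i).trans ?_
  simp only [Finset.sum_add_distrib, Finset.sum_sub_distrib]
  have hXi := sum_motionVec_dotProduct_Xi_mulVec_le hF k t (ξ := ξ) (e := e) (f := f)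
  have hϖ := sum_sum_ϖ_mul_le hF t (e := e)
  have hW : ∑ i, ∑ j ∈ nbhd S.graph i, S.τ i ^ 2 * (f j t ⬝ᵥ V.W j *ᵥ f j t) =
      ∑ i, (∑ j ∈ outNbhd S.graph i, S.τ j ^ 2) * (f i t ⬝ᵥ V.W i *ᵥ f i t) := by
    rw [sum_nbhd_comm]
    simp only [Finset.sum_mul]
  have hdisagree : 1 / γ ^ 2 * disagreementRate S e t =
      ∑ i, ((S.p i : ℝ) + S.q i) / γ ^ 2 * (e i t ⬝ᵥ e i t)
        - ∑ i, 2 / γ ^ 2 * ∑ j ∈ nbhd S.graph i, e i t ⬝ᵥ e j t := by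
    simp only [disagreementRate_eq, mul_sub, Finset.mul_sum]
    congr 1
    · exact Finset.sum_congr rfl fun i _ => by ring
    · exact Finset.sum_congr rfl fun i _ => Finset.sum_congr rfl fun j _ => by ring
  rw [supplyRate]
  linarith

lemma intervalIntegrable_sqRate (h : ∀ i, HasL2Deriv (e i) (f i)) (a b : ℝ) :
    IntervalIntegrable (sqRate e f) volume a b :=
  intervalIntegrable_fun_sum fun i _ =>
    (((h i).continuous.dotProduct (h i).continuous).intervalIntegrable a b).add
      ((h i).intervalIntegrable_dotProduct_self a b)

lemma continuous_disagreementRate (h : ∀ i, Continuous (e i)) :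
    Continuous (disagreementRate S e) :=
  continuous_finsetSum _ fun i _ => continuous_finsetSum _ fun j _ =>
    ((h j).sub (h i)).dotProduct ((h j).sub (h i))

lemma intervalIntegrable_supplyRate (h : ∀ i, HasL2Deriv (e i) (f i)) {a b : ℝ}
    (hξ : ∀ i, IntervalIntegrable (fun t => ξ i t ⬝ᵥ ξ i t) volume a b) :
    IntervalIntegrable (supplyRate S γ ε ξ e f) volume a b :=
  ((intervalIntegrable_fun_sum fun i _ => hξ i).sub
    (((continuous_disagreementRate fun i => (h i).continuous).intervalIntegrable a b).const_mul
      _)).sub ((intervalIntegrable_sqRate h a b).const_mul _)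

lemma lyapunov_le_of_mem_Icc (hF : Feasible S g γ V ε) (hm : IsMotion S g a₀ ξ e f) {k : ℕ}
    {a b : ℝ} (ha : a₀ ≤ a) (hka : S.t k ≤ a) (hab : a ≤ b) (hbk : b ≤ S.t (k + 1))
    (hξ : ∀ i, IntervalIntegrable (fun t => ξ i t ⬝ᵥ ξ i t) volume a b) :
    lyapunov S V e f k b ≤ lyapunov S V e f k a + ∫ t in a..b, supplyRate S γ ε ξ e f t := by
  have hV := isPrimitive_lyapunov hm.hasL2Deriv (fun i => (hF.posDef_Y i).1) k (S := S)
  rw [hV.eq_add_integral a b]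
  gcongr
  exact intervalIntegral.integral_mono_on_of_le_Ioo hab (hV.intervalIntegrable a b)
    (intervalIntegrable_supplyRate hm.hasL2Deriv hξ) fun t ht =>
      lyapunovDeriv_le_supplyRate hF hm (ha.trans ht.1.le)
        ⟨hka.trans ht.1.le, ht.2.trans_le hbk⟩

lemma lyapunov_le (hF : Feasible S g γ V ε) (hm : IsMotion S g a₀ ξ e f)
    (hξ : ∀ i a b, a₀ ≤ a → a ≤ b → IntervalIntegrable (fun t => ξ i t ⬝ᵥ ξ i t) volume a b)
    {k l : ℕ} (hkl : k ≤ l) {a b : ℝ} (ha : a₀ ≤ a) (hka : a ∈ Icc (S.t k) (S.t (k + 1)))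
    (hab : a ≤ b) (hlb : b ∈ Icc (S.t l) (S.t (l + 1))) :
    lyapunov S V e f l b ≤ lyapunov S V e f k a + ∫ t in a..b, supplyRate S γ ε ξ e f t := by
  induction l, hkl using Nat.le_induction generalizing b with
  | base => exact lyapunov_le_of_mem_Icc hF hm ha hka.1 hab hlb.2 fun i => hξ i a b ha hab
  | succ l hkl ih =>
    have hal : a ≤ S.t (l + 1) :=
      hka.2.trans (S.t_strictMono.monotone (Nat.succ_le_succ hkl))
    have hbefore := ih hal ⟨S.t_strictMono.monotone (Nat.le_succ l), le_rfl⟩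
    have hjump := lyapunov_succ_le hm.hasL2Deriv hF.posSemidef_W hF.bddAbove_pollGap l (V := V)
    have hafter := lyapunov_le_of_mem_Icc hF hm (ha.trans hal) le_rfl hlb.1 hlb.2
      fun i => hξ i _ _ (ha.trans hal) hlb.1
    have hadd := intervalIntegral.integral_add_adjacent_intervals
      (intervalIntegrable_supplyRate (S := S) (γ := γ) (ε := ε) hm.hasL2Deriv
        fun i => hξ i a _ ha hal)
      (intervalIntegrable_supplyRate (S := S) (γ := γ) (ε := ε) hm.hasL2Deriv
        fun i => hξ i _ _ (ha.trans hal) hlb.1)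
    linarith

end Dissipation

/-! ### Solutions of the error dynamics -/

section Motion

variable {N n mw mv : ℕ} (S : Network N n mw mv)

namespace Network

lemma exists_lt_t_succ (t : ℝ) : ∃ k, t < S.t (k + 1) := by
  obtain ⟨k, hk⟩ := (S.t_tendsto.eventually_gt_atTop t).exists
  exact ⟨k, hk.trans (S.t_strictMono k.lt_succ_self)⟩

open scoped Classical in
/-- The index `k` of the sampling interval `[t_k, t_{k+1})` that contains `t`; it is `0` for
negative `t`. -/
def samplingIndex (t : ℝ) : ℕ := Nat.find (S.exists_lt_t_succ t)

lemma lt_t_samplingIndex_succ (t : ℝ) : t < S.t (S.samplingIndex t + 1) := by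
  classical exact Nat.find_spec (S.exists_lt_t_succ t)

lemma samplingIndex_le {t : ℝ} {k : ℕ} (h : t < S.t (k + 1)) : S.samplingIndex t ≤ k := by
  classical exact Nat.find_min' (S.exists_lt_t_succ t) h

lemma samplingIndex_mono : Monotone S.samplingIndex := fun _ b hab =>
  S.samplingIndex_le (hab.trans_lt (S.lt_t_samplingIndex_succ b))

lemma t_samplingIndex_le {t : ℝ} (ht : 0 ≤ t) : S.t (S.samplingIndex t) ≤ t := by
  rcases h : S.samplingIndex t with _ | k
  · rwa [S.t_zero]
  · by_contra! hlt
    have := S.samplingIndex_le hlt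
    omega

lemma mem_Ico_samplingIndex {t : ℝ} (ht : 0 ≤ t) :
    t ∈ Ico (S.t (S.samplingIndex t)) (S.t (S.samplingIndex t + 1)) :=
  ⟨S.t_samplingIndex_le ht, S.lt_t_samplingIndex_succ t⟩

lemma samplingIndex_eq {t : ℝ} {k : ℕ} (h : t ∈ Ico (S.t k) (S.t (k + 1))) :
    S.samplingIndex t = k := by
  refine le_antisymm (S.samplingIndex_le h.2) ?_
  have := S.t_strictMono.lt_iff_lt.1 (h.1.trans_lt (S.lt_t_samplingIndex_succ t))
  omega

end Network

lemma memLp_restrict_Ioc_of_continuous {E : Type*} [NormedAddCommGroup E]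
    [SecondCountableTopology E] {φ : ℝ → E} (hφ : Continuous φ) (q : ℝ≥0∞) (a b : ℝ) :
    MemLp φ q (volume.restrict (Ioc a b)) := by
  obtain ⟨C, hC⟩ := isCompact_Icc.exists_bound_of_continuousOn (hφ.continuousOn (s := Icc a b))
  exact MemLp.of_bound hφ.aestronglyMeasurable C
    ((ae_restrict_mem measurableSet_Ioc).mono fun t ht => hC t (Ioc_subset_Icc_self ht))

lemma memLp_comp_samplingIndex {E : Type*} [NormedAddCommGroup E] (φ : ℕ → E) (q : ℝ≥0∞)
    (a b : ℝ) : MemLp (fun t => φ (S.samplingIndex t)) q (volume.restrict (Ioc a b)) := by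
  have hmeas : StronglyMeasurable fun t => φ (S.samplingIndex t) :=
    (StronglyMeasurable.of_discrete (f := φ)).comp_measurable S.samplingIndex_mono.measurable
  refine MemLp.of_bound hmeas.aestronglyMeasurable
    (∑ k ∈ Finset.range (S.samplingIndex b + 1), ‖φ k‖)
    ((ae_restrict_mem measurableSet_Ioc).mono fun t ht => ?_)
  exact Finset.single_le_sum (f := fun k => ‖φ k‖) (fun k _ => norm_nonneg _)
    (Finset.mem_range.2 (Nat.lt_succ_of_le (S.samplingIndex_mono ht.2)))

variable {S} (g : Gains S) (ξ : Fin N → ℝ → Fin mw ⊕ Fin mv → ℝ) (e : Fin N → ℝ → Fin n → ℝ)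
  (s₀ : ℝ)

/-- The coupling term in use on `[t_k, t_{k+1})`. -/
def coupling (i : Fin N) (k : ℕ) : Fin n → ℝ :=
  (g.K i * S.H i) *ᵥ ∑ j ∈ nbhd S.graph i,
    (e j (S.sampleTime i k j) - e i (S.sampleTime i k j))

/-- The right-hand side of the error dynamics on `[t_k, t_{k+1})`. -/
def errorField (i : Fin N) (k : ℕ) (t : ℝ) : Fin n → ℝ :=
  (S.A - g.L i * S.C i) *ᵥ e i t + (S.B - g.L i * S.D i) *ᵥ ξ i t + coupling g e i k

/-- The error with its history before `s₀` replaced by the constant `e_i(s₀)`. The histories in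
the definition of exponential stability are only bounded, while the functional needs an
absolutely continuous signal on the whole line. -/
def holdBefore (i : Fin N) (t : ℝ) : Fin n → ℝ := e i (max t s₀)

/-- The derivative of `holdBefore`. -/
def holdBeforeDeriv (i : Fin N) : ℝ → Fin n → ℝ :=
  (Ici s₀).indicator fun t => errorField g ξ e i (S.samplingIndex t) t

variable {g ξ e s₀} {i : Fin N}

lemma holdBefore_of_le {t : ℝ} (ht : s₀ ≤ t) : holdBefore e s₀ i t = e i t := by
  rw [holdBefore, max_eq_left ht]

lemma holdBefore_of_ge {t : ℝ} (ht : t ≤ s₀) : holdBefore e s₀ i t = e i s₀ := by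
  rw [holdBefore, max_eq_right ht]

lemma holdBeforeDeriv_of_lt {t : ℝ} (ht : t < s₀) : holdBeforeDeriv g ξ e s₀ i t = 0 :=
  indicator_of_notMem (notMem_Ici.2 ht) _

lemma holdBeforeDeriv_eq {k : ℕ} {t : ℝ} (ht : s₀ ≤ t) (hk : t ∈ Ico (S.t k) (S.t (k + 1))) :
    holdBeforeDeriv g ξ e s₀ i t = errorField g ξ e i k t := by
  rw [holdBeforeDeriv, indicator_of_mem (mem_Ici.2 ht), S.samplingIndex_eq hk]

lemma holdBefore_eq_self (h : ∀ i, ∀ t ≤ s₀, e i t = e i s₀) : holdBefore e s₀ = e := by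
  ext1 i
  ext1 t
  rcases le_total s₀ t with ht | ht
  · exact holdBefore_of_le ht
  · rw [holdBefore_of_ge ht, h i t ht]

lemma continuous_holdBefore (he : ContinuousOn (e i) (Ici s₀)) : Continuous (holdBefore e s₀ i) :=
  he.comp_continuous (continuous_id.max continuous_const) fun t => mem_Ici.2 (le_max_right t s₀)

lemma memLp_holdBeforeDeriv (he : ContinuousOn (e i) (Ici s₀))
    (hξ : MemLp (ξ i) 2 (volume.restrict (Ici s₀))) (a b : ℝ) :
    MemLp (holdBeforeDeriv g ξ e s₀ i) 2 (volume.restrict (Ioc a b)) := by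
  have heq : holdBeforeDeriv g ξ e s₀ i = (Ici s₀).indicator fun t =>
      (S.A - g.L i * S.C i) *ᵥ holdBefore e s₀ i t + (S.B - g.L i * S.D i) *ᵥ ξ i t
        + coupling g e i (S.samplingIndex t) :=
    indicator_congr fun t ht => by rw [errorField, holdBefore_of_le (mem_Ici.1 ht)]
  rw [heq, memLp_indicator_iff_restrict measurableSet_Ici]
  have hstate := memLp_mulVec ((memLp_restrict_Ioc_of_continuous (continuous_holdBefore he) 2 a
    b).mono_measure (Measure.restrict_le_self (s := Ici s₀))) (S.A - g.L i * S.C i)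
  have hpert := memLp_mulVec (hξ.mono_measure (Measure.restrict_mono_measure
    (Measure.restrict_le_self (s := Ioc a b)) (Ici s₀))) (S.B - g.L i * S.D i)
  have hcoupling := (memLp_comp_samplingIndex S (coupling g e i) 2 a b).mono_measure
    (Measure.restrict_le_self (s := Ici s₀))
  exact (hstate.add hpert).add hcoupling

namespace IsErrorTrajectory

lemma integral_holdBeforeDeriv_of_mem (he : IsErrorTrajectory S g s₀ ξ e) (i : Fin N) {k : ℕ}
    {a b : ℝ} (ha : s₀ ≤ a) (hka : S.t k ≤ a) (hab : a ≤ b) (hbk : b ≤ S.t (k + 1)) :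
    ∫ s in a..b, holdBeforeDeriv g ξ e s₀ i s = e i b - e i a := by
  rw [he.eq i k a b ha hka hab hbk, add_sub_cancel_left]
  exact intervalIntegral.integral_congr_Ioo_of_le hab fun s hs =>
    holdBeforeDeriv_eq (ha.trans hs.1.le) ⟨hka.trans hs.1.le, hs.2.trans_le hbk⟩

lemma integral_holdBeforeDeriv_of_le_t (hs₀ : 0 ≤ s₀) (he : IsErrorTrajectory S g s₀ ξ e)
    (hint : ∀ a b, IntervalIntegrable (holdBeforeDeriv g ξ e s₀ i) volume a b) (k : ℕ) {b : ℝ}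
    (hb : s₀ ≤ b) (hbk : b ≤ S.t k) :
    ∫ s in s₀..b, holdBeforeDeriv g ξ e s₀ i s = e i b - e i s₀ := by
  induction k generalizing b with
  | zero =>
    obtain rfl : b = s₀ := le_antisymm (hbk.trans (S.t_zero.trans_le hs₀)) hb
    simp
  | succ k ih =>
    rcases le_total b (S.t k) with hbk' | hkb
    · exact ih hb hbk'
    rcases le_total s₀ (S.t k) with hsk | hks
    · rw [← intervalIntegral.integral_add_adjacent_intervals (hint s₀ (S.t k)) (hint (S.t k) b),
        ih hsk le_rfl, he.integral_holdBeforeDeriv_of_mem i hsk le_rfl hkb hbk]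
      abel
    · exact he.integral_holdBeforeDeriv_of_mem i le_rfl hks hb hbk

lemma hasL2Deriv (hs₀ : 0 ≤ s₀) (he : IsErrorTrajectory S g s₀ ξ e)
    (hξ : MemLp (ξ i) 2 (volume.restrict (Ici s₀))) :
    HasL2Deriv (holdBefore e s₀ i) (holdBeforeDeriv g ξ e s₀ i) := by
  have hmem := memLp_holdBeforeDeriv (g := g) (he.cont i) hξ
  have hint (a b : ℝ) : IntervalIntegrable (holdBeforeDeriv g ξ e s₀ i) volume a b :=
    ⟨(hmem a b).integrable one_le_two, (hmem b a).integrable one_le_two⟩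
  have hfrom (b : ℝ) :
      ∫ s in s₀..b, holdBeforeDeriv g ξ e s₀ i s = holdBefore e s₀ i b - e i s₀ := by
    rcases le_total s₀ b with hb | hb
    · rw [holdBefore_of_le hb]
      exact he.integral_holdBeforeDeriv_of_le_t hs₀ hint _ hb (S.lt_t_samplingIndex_succ b).le
    · rw [holdBefore_of_ge hb, sub_self, intervalIntegral.integral_symm,
        intervalIntegral.integral_congr_Ioo_of_le hb fun s hs => holdBeforeDeriv_of_lt hs.2,
        intervalIntegral.integral_zero, neg_zero]
  refine ⟨hmem, fun a b => ?_⟩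
  rw [← intervalIntegral.integral_interval_sub_left (hint s₀ b) (hint s₀ a), hfrom, hfrom,
    sub_sub_sub_cancel_right]

lemma isMotion (hs₀ : 0 ≤ s₀) (he : IsErrorTrajectory S g s₀ ξ e)
    (hξ : ∀ i, MemLp (ξ i) 2 (volume.restrict (Ici s₀))) {a₀ : ℝ} (ha₀ : s₀ ≤ a₀)
    (hsample : ∀ i k t, a₀ ≤ t → t < S.t (k + 1) → ∀ j ∈ nbhd S.graph i,
      s₀ ≤ S.sampleTime i k j) :
    IsMotion S g a₀ ξ (holdBefore e s₀) (holdBeforeDeriv g ξ e s₀) where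
  hasL2Deriv i := he.hasL2Deriv hs₀ (hξ i)
  eq i k t ht hk := by
    rw [holdBeforeDeriv_eq (ha₀.trans ht) hk, errorField, coupling, holdBefore_of_le (ha₀.trans ht)]
    congr 2
    refine Finset.sum_congr rfl fun j hj => ?_
    have hs := hsample i k t ht hk.2 j hj
    rw [holdBefore_of_le hs, holdBefore_of_le hs]

end IsErrorTrajectory

end Motion

/-! ### Trajectories of the plant and the observers -/

section Trajectory

variable {N n mw mv : ℕ} {S : Network N n mw mv} {g : Gains S} {x₀ : Fin n → ℝ}
  {w : ℝ → Fin mw → ℝ} {v : Fin N → ℝ → Fin mv → ℝ} {x : ℝ → Fin n → ℝ}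
  {xh : Fin N → ℝ → Fin n → ℝ} {i : Fin N} {a b : ℝ}

lemma intervalIntegrable_mulVec {ι ι' : Type*} [Fintype ι] [Fintype ι'] (M : Matrix ι ι' ℝ)
    {u : ℝ → ι' → ℝ} (hu : IntervalIntegrable u volume a b) :
    IntervalIntegrable (fun t => M *ᵥ u t) volume a b :=
  ⟨ContinuousLinearMap.integrable_comp (LinearMap.toContinuousLinearMap M.mulVecLin) hu.1,
    ContinuousLinearMap.integrable_comp (LinearMap.toContinuousLinearMap M.mulVecLin) hu.2⟩

lemma IsL2.intervalIntegrable_pert (hL : IsL2 w v) (i : Fin N) (ha : 0 ≤ a) (hb : 0 ≤ b) :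
    IntervalIntegrable (pert w v i) volume a b := by
  have hIoc {c d : ℝ} (hc : 0 ≤ c) : IntegrableOn (pert w v i) (Ioc c d) :=
    ((hL i).mono_measure (Measure.restrict_mono
      (Ioc_subset_Ioi_self.trans (Ioi_subset_Ioi hc)) le_rfl)).integrable one_le_two
  exact ⟨hIoc ha, hIoc hb⟩

lemma IsL2.integrableOn_dotProduct_pert (hL : IsL2 w v) (i : Fin N) :
    IntegrableOn (fun t => pert w v i t ⬝ᵥ pert w v i t) (Ioi 0) :=
  integrable_dotProduct_of_memLp (hL i) (hL i)

lemma IsL2.intervalIntegrable_dotProduct_pert (hL : IsL2 w v) (i : Fin N) (ha : 0 ≤ a)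
    (hb : 0 ≤ b) :
    IntervalIntegrable (fun t => pert w v i t ⬝ᵥ pert w v i t) volume a b :=
  ⟨(hL.integrableOn_dotProduct_pert i).mono_set
      (Ioc_subset_Ioi_self.trans (Ioi_subset_Ioi ha)),
    (hL.integrableOn_dotProduct_pert i).mono_set
      (Ioc_subset_Ioi_self.trans (Ioi_subset_Ioi hb))⟩

lemma B_mulVec_pert (i : Fin N) (t : ℝ) : S.B *ᵥ pert w v i t = S.B₂ *ᵥ w t := by
  rw [Network.B, pert, fromCols_mulVec_sumElim, zero_mulVec, add_zero]

lemma D_mulVec_pert (i : Fin N) (t : ℝ) :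
    S.D i *ᵥ pert w v i t = S.D₂ i *ᵥ w t + S.Dbar₂ i *ᵥ v i t := by
  rw [Network.D, pert, fromCols_mulVec_sumElim]

variable (S g w v x xh) in
/-- The right-hand side of the plant equation. -/
def plantField (s : ℝ) : Fin n → ℝ := S.A *ᵥ x s + S.B₂ *ᵥ w s

variable (S g w v x xh) in
/-- The right-hand side of the equation of observer `i` on `[t_k, t_{k+1})`. -/
def observerField (i : Fin N) (k : ℕ) (s : ℝ) : Fin n → ℝ :=
  S.A *ᵥ xh i s + g.L i *ᵥ (measurement S x w v i s - S.C i *ᵥ xh i s)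
    + g.K i *ᵥ ∑ j ∈ nbhd S.graph i,
        S.H i *ᵥ (xh j (S.sampleTime i k j) - xh i (S.sampleTime i k j))

lemma plantField_sub_observerField (i : Fin N) (k : ℕ) (s : ℝ) :
    plantField S w x s - observerField S g w v x xh i k s =
      errorField g (pert w v) (fun i t => x t - xh i t) i k s := by
  have hsum : ∑ j ∈ nbhd S.graph i, (x (S.sampleTime i k j) - xh j (S.sampleTime i k j)
      - (x (S.sampleTime i k j) - xh i (S.sampleTime i k j))) =
      -∑ j ∈ nbhd S.graph i, (xh j (S.sampleTime i k j) - xh i (S.sampleTime i k j)) := by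
    rw [← Finset.sum_neg_distrib]
    exact Finset.sum_congr rfl fun j _ => by abel
  rw [plantField, observerField, errorField, coupling, measurement, hsum, ← mulVec_sum,
    ← B_mulVec_pert (v := v) i, add_assoc (S.C i *ᵥ _), ← D_mulVec_pert]
  simp only [sub_mulVec, mulVec_sub, mulVec_add, mulVec_neg, ← mulVec_mulVec]
  abel

namespace IsTrajectory

lemma intervalIntegrable_plantField (ht : IsTrajectory S g x₀ w v x xh) (hL : IsL2 w v)
    (i : Fin N) (ha : 0 ≤ a) (hb : 0 ≤ b) :
    IntervalIntegrable (plantField S w x) volume a b := by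
  have heq : plantField S w x = fun s => S.A *ᵥ x s + S.B *ᵥ pert w v i s :=
    funext fun s => by rw [plantField, B_mulVec_pert]
  rw [heq]
  exact (intervalIntegrable_mulVec _ (ht.plant_cont.intervalIntegrable a b)).add
    (intervalIntegrable_mulVec _ (hL.intervalIntegrable_pert i ha hb))

lemma intervalIntegrable_observerField (ht : IsTrajectory S g x₀ w v x xh) (hL : IsL2 w v)
    (i : Fin N) (k : ℕ) (ha : 0 ≤ a) (hb : 0 ≤ b) :
    IntervalIntegrable (observerField S g w v x xh i k) volume a b := by
  have hxh := (ht.obs_cont i).intervalIntegrable (μ := volume) a b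
  have heq : observerField S g w v x xh i k = fun s => S.A *ᵥ xh i s
      + g.L i *ᵥ (S.C i *ᵥ x s + S.D i *ᵥ pert w v i s - S.C i *ᵥ xh i s)
      + g.K i *ᵥ ∑ j ∈ nbhd S.graph i,
          S.H i *ᵥ (xh j (S.sampleTime i k j) - xh i (S.sampleTime i k j)) :=
    funext fun s => by rw [observerField, measurement, add_assoc (S.C i *ᵥ _), D_mulVec_pert]
  rw [heq]
  refine ((intervalIntegrable_mulVec S.A hxh).add
    (intervalIntegrable_mulVec (g.L i) ?_)).add intervalIntegrable_const
  exact ((intervalIntegrable_mulVec (S.C i) (ht.plant_cont.intervalIntegrable a b)).add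
    (intervalIntegrable_mulVec (S.D i) (hL.intervalIntegrable_pert i ha hb))).sub
    (intervalIntegrable_mulVec (S.C i) hxh)

lemma isErrorTrajectory (ht : IsTrajectory S g x₀ w v x xh) (hL : IsL2 w v) :
    IsErrorTrajectory S g 0 (pert w v) fun i t => x t - xh i t where
  cont i := (ht.plant_cont.sub (ht.obs_cont i)).continuousOn
  eq i k a b ha hka hab hbk := by
    have hb := ha.trans hab
    have hk := S.t_nonneg k
    have hplant : ∫ s in a..b, plantField S w x s = x b - x a := by
      rw [ht.plant_eq a ha, ht.plant_eq b hb, add_sub_add_left_eq_sub]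
      exact (intervalIntegral.integral_interval_sub_left
        (ht.intervalIntegrable_plantField hL i le_rfl hb)
        (ht.intervalIntegrable_plantField hL i le_rfl ha)).symm
    have hobserver : ∫ s in a..b, observerField S g w v x xh i k s = xh i b - xh i a := by
      rw [ht.obs_eq i k a ⟨hka, hab.trans hbk⟩, ht.obs_eq i k b ⟨hka.trans hab, hbk⟩,
        add_sub_add_left_eq_sub]
      exact (intervalIntegral.integral_interval_sub_left
        (ht.intervalIntegrable_observerField hL i k hk hb)
        (ht.intervalIntegrable_observerField hL i k hk ha)).symm
    have herror : ∫ s in a..b, errorField g (pert w v) (fun i t => x t - xh i t) i k s =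
        x b - x a - (xh i b - xh i a) := by
      simp only [← plantField_sub_observerField]
      rw [intervalIntegral.integral_sub (ht.intervalIntegrable_plantField hL i ha hb)
        (ht.intervalIntegrable_observerField hL i k ha hb), hplant, hobserver]
    exact (eq_add_of_sub_eq' ((sub_sub_sub_comm _ _ _ _).trans herror.symm))

lemma error_of_nonpos (ht : IsTrajectory S g x₀ w v x xh) (i : Fin N) {t : ℝ} (h : t ≤ 0) :
    x t - xh i t = x₀ := by
  rw [ht.plant_init t h, ht.obs_init i t h, sub_zero]

lemma isMotion (ht : IsTrajectory S g x₀ w v x xh) (hL : IsL2 w v) :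
    IsMotion S g 0 (pert w v) (fun i t => x t - xh i t)
      (holdBeforeDeriv g (pert w v) (fun i t => x t - xh i t) 0) := by
  have hhold : holdBefore (fun i t => x t - xh i t) 0 = fun i t => x t - xh i t :=
    holdBefore_eq_self fun i t h => by rw [ht.error_of_nonpos i h, ht.error_of_nonpos i le_rfl]
  have hξ (i : Fin N) : MemLp (pert w v i) 2 (volume.restrict (Ici 0)) := by
    rw [← restrict_Ioi_eq_restrict_Ici]
    exact hL i
  have hm := (ht.isErrorTrajectory hL).isMotion le_rfl hξ le_rfl
    fun i k t _ _ j _ => S.sampleTime_nonneg i k j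
  rwa [hhold] at hm

end IsTrajectory

end Trajectory

/-! ### Consensus performance -/

section Performance

variable {N n mw mv : ℕ} {S : Network N n mw mv} {g : Gains S} {γ ε : ℝ} {V : LMIVars N n}
  {e f : Fin N → ℝ → Fin n → ℝ} {ξ : Fin N → ℝ → Fin mw ⊕ Fin mv → ℝ} {x₀ : Fin n → ℝ}
  {w : ℝ → Fin mw → ℝ} {v : Fin N → ℝ → Fin mv → ℝ} {x : ℝ → Fin n → ℝ}
  {xh : Fin N → ℝ → Fin n → ℝ} {i : Fin N}

lemma nat_mul_dotProduct_weightP_mulVec (hN : N ≠ 0) (u : Fin n → ℝ) :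
    N * (u ⬝ᵥ weightP S V *ᵥ u) = ∑ i, (u ⬝ᵥ (V.Y i)⁻¹ *ᵥ u
      + (1 - decayWeight S V i) / (2 * V.α i) * (u ⬝ᵥ V.S i *ᵥ u)) := by
  have hN' : (N : ℝ) ≠ 0 := Nat.cast_ne_zero.2 hN
  rw [weightP, smul_mulVec, dotProduct_smul, smul_eq_mul, ← mul_assoc, mul_one_div_cancel hN',
    one_mul, sum_mulVec, dotProduct_sum]
  simp only [add_mulVec, smul_mulVec, dotProduct_add, dotProduct_smul, smul_eq_mul, decayWeight]

-- With `c = 2 α_i τ_i` this is `1 + c ≤ e^c`, multiplied by `e^{-c}`.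
lemma decayWeight_mul_τ_le (hα : 0 < V.α i) :
    decayWeight S V i * S.τ i ≤ (1 - decayWeight S V i) / (2 * V.α i) := by
  have hexp := mul_le_mul_of_nonneg_left (Real.add_one_le_exp (2 * V.α i * S.τ i))
    (decayWeight_pos S V i).le
  have hinv : decayWeight S V i * Real.exp (2 * V.α i * S.τ i) = 1 := by
    rw [decayWeight, ← Real.exp_add, neg_mul, neg_mul, neg_add_cancel, Real.exp_zero]
  rw [le_div_iff₀ (by positivity)]
  linarith

lemma derivEnergy_of_nonpos (hf : ∀ t < 0, f i t = 0) {t : ℝ} (ht : t ≤ 0) :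
    derivEnergy V f i t = 0 := by
  rw [derivEnergy, intervalIntegral.integral_symm, neg_eq_zero,
    intervalIntegral.integral_congr_Ioo_of_le (g := fun _ => (0 : ℝ)) ht fun s hs => by
      rw [hf s hs.2, zero_dotProduct], intervalIntegral.integral_zero]

lemma nodeFunctional_zero (hτ : 0 ≤ S.τ i) (he : ∀ t ≤ 0, e i t = x₀)
    (hf : ∀ t < 0, f i t = 0) :
    nodeFunctional S V e f i 0 = x₀ ⬝ᵥ (V.Y i)⁻¹ *ᵥ x₀
      + decayWeight S V i * S.τ i * (x₀ ⬝ᵥ V.S i *ᵥ x₀) := by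
  have hτ' : 0 - S.τ i ≤ 0 := by linarith
  have hstate : ∫ s in (0 - S.τ i)..0, e i s ⬝ᵥ V.S i *ᵥ e i s =
      S.τ i * (x₀ ⬝ᵥ V.S i *ᵥ x₀) := by
    rw [intervalIntegral.integral_congr_Ioo_of_le (g := fun _ => x₀ ⬝ᵥ V.S i *ᵥ x₀) hτ'
      fun s hs => by rw [he s hs.2.le]]
    simp
  have henergy : ∫ s in (0 - S.τ i)..0, derivEnergy V f i s = 0 := by
    rw [intervalIntegral.integral_congr_Ioo_of_le (g := fun _ => (0 : ℝ)) hτ'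
      fun s hs => derivEnergy_of_nonpos hf hs.2.le, intervalIntegral.integral_zero]
  rw [nodeFunctional, hstate, henergy, derivEnergy_of_nonpos hf le_rfl, he 0 le_rfl]
  ring

lemma edgeFunctional_sampleTime_zero (i j : Fin N) :
    edgeFunctional S V e f i j (S.sampleTime i 0 j) 0 = 0 := by
  have hs : S.sampleTime i 0 j = 0 :=
    le_antisymm ((S.sampleTime_le i 0 j).trans_eq S.t_zero) (S.sampleTime_nonneg i 0 j)
  rw [hs, edgeFunctional_self]

lemma lyapunov_zero_le (hF : Feasible S g γ V ε) (hN : N ≠ 0) (he : ∀ i, ∀ t ≤ 0, e i t = x₀)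
    (hf : ∀ i, ∀ t < 0, f i t = 0) :
    lyapunov S V e f 0 0 ≤ N * (x₀ ⬝ᵥ weightP S V *ᵥ x₀) := by
  simp only [nat_mul_dotProduct_weightP_mulVec hN, lyapunov, edgeFunctional_sampleTime_zero,
    Finset.sum_const_zero, add_zero]
  refine Finset.sum_le_sum fun i _ => ?_
  rw [nodeFunctional_zero (hF.τ_nonneg i) (he i) (hf i)]
  gcongr
  · exact dotProduct_mulVec_self_nonneg (hF.posSemidef_S i) x₀
  · exact decayWeight_mul_τ_le (hF.α_pos i)

lemma integral_supplyRate_le (hε : 0 ≤ ε) (h : ∀ i, HasL2Deriv (e i) (f i)) {a b : ℝ}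
    (hab : a ≤ b) (hξ : ∀ i, IntervalIntegrable (fun t => ξ i t ⬝ᵥ ξ i t) volume a b) :
    ∫ t in a..b, supplyRate S γ ε ξ e f t ≤
      (∫ t in a..b, ∑ i, ξ i t ⬝ᵥ ξ i t)
        - 1 / γ ^ 2 * ∫ t in a..b, disagreementRate S e t := by
  have hpert : IntervalIntegrable (fun t => ∑ i, ξ i t ⬝ᵥ ξ i t) volume a b :=
    intervalIntegrable_fun_sum fun i _ => hξ i
  have hdis : IntervalIntegrable (disagreementRate S e) volume a b :=
    (continuous_disagreementRate fun i => (h i).continuous).intervalIntegrable _ _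
  rw [← intervalIntegral.integral_const_mul, ← intervalIntegral.integral_sub hpert
    (hdis.const_mul _)]
  exact intervalIntegral.integral_mono_on hab (intervalIntegrable_supplyRate h hξ)
    (hpert.sub (hdis.const_mul _)) fun t _ => sub_le_self _ (mul_nonneg hε (sqRate_nonneg t))

lemma integral_disagreementRate_le (hF : Feasible S g γ V ε) (hγ : γ ≠ 0)
    (hm : IsMotion S g 0 ξ e f)
    (hξ : ∀ i a b, 0 ≤ a → a ≤ b → IntervalIntegrable (fun t => ξ i t ⬝ᵥ ξ i t) volume a b)
    (k : ℕ) :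
    ∫ t in (0 : ℝ)..S.t k, disagreementRate S e t ≤
      γ ^ 2 * (lyapunov S V e f 0 0 + ∫ t in (0 : ℝ)..S.t k, ∑ i, ξ i t ⬝ᵥ ξ i t) := by
  have hk := S.t_nonneg k
  have hmem (l : ℕ) : S.t l ∈ Icc (S.t l) (S.t (l + 1)) :=
    left_mem_Icc.2 (S.t_strictMono l.lt_succ_self).le
  have hdissipation := lyapunov_le hF hm hξ (Nat.zero_le k) le_rfl
    (S.t_zero ▸ hmem 0 : (0 : ℝ) ∈ _) hk (hmem k)
  have hlower := sum_le_lyapunov hm.hasL2Deriv hF.posSemidef_S hF.posSemidef_R hF.posSemidef_W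
    hF.bddAbove_pollGap (hmem k) (V := V)
  have hnonneg : 0 ≤ ∑ i, e i (S.t k) ⬝ᵥ (V.Y i)⁻¹ *ᵥ e i (S.t k) :=
    Finset.sum_nonneg fun i _ => dotProduct_mulVec_self_nonneg (hF.posDef_Y i).inv.posSemidef _
  have hsupply := integral_supplyRate_le (S := S) (γ := γ) hF.ε_pos.le hm.hasL2Deriv hk
    fun i => hξ i _ _ le_rfl hk
  have hbound : 1 / γ ^ 2 * ∫ t in (0 : ℝ)..S.t k, disagreementRate S e t ≤
      lyapunov S V e f 0 0 + ∫ t in (0 : ℝ)..S.t k, ∑ i, ξ i t ⬝ᵥ ξ i t := by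
    linarith
  rwa [one_div_mul_eq_div, div_le_iff₀' (by positivity)] at hbound

lemma posDef_weightP (hF : Feasible S g γ V ε) (hN : N ≠ 0) : (weightP S V).PosDef := by
  have : NeZero N := ⟨hN⟩
  refine (posDef_sum Finset.univ_nonempty fun i _ => ?_).smul
    (one_div_pos.2 (Nat.cast_pos.2 hN.bot_lt) : (0 : ℝ) < 1 / N)
  have hα := hF.α_pos i
  exact (hF.posDef_Y i).inv.add_posSemidef ((hF.posSemidef_S i).smul (div_nonneg
    (sub_nonneg.2 (decayWeight_le_one hα.le (hF.τ_nonneg i))) (by positivity)))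

lemma eucl_sq {ι : Type} [Fintype ι] (u : ι → ℝ) : eucl u ^ 2 = u ⬝ᵥ u := by
  rw [eucl, EuclideanSpace.real_norm_sq_eq]
  simp [dotProduct, pow_two]

lemma ofReal_disagreementRate (t : ℝ) :
    ENNReal.ofReal (disagreementRate S (fun i t => x t - xh i t) t) =
      ∑ i, ∑ j ∈ nbhd S.graph i, ENNReal.ofReal (eucl (xh j t - xh i t) ^ 2) := by
  rw [disagreementRate, ENNReal.ofReal_sum_of_nonneg fun i _ =>
    Finset.sum_nonneg fun j _ => dotProduct_self_nonneg _]
  refine Finset.sum_congr rfl fun i _ => ?_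
  rw [ENNReal.ofReal_sum_of_nonneg fun j _ => dotProduct_self_nonneg _]
  refine Finset.sum_congr rfl fun j _ => ?_
  rw [eucl_sq, sub_sub_sub_cancel_left, ← neg_sub (xh i t) (xh j t), neg_dotProduct_neg]

lemma ofReal_sum_dotProduct_pert (t : ℝ) :
    ENNReal.ofReal (∑ i, pert w v i t ⬝ᵥ pert w v i t) =
      ∑ i, ENNReal.ofReal (eucl (pert w v i t) ^ 2) := by
  rw [ENNReal.ofReal_sum_of_nonneg fun i _ => dotProduct_self_nonneg _]
  simp only [eucl_sq]

lemma Network.setLIntegral_Ioi_le {φ : ℝ → ℝ≥0∞} {c : ℝ≥0∞} (S : Network N n mw mv)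
    (h : ∀ k, ∫⁻ t in Ioc 0 (S.t k), φ t ≤ c) : ∫⁻ t in Ioi (0 : ℝ), φ t ≤ c := by
  have hUnion : Ioi (0 : ℝ) = ⋃ k, Ioc 0 (S.t k) := by
    ext t
    simp only [mem_Ioi, mem_iUnion, mem_Ioc]
    exact ⟨fun ht => ⟨_, ht, (S.lt_t_samplingIndex_succ t).le⟩, fun ⟨_, ht, _⟩ => ht⟩
  have hmono : Monotone fun k => Ioc 0 (S.t k) := fun k l hkl =>
    Ioc_subset_Ioc_right (S.t_strictMono.monotone hkl)
  rw [hUnion, setLIntegral_iUnion_of_directed _ hmono.directed_le]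
  exact iSup_le h

lemma IsL2.ofReal_integral_sum_dotProduct_pert_le (hL : IsL2 w v) {b : ℝ} (hb : 0 ≤ b) :
    ENNReal.ofReal (∫ t in (0 : ℝ)..b, ∑ i, pert w v i t ⬝ᵥ pert w v i t) ≤
      pertNormSq w v := by
  have hint : IntervalIntegrable (fun t => ∑ i, pert w v i t ⬝ᵥ pert w v i t) volume 0 b :=
    intervalIntegrable_fun_sum fun i _ => hL.intervalIntegrable_dotProduct_pert i le_rfl hb
  rw [intervalIntegral.integral_of_le hb, ofReal_integral_eq_lintegral_ofReal hint.1
    (.of_forall fun t => Finset.sum_nonneg fun i _ => dotProduct_self_nonneg _), pertNormSq]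
  simp only [ofReal_sum_dotProduct_pert]
  exact lintegral_mono_set Ioc_subset_Ioi_self

lemma setLIntegral_disagreementRate_le (hF : Feasible S g γ V ε) (hN : N ≠ 0) (hγ : γ ≠ 0)
    (hL : IsL2 w v) (ht : IsTrajectory S g x₀ w v x xh) (k : ℕ) :
    ∫⁻ t in Ioc 0 (S.t k), ENNReal.ofReal (disagreementRate S (fun i t => x t - xh i t) t) ≤
      ENNReal.ofReal (γ ^ 2) *
        (N * ENNReal.ofReal (x₀ ⬝ᵥ weightP S V *ᵥ x₀) + pertNormSq w v) := by
  have hk := S.t_nonneg k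
  have hm := ht.isMotion hL
  have hcont : Continuous (disagreementRate S fun i t => x t - xh i t) :=
    continuous_disagreementRate fun i => (hm.hasL2Deriv i).continuous
  have hstart := lyapunov_zero_le hF hN (fun i t => ht.error_of_nonpos i)
    (f := holdBeforeDeriv g (pert w v) (fun i t => x t - xh i t) 0)
    fun i t h => holdBeforeDeriv_of_lt h
  have hbound := integral_disagreementRate_le hF hγ hm
    (fun i a b ha hab => hL.intervalIntegrable_dotProduct_pert i ha (ha.trans hab)) k
  have hP := dotProduct_mulVec_self_nonneg (posDef_weightP hF hN).posSemidef x₀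
  rw [← ofReal_integral_eq_lintegral_ofReal (hcont.intervalIntegrable (μ := volume) 0 (S.t k)).1
    (.of_forall fun t => disagreementRate_nonneg t), ← intervalIntegral.integral_of_le hk]
  calc _ ≤ ENNReal.ofReal (γ ^ 2 * (N * (x₀ ⬝ᵥ weightP S V *ᵥ x₀)
        + ∫ t in (0 : ℝ)..S.t k, ∑ i, pert w v i t ⬝ᵥ pert w v i t)) := by
        refine ENNReal.ofReal_le_ofReal (hbound.trans ?_)
        gcongr
    _ = ENNReal.ofReal (γ ^ 2) * (N * ENNReal.ofReal (x₀ ⬝ᵥ weightP S V *ᵥ x₀)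
        + ENNReal.ofReal (∫ t in (0 : ℝ)..S.t k, ∑ i, pert w v i t ⬝ᵥ pert w v i t)) := by
        rw [ENNReal.ofReal_mul (by positivity), ENNReal.ofReal_add (by positivity)
          (intervalIntegral.integral_nonneg hk fun t _ =>
            Finset.sum_nonneg fun i _ => dotProduct_self_nonneg _),
          ENNReal.ofReal_mul N.cast_nonneg, ENNReal.ofReal_natCast]
    _ ≤ _ := by
        gcongr
        exact hL.ofReal_integral_sum_dotProduct_pert_le hk

lemma consensusPerformance (hF : Feasible S g γ V ε) (hN : N ≠ 0) (hγ : γ ≠ 0) :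
    ConsensusPerformance S g γ (weightP S V) := by
  refine iSup_le fun x₀ => iSup_le fun w => iSup_le fun v => iSup_le fun x => iSup_le fun xh =>
    iSup_le fun hL => iSup_le fun _ => iSup_le fun ht => ENNReal.div_le_of_le_mul ?_
  have htotal := S.setLIntegral_Ioi_le (setLIntegral_disagreementRate_le hF hN hγ hL ht)
  simp only [ofReal_disagreementRate] at htotal
  rw [disagreement]
  refine (mul_le_mul_right htotal _).trans_eq ?_
  rw [mul_left_comm, mul_add, ← mul_assoc (N : ℝ≥0∞)⁻¹, ENNReal.inv_mul_cancel
    (Nat.cast_ne_zero.2 hN) (ENNReal.natCast_ne_top N), one_mul]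

end Performance

/-! ### Upper bounds of the functional -/

lemma integral_le_integral_of_le {q ψ : ℝ → ℝ} {a s t : ℝ} (has : a ≤ s) (hst : s ≤ t)
    (hq : IntervalIntegrable q volume s t) (hψ : IntervalIntegrable ψ volume a t)
    (hψ₀ : ∀ u, 0 ≤ ψ u) (hle : ∀ u, q u ≤ ψ u) : ∫ u in s..t, q u ≤ ∫ u in a..t, ψ u :=
  (intervalIntegral.integral_mono_on hst hq (hψ.mono_set (by
    rw [uIcc_of_le hst, uIcc_of_le (has.trans hst)]
    exact Icc_subset_Icc_left has)) fun u _ => hle u).trans <|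
  intervalIntegral.integral_mono_interval has hst le_rfl (.of_forall hψ₀) hψ

-- `z · z` differs from its value at `t` by at most the integral of `2 (z · f)`; the claim is the
-- mean of this bound over the window.
lemma HasL2Deriv.mul_dotProduct_self_le {ι : Type*} [Fintype ι] {z f : ℝ → ι → ℝ}
    (hz : HasL2Deriv z f) {h : ℝ} (hh : 0 ≤ h) (t : ℝ) :
    h * (z t ⬝ᵥ z t) ≤ (1 + h) * ∫ u in (t - h)..t, (z u ⬝ᵥ z u + f u ⬝ᵥ f u) := by
  have hth : t - h ≤ t := sub_le_self t hh
  have hsq : Continuous fun u => z u ⬝ᵥ z u := hz.continuous.dotProduct hz.continuous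
  have hint : IntervalIntegrable (fun u => z u ⬝ᵥ z u + f u ⬝ᵥ f u) volume (t - h) t :=
    (hsq.intervalIntegrable _ _).add (hz.intervalIntegrable_dotProduct_self _ _)
  have hnonneg (u : ℝ) : 0 ≤ z u ⬝ᵥ z u + f u ⬝ᵥ f u :=
    add_nonneg (dotProduct_self_nonneg _) (dotProduct_self_nonneg _)
  set I := ∫ u in (t - h)..t, (z u ⬝ᵥ z u + f u ⬝ᵥ f u)
  have hpoint (r : ℝ) (hr : r ∈ Icc (t - h) t) : z t ⬝ᵥ z t ≤ z r ⬝ᵥ z r + I := by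
    have hprim := hz.isPrimitive.dotProduct hz.isPrimitive
    rw [hprim.eq_add_integral r t]
    gcongr
    refine integral_le_integral_of_le hr.1 hr.2 (hprim.intervalIntegrable r t) hint hnonneg
      fun u => ?_
    rw [dotProduct_comm (f u), ← two_mul]
    exact two_mul_dotProduct_le _ _
  have hmean := intervalIntegral.integral_mono_on (μ := volume) hth intervalIntegrable_const
    ((hsq.intervalIntegrable _ _).add intervalIntegrable_const) hpoint
  rw [intervalIntegral.integral_add (hsq.intervalIntegrable _ _) intervalIntegrable_const,
    intervalIntegral.integral_const, intervalIntegral.integral_const, sub_sub_cancel, smul_eq_mul,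
    smul_eq_mul] at hmean
  have hstate : ∫ u in (t - h)..t, z u ⬝ᵥ z u ≤ I :=
    integral_le_integral_of_le le_rfl hth (hsq.intervalIntegrable _ _) hint hnonneg
      fun u => le_add_of_nonneg_right (dotProduct_self_nonneg _)
  linarith

section UpperBound

variable {N n mw mv : ℕ} {S : Network N n mw mv} {g : Gains S} {γ ε : ℝ} {V : LMIVars N n}
  {e f : Fin N → ℝ → Fin n → ℝ} {i j : Fin N} {h s t : ℝ}

lemma dotProduct_self_add_le_sqRate (i : Fin N) (t : ℝ) :
    e i t ⬝ᵥ e i t + f i t ⬝ᵥ f i t ≤ sqRate e f t :=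
  Finset.single_le_sum (f := fun i => e i t ⬝ᵥ e i t + f i t ⬝ᵥ f i t)
    (fun _ _ => add_nonneg (dotProduct_self_nonneg _) (dotProduct_self_nonneg _))
    (Finset.mem_univ i)

lemma dotProduct_self_le_sqRate (i : Fin N) (t : ℝ) : e i t ⬝ᵥ e i t ≤ sqRate e f t :=
  (le_add_of_nonneg_right (dotProduct_self_nonneg _)).trans (dotProduct_self_add_le_sqRate i t)

lemma deriv_dotProduct_self_le_sqRate (i : Fin N) (t : ℝ) : f i t ⬝ᵥ f i t ≤ sqRate e f t :=
  (le_add_of_nonneg_left (dotProduct_self_nonneg _)).trans (dotProduct_self_add_le_sqRate i t)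

lemma integral_sqRate_nonneg (hst : s ≤ t) : 0 ≤ ∫ u in s..t, sqRate e f u :=
  intervalIntegral.integral_nonneg hst fun u _ => sqRate_nonneg u

lemma dotProduct_self_le_integral_sqRate (he : ∀ i, HasL2Deriv (e i) (f i)) (hh : 0 < h)
    (i : Fin N) (t : ℝ) :
    e i t ⬝ᵥ e i t ≤ (1 + h) / h * ∫ u in (t - h)..t, sqRate e f u := by
  have hwindow := (he i).mul_dotProduct_self_le hh.le t
  have hmono : ∫ u in (t - h)..t, (e i u ⬝ᵥ e i u + f i u ⬝ᵥ f i u) ≤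
      ∫ u in (t - h)..t, sqRate e f u :=
    integral_le_integral_of_le le_rfl (sub_le_self t hh.le)
      ((((he i).continuous.dotProduct (he i).continuous).intervalIntegrable _ _).add
        ((he i).intervalIntegrable_dotProduct_self _ _))
      (intervalIntegrable_sqRate he _ _) sqRate_nonneg (dotProduct_self_add_le_sqRate i)
  rw [div_mul_eq_mul_div, le_div_iff₀' hh]
  exact hwindow.trans (mul_le_mul_of_nonneg_left hmono (by positivity))

lemma integral_quadraticForm_le_integral_sqRate (he : ∀ i, HasL2Deriv (e i) (f i))
    {z : ℝ → Fin n → ℝ} {M : Matrix (Fin n) (Fin n) ℝ} {c : ℝ} (hc : 0 ≤ c)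
    (hM : ∀ v, v ⬝ᵥ M *ᵥ v ≤ c * (v ⬝ᵥ v))
    (hz : IntervalIntegrable (fun u => z u ⬝ᵥ M *ᵥ z u) volume s t)
    (hle : ∀ u, z u ⬝ᵥ z u ≤ sqRate e f u) (hs : t - h ≤ s) (hst : s ≤ t) :
    ∫ u in s..t, z u ⬝ᵥ M *ᵥ z u ≤ c * ∫ u in (t - h)..t, sqRate e f u := by
  rw [← intervalIntegral.integral_const_mul]
  exact integral_le_integral_of_le hs hst hz ((intervalIntegrable_sqRate he _ _).const_mul c)
    (fun u => mul_nonneg hc (sqRate_nonneg u))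
    fun u => (hM _).trans (mul_le_mul_of_nonneg_left (hle u) hc)

lemma nodeFunctional_le (hF : Feasible S g γ V ε) (he : HasL2Deriv (e i) (f i)) (t : ℝ) :
    nodeFunctional S V e f i t ≤ e i t ⬝ᵥ (V.Y i)⁻¹ *ᵥ e i t
      + (∫ s in (t - S.τ i)..t, e i s ⬝ᵥ V.S i *ᵥ e i s)
      + S.τ i ^ 2 * ∫ s in (t - S.τ i)..t, f i s ⬝ᵥ V.R i *ᵥ f i s := by
  have hτ := hF.τ_nonneg i
  have htτ : t - S.τ i ≤ t := sub_le_self t hτ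
  have hweight := decayWeight_le_one (hF.α_pos i).le hτ
  have hE := isPrimitive_derivEnergy (V := V) he
  have hstate : 0 ≤ ∫ s in (t - S.τ i)..t, e i s ⬝ᵥ V.S i *ᵥ e i s :=
    intervalIntegral.integral_nonneg htτ fun s _ => dotProduct_mulVec_self_nonneg
      (hF.posSemidef_S i) _
  have henergy : S.τ i * derivEnergy V f i t - ∫ s in (t - S.τ i)..t, derivEnergy V f i s ≤
      S.τ i * ∫ s in (t - S.τ i)..t, f i s ⬝ᵥ V.R i *ᵥ f i s := by
    have hmono := intervalIntegral.integral_mono_on (μ := volume) htτ intervalIntegrable_const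
      (hE.continuous.intervalIntegrable _ _)
      fun s hs => monotone_derivEnergy he (hF.posSemidef_R i) hs.1
    rw [intervalIntegral.integral_const, sub_sub_cancel, smul_eq_mul] at hmono
    rw [hE.integral_eq_sub]
    linarith
  have henergy_nonneg : 0 ≤ ∫ s in (t - S.τ i)..t, f i s ⬝ᵥ V.R i *ᵥ f i s :=
    intervalIntegral.integral_nonneg htτ fun s _ => dotProduct_mulVec_self_nonneg
      (hF.posSemidef_R i) _
  have hweighted : decayWeight S V i * S.τ i *
      (S.τ i * derivEnergy V f i t - ∫ s in (t - S.τ i)..t, derivEnergy V f i s) ≤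
      S.τ i ^ 2 * ∫ s in (t - S.τ i)..t, f i s ⬝ᵥ V.R i *ᵥ f i s :=
    calc _ ≤ decayWeight S V i * S.τ i *
          (S.τ i * ∫ s in (t - S.τ i)..t, f i s ⬝ᵥ V.R i *ᵥ f i s) :=
          mul_le_mul_of_nonneg_left henergy (mul_nonneg (decayWeight_pos S V i).le hτ)
      _ ≤ 1 * S.τ i * (S.τ i * ∫ s in (t - S.τ i)..t, f i s ⬝ᵥ V.R i *ᵥ f i s) := by gcongr
      _ = _ := by ring
  rw [nodeFunctional]
  gcongr
  exact mul_le_of_le_one_left hstate hweight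

lemma edgeFunctional_le (hW : (V.W j).PosSemidef) (hst : s ≤ t) :
    edgeFunctional S V e f i j s t ≤ S.τ i ^ 2 * ∫ u in s..t, f j u ⬝ᵥ V.W j *ᵥ f j u :=
  sub_le_self _ <| mul_nonneg (by positivity) <|
    intervalIntegral.integral_nonneg hst fun _ _ => dotProduct_mulVec_self_nonneg hW _

lemma exists_nodeFunctional_le (hF : Feasible S g γ V ε) (hh : 0 < h) (hτh : S.τ i ≤ h) :
    ∃ C : ℝ, 0 ≤ C ∧ ∀ e f : Fin N → ℝ → Fin n → ℝ, (∀ i, HasL2Deriv (e i) (f i)) →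
      ∀ t, nodeFunctional S V e f i t ≤ C * ∫ u in (t - h)..t, sqRate e f u := by
  obtain ⟨cY, hcY, hY⟩ := exists_dotProduct_mulVec_self_le (V.Y i)⁻¹
  obtain ⟨cS, hcS, hS⟩ := exists_dotProduct_mulVec_self_le (V.S i)
  obtain ⟨cR, hcR, hR⟩ := exists_dotProduct_mulVec_self_le (V.R i)
  refine ⟨cY * ((1 + h) / h) + cS + S.τ i ^ 2 * cR, by positivity, fun e f he t => ?_⟩
  have hlast := (hY (e i t)).trans
    (mul_le_mul_of_nonneg_left (dotProduct_self_le_integral_sqRate he hh i t) hcY)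
  have hτt : t - S.τ i ≤ t := sub_le_self t (hF.τ_nonneg i)
  have hstate := integral_quadraticForm_le_integral_sqRate he hcS hS
    (((he i).continuous.dotProduct (continuous_const.matrix_mulVec
      (he i).continuous)).intervalIntegrable _ _)
    (dotProduct_self_le_sqRate i) (sub_le_sub_left hτh t) hτt
  have henergy := integral_quadraticForm_le_integral_sqRate he hcR hR
    ((he i).intervalIntegrable_quadraticForm _ _ _) (deriv_dotProduct_self_le_sqRate i)
    (sub_le_sub_left hτh t) hτt
  rw [add_mul, add_mul, mul_assoc, mul_assoc]
  refine (nodeFunctional_le hF (he i) t).trans ?_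
  gcongr

lemma exists_edgeFunctional_le (hW : (V.W j).PosSemidef) (i : Fin N) :
    ∃ C : ℝ, 0 ≤ C ∧ ∀ e f : Fin N → ℝ → Fin n → ℝ, (∀ i, HasL2Deriv (e i) (f i)) →
      ∀ h s t, t - h ≤ s → s ≤ t →
        edgeFunctional S V e f i j s t ≤ C * ∫ u in (t - h)..t, sqRate e f u := by
  obtain ⟨c, hc, hcW⟩ := exists_dotProduct_mulVec_self_le (V.W j)
  refine ⟨S.τ i ^ 2 * c, by positivity, fun e f he h s t hs hst => ?_⟩
  rw [mul_assoc]
  exact (edgeFunctional_le hW hst).trans <| mul_le_mul_of_nonneg_left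
    (integral_quadraticForm_le_integral_sqRate he hc hcW
      ((he j).intervalIntegrable_quadraticForm _ _ _) (deriv_dotProduct_self_le_sqRate j) hs hst)
    (sq_nonneg _)

lemma exists_lyapunov_le (hF : Feasible S g γ V ε) (hh : 0 < h) (hτh : ∀ i, S.τ i ≤ h) :
    ∃ C : ℝ, 0 ≤ C ∧ ∀ e f : Fin N → ℝ → Fin n → ℝ, (∀ i, HasL2Deriv (e i) (f i)) →
      ∀ k, ∀ t ∈ Icc (S.t k) (S.t (k + 1)),
        lyapunov S V e f k t ≤ C * ∫ u in (t - h)..t, sqRate e f u := by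
  choose A hA hnode using fun i => exists_nodeFunctional_le hF hh (hτh i)
  choose B hB hedge using fun i j => exists_edgeFunctional_le (S := S) (hF.posSemidef_W j) i
  refine ⟨∑ i, A i + ∑ i, ∑ j ∈ nbhd S.graph i, B i j, add_nonneg
    (Finset.sum_nonneg fun i _ => hA i)
    (Finset.sum_nonneg fun i _ => Finset.sum_nonneg fun j _ => hB i j), fun e f he k t ht => ?_⟩
  rw [lyapunov, add_mul, Finset.sum_mul, Finset.sum_mul]
  gcongr with i _ i _
  · exact hnode i e f he t
  · rw [Finset.sum_mul]
    gcongr with j hj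
    refine hedge i j e f he _ _ _ ?_ ((S.sampleTime_le i k j).trans ht.1)
    linarith [S.t_succ_sub_τ_le_sampleTime (hF.bddAbove_pollGap i) k hj, ht.2, hτh i]

end UpperBound

/-! ### Exponential decay of the functional -/

lemma le_exp_mul_of_contraction_nat {v : ℝ → ℝ} {a h κ : ℝ} (hh : 0 ≤ h)
    (hstep : ∀ s, a ≤ s → v (s + h) ≤ Real.exp (-κ * h) * v s) (m : ℕ) :
    v (a + m * h) ≤ Real.exp (-κ * (m * h)) * v a := by
  induction m with
  | zero => simp
  | succ m ih =>
    calc v (a + (m + 1 : ℕ) * h) = v (a + m * h + h) := by push_cast; ring_nf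
      _ ≤ Real.exp (-κ * h) * v (a + m * h) := hstep _ (le_add_of_nonneg_right (by positivity))
      _ ≤ Real.exp (-κ * h) * (Real.exp (-κ * (m * h)) * v a) := by gcongr
      _ = Real.exp (-κ * ((m + 1 : ℕ) * h)) * v a := by
        rw [← mul_assoc, ← Real.exp_add]
        push_cast
        ring_nf

lemma le_exp_mul_of_contraction {v : ℝ → ℝ} {a h κ t : ℝ}
    (hv : AntitoneOn v (Ici a)) (hva : 0 ≤ v a) (hh : 0 < h) (hκ : 0 ≤ κ)
    (hstep : ∀ s, a ≤ s → v (s + h) ≤ Real.exp (-κ * h) * v s) (ht : a ≤ t) :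
    v t ≤ Real.exp (-κ * (t - a - h)) * v a := by
  set m := ⌊(t - a) / h⌋₊
  have hle : m * h ≤ t - a := (le_div_iff₀ hh).1 (Nat.floor_le (div_nonneg (sub_nonneg.2 ht) hh.le))
  have hlt : t - a < (m + 1) * h := (div_lt_iff₀ hh).1 (Nat.lt_floor_add_one _)
  have ham : a ≤ a + m * h := le_add_of_nonneg_right (by positivity)
  calc v t ≤ v (a + m * h) := hv ham ht (by linarith)
    _ ≤ Real.exp (-κ * (m * h)) * v a := le_exp_mul_of_contraction_nat hh.le hstep m
    _ ≤ Real.exp (-κ * (t - a - h)) * v a := by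
      have hexp : -κ * (m * h) ≤ -κ * (t - a - h) :=
        mul_le_mul_of_nonpos_left (by linarith) (neg_nonpos.2 hκ)
      gcongr

section Decay

variable {N n mw mv : ℕ} {S : Network N n mw mv} {g : Gains S} {γ ε : ℝ} {V : LMIVars N n}
  {e f : Fin N → ℝ → Fin n → ℝ} {a₀ h : ℝ}

lemma supplyRate_zero_le (t : ℝ) : supplyRate S γ ε 0 e f t ≤ -ε * sqRate e f t := by
  have hdisagreement : 0 ≤ 1 / γ ^ 2 * disagreementRate S e t :=
    mul_nonneg (by positivity) (disagreementRate_nonneg t)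
  simp only [supplyRate, Pi.zero_apply, dotProduct_zero, Finset.sum_const_zero]
  linarith

lemma lyapunov_le_sub_integral_sqRate (hF : Feasible S g γ V ε) (hm : IsMotion S g a₀ 0 e f)
    (ha₀ : 0 ≤ a₀) {s r : ℝ} (hs : a₀ ≤ s) (hsr : s ≤ r) :
    lyapunov S V e f (S.samplingIndex r) r ≤
      lyapunov S V e f (S.samplingIndex s) s - ε * ∫ u in s..r, sqRate e f u := by
  have hzero (i : Fin N) (a b : ℝ) : IntervalIntegrable
      (fun t => (0 : Fin N → ℝ → Fin mw ⊕ Fin mv → ℝ) i t ⬝ᵥ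
        (0 : Fin N → ℝ → Fin mw ⊕ Fin mv → ℝ) i t) volume a b := by simp
  have hlyap := lyapunov_le hF hm (fun i a b _ _ => hzero i a b) (S.samplingIndex_mono hsr) hs
    (Ico_subset_Icc_self (S.mem_Ico_samplingIndex (ha₀.trans hs))) hsr
    (Ico_subset_Icc_self (S.mem_Ico_samplingIndex (ha₀.trans (hs.trans hsr))))
  have hsupply := intervalIntegral.integral_mono_on hsr
    (intervalIntegrable_supplyRate (S := S) (γ := γ) (ε := ε) hm.hasL2Deriv
      fun i => hzero i s r)
    ((intervalIntegrable_sqRate hm.hasL2Deriv s r).const_mul (-ε)) fun u _ => supplyRate_zero_le u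
  rw [intervalIntegral.integral_const_mul] at hsupply
  linarith

lemma sum_le_lyapunov_samplingIndex (hF : Feasible S g γ V ε)
    (he : ∀ i, HasL2Deriv (e i) (f i)) {t : ℝ} (ht : 0 ≤ t) :
    ∑ i, e i t ⬝ᵥ (V.Y i)⁻¹ *ᵥ e i t ≤ lyapunov S V e f (S.samplingIndex t) t :=
  sum_le_lyapunov he hF.posSemidef_S hF.posSemidef_R hF.posSemidef_W hF.bddAbove_pollGap
    (Ico_subset_Icc_self (S.mem_Ico_samplingIndex ht))

lemma antitoneOn_lyapunov (hF : Feasible S g γ V ε) (hm : IsMotion S g a₀ 0 e f) (ha₀ : 0 ≤ a₀) :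
    AntitoneOn (fun t => lyapunov S V e f (S.samplingIndex t) t) (Ici a₀) := fun _ hs _ _ hsr =>
  (lyapunov_le_sub_integral_sqRate hF hm ha₀ hs hsr).trans <|
    sub_le_self _ (mul_nonneg hF.ε_pos.le (integral_sqRate_nonneg hsr))

-- Over a window of length `h` the functional loses at least `ε I` and ends below `C I`, where `I`
-- is the integral of the square rate over the window. Hence it contracts by `C / (ε + C)`.
lemma exists_lyapunov_decay (hF : Feasible S g γ V ε) (hh : 0 < h) (hτh : ∀ i, S.τ i ≤ h) :
    ∃ K : ℝ, 0 ≤ K ∧ ∃ κ : ℝ, 0 < κ ∧ ∀ a₀, 0 ≤ a₀ → ∀ e f : Fin N → ℝ → Fin n → ℝ,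
      IsMotion S g a₀ 0 e f → ∀ t, a₀ ≤ t → lyapunov S V e f (S.samplingIndex t) t ≤
        K * Real.exp (-κ * (t - a₀)) * ∫ u in (a₀ - h)..a₀, sqRate e f u := by
  obtain ⟨C, hC, hup⟩ := exists_lyapunov_le hF hh hτh
  have hε := hF.ε_pos
  set κ := ε / (ε + C) / h
  have hκh : -κ * h = -(ε / (ε + C)) := by rw [neg_mul, div_mul_cancel₀ _ hh.ne']
  have hκ : 0 < κ := by positivity
  refine ⟨Real.exp (κ * h) * C, by positivity, κ, hκ, fun a₀ ha₀ e f hm t ht => ?_⟩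
  set v : ℝ → ℝ := fun t => lyapunov S V e f (S.samplingIndex t) t
  have hv_le (s : ℝ) (hs : a₀ ≤ s) : v s ≤ C * ∫ u in (s - h)..s, sqRate e f u :=
    hup e f hm.hasL2Deriv _ _ (Ico_subset_Icc_self (S.mem_Ico_samplingIndex (ha₀.trans hs)))
  have hv_nonneg (s : ℝ) (hs : a₀ ≤ s) : 0 ≤ v s :=
    (Finset.sum_nonneg fun i _ => dotProduct_mulVec_self_nonneg (hF.posDef_Y i).inv.posSemidef
      _).trans (sum_le_lyapunov_samplingIndex hF hm.hasL2Deriv (ha₀.trans hs))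
  have hstep (s : ℝ) (hs : a₀ ≤ s) : v (s + h) ≤ Real.exp (-κ * h) * v s := by
    have hloss : v (s + h) ≤ v s - ε * ∫ u in s..(s + h), sqRate e f u :=
      lyapunov_le_sub_integral_sqRate hF hm ha₀ hs (le_add_of_nonneg_right hh.le)
    have hend := hv_le (s + h) (hs.trans (le_add_of_nonneg_right hh.le))
    rw [add_sub_cancel_right] at hend
    have hcontract : v (s + h) ≤ (1 - ε / (ε + C)) * v s := by
      rw [one_sub_div (by positivity), add_sub_cancel_left, div_mul_eq_mul_div,
        le_div_iff₀ (by positivity)]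
      linarith [mul_le_mul_of_nonneg_left hend hε.le, mul_le_mul_of_nonneg_left hloss hC]
    refine hcontract.trans (mul_le_mul_of_nonneg_right ?_ (hv_nonneg s hs))
    rw [hκh, sub_eq_neg_add]
    exact Real.add_one_le_exp _
  calc v t ≤ Real.exp (-κ * (t - a₀ - h)) * v a₀ :=
        le_exp_mul_of_contraction (antitoneOn_lyapunov hF hm ha₀) (hv_nonneg a₀ le_rfl) hh hκ.le
          hstep ht
    _ ≤ Real.exp (-κ * (t - a₀ - h)) * (C * ∫ u in (a₀ - h)..a₀, sqRate e f u) := by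
        gcongr
        exact hv_le a₀ le_rfl
    _ = Real.exp (κ * h) * C * Real.exp (-κ * (t - a₀)) *
          ∫ u in (a₀ - h)..a₀, sqRate e f u := by
        rw [show -κ * (t - a₀ - h) = κ * h + -κ * (t - a₀) by ring, Real.exp_add]
        ring


lemma exists_dotProduct_self_decay (hF : Feasible S g γ V ε) (hh : 0 < h)
    (hτh : ∀ i, S.τ i ≤ h) :
    ∃ K : ℝ, 0 ≤ K ∧ ∃ κ : ℝ, 0 < κ ∧ ∀ a₀, 0 ≤ a₀ → ∀ e f : Fin N → ℝ → Fin n → ℝ,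
      IsMotion S g a₀ 0 e f → ∀ i t, a₀ ≤ t → e i t ⬝ᵥ e i t ≤
        K * Real.exp (-κ * (t - a₀)) * ∫ u in (a₀ - h)..a₀, sqRate e f u := by
  obtain ⟨K, hK, κ, hκ, hdecay⟩ := exists_lyapunov_decay hF hh hτh
  obtain ⟨δ, hδ, hY⟩ :=
    exists_smul_dotProduct_le_dotProduct_mulVec_family fun i => (hF.posDef_Y i).inv
  refine ⟨K / δ, by positivity, κ, hκ, fun a₀ ha₀ e f hm i t ht => ?_⟩
  rw [mul_assoc, div_mul_eq_mul_div, le_div_iff₀' hδ, ← mul_assoc]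
  calc δ * (e i t ⬝ᵥ e i t) ≤ e i t ⬝ᵥ (V.Y i)⁻¹ *ᵥ e i t := hY i _
    _ ≤ ∑ j, e j t ⬝ᵥ (V.Y j)⁻¹ *ᵥ e j t :=
        Finset.single_le_sum (f := fun j => e j t ⬝ᵥ (V.Y j)⁻¹ *ᵥ e j t)
          (fun j _ => dotProduct_mulVec_self_nonneg (hF.posDef_Y j).inv.posSemidef _)
          (Finset.mem_univ i)
    _ ≤ lyapunov S V e f (S.samplingIndex t) t :=
        sum_le_lyapunov_samplingIndex hF hm.hasL2Deriv (ha₀.trans ht)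
    _ ≤ _ := hdecay a₀ ha₀ e f hm t ht

end Decay

/-! ### Growth over a bounded time -/

section DelayedGronwall

variable {E : Type*} [NormedAddCommGroup E] [NormedSpace ℝ E] {z f : ℝ → E} {a b c β B t : ℝ}

lemma IsPrimitive.pi {ι : Type*} [Fintype ι] {E : ι → Type*} [∀ i, NormedAddCommGroup (E i)]
    [∀ i, NormedSpace ℝ (E i)] [∀ i, CompleteSpace (E i)] {F f : ∀ i, ℝ → E i}
    (h : ∀ i, IsPrimitive (F i) (f i)) :
    IsPrimitive (fun t i => F i t) fun t i => f i t where
  intervalIntegrable a b :=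
    ⟨.of_eval fun i => ((h i).intervalIntegrable a b).1,
      .of_eval fun i => ((h i).intervalIntegrable a b).2⟩
  integral_eq_sub a b := by
    ext1 i
    rw [intervalIntegral, Pi.sub_apply,
      eval_integral fun i => ((h i).intervalIntegrable a b).1,
      eval_integral fun i => ((h i).intervalIntegrable a b).2]
    exact (h i).integral_eq_sub a b

lemma IsPrimitive.norm_sub_le_of_norm_le_exp (hz : IsPrimitive z f) (hat : a ≤ t)
    (hf : ∀ s ∈ Icc a t, ‖f s‖ ≤ c * (B * Real.exp (2 * c * (s - a)))) :
    ‖z t - z a‖ ≤ B / 2 * (Real.exp (2 * c * (t - a)) - 1) := by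
  have hderiv (s : ℝ) : HasDerivAt (fun s => B / 2 * Real.exp (2 * c * (s - a)))
      (c * (B * Real.exp (2 * c * (s - a)))) s := by
    have hexponent : HasDerivAt (fun s => 2 * c * (s - a)) (2 * c) s := by
      simpa using ((hasDerivAt_id s).sub_const a).const_mul (2 * c)
    exact (hexponent.exp.const_mul (B / 2)).congr_deriv (by ring)
  have hint : IntervalIntegrable (fun s => c * (B * Real.exp (2 * c * (s - a)))) volume a t :=
    Continuous.intervalIntegrable (by fun_prop) a t
  rw [← hz.integral_eq_sub]
  calc ‖∫ s in a..t, f s‖ ≤ ∫ s in a..t, c * (B * Real.exp (2 * c * (s - a))) :=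
        intervalIntegral.norm_integral_le_of_norm_le hat
          (.of_forall fun s hs => hf s (Ioc_subset_Icc_self hs)) hint
    _ = B / 2 * (Real.exp (2 * c * (t - a)) - 1) := by
        rw [intervalIntegral.integral_eq_sub_of_hasDerivAt (fun s _ => hderiv s) hint, sub_self,
          mul_zero, Real.exp_zero]
        ring

-- A delayed Grönwall inequality. The smallest `B ≥ β` with `‖z t‖ ≤ B e^{2c(t-a)}` satisfies
-- `B ≤ β + B / 2`; the factor `2` in the exponent produces the `1 / 2`.
lemma IsPrimitive.norm_le_of_norm_deriv_le_of_history (hz : IsPrimitive z f) (hc : 0 ≤ c)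
    (hβ : ‖z a‖ ≤ β)
    (hf : ∀ B ≥ β, ∀ t ∈ Icc a b, (∀ s ∈ Icc a t, ‖z s‖ ≤ B) → ‖f t‖ ≤ c * B)
    (ht : t ∈ Icc a b) : ‖z t‖ ≤ 2 * β * Real.exp (2 * c * (t - a)) := by
  have hβ₀ : 0 ≤ β := (norm_nonneg _).trans hβ
  have hcont : Continuous fun t => Real.exp (-(2 * c * (t - a))) * ‖z t‖ :=
    (by fun_prop : Continuous fun t : ℝ => Real.exp (-(2 * c * (t - a)))).mul hz.continuous.norm
  obtain ⟨t₁, ht₁, hmax⟩ := isCompact_Icc.exists_isMaxOn ⟨t, ht⟩ hcont.continuousOn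
  set μ := Real.exp (-(2 * c * (t₁ - a))) * ‖z t₁‖ with hμ
  set B := max β μ
  have hB₀ : 0 ≤ B := hβ₀.trans (le_max_left _ _)
  have hzB (s : ℝ) (hs : s ∈ Icc a b) : ‖z s‖ ≤ B * Real.exp (2 * c * (s - a)) := by
    have hs_le : Real.exp (-(2 * c * (s - a))) * ‖z s‖ ≤ B := (hmax hs).trans (le_max_right _ _)
    rwa [Real.exp_neg, inv_mul_le_iff₀ (Real.exp_pos _), mul_comm] at hs_le
  have hone (s : ℝ) (hs : a ≤ s) : 1 ≤ Real.exp (2 * c * (s - a)) :=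
    Real.one_le_exp (mul_nonneg (by positivity) (sub_nonneg.2 hs))
  have hfB (s : ℝ) (hs : s ∈ Icc a b) : ‖f s‖ ≤ c * (B * Real.exp (2 * c * (s - a))) := by
    refine hf _ ((le_max_left β μ).trans (le_mul_of_one_le_right hB₀ (hone s hs.1))) s hs
      fun r hr => (hzB r ⟨hr.1, hr.2.trans hs.2⟩).trans ?_
    gcongr
    exact hr.2
  have hμ_le : μ ≤ β + B / 2 := by
    have hincr := hz.norm_sub_le_of_norm_le_exp ht₁.1
      fun s hs => hfB s ⟨hs.1, hs.2.trans ht₁.2⟩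
    have htri := norm_le_norm_add_norm_sub' (z t₁) (z a)
    rw [hμ, Real.exp_neg, inv_mul_le_iff₀ (Real.exp_pos _)]
    linarith [le_mul_of_one_le_left hβ₀ (hone t₁ ht₁.1)]
  have hB_le : B ≤ 2 * β := by
    have : B ≤ β + B / 2 := max_le (le_add_of_nonneg_right (by positivity)) hμ_le
    linarith
  exact (hzB t ht).trans (by gcongr)

end DelayedGronwall

lemma exists_norm_mulVec_le {ι ι' : Type*} [Fintype ι] [Fintype ι'] (M : Matrix ι ι' ℝ) :
    ∃ c : ℝ, 0 ≤ c ∧ ∀ v, ‖M *ᵥ v‖ ≤ c * ‖v‖ :=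
  ⟨_, norm_nonneg _, (LinearMap.toContinuousLinearMap M.mulVecLin).le_opNorm⟩

lemma dotProduct_self_le_card_mul_sq {ι : Type*} [Fintype ι] {v : ι → ℝ} {B : ℝ} (hv : ‖v‖ ≤ B) :
    v ⬝ᵥ v ≤ Fintype.card ι * B ^ 2 := by
  rw [← nsmul_eq_mul]
  refine Finset.sum_le_card_nsmul _ _ _ fun d _ => ?_
  rw [← pow_two, ← sq_abs]
  gcongr
  exact (norm_le_pi_norm v d).trans hv

section Growth

variable {N n mw mv : ℕ} {S : Network N n mw mv} {g : Gains S} {e : Fin N → ℝ → Fin n → ℝ}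
  {s₀ β B D t : ℝ}

lemma norm_sum_sub_sampleTime_le {i : Fin N} {k : ℕ}
    (he : ∀ j, ∀ l ∈ nbhd S.graph i, ‖e j (S.sampleTime i k l)‖ ≤ B) :
    ‖∑ j ∈ nbhd S.graph i, (e j (S.sampleTime i k j) - e i (S.sampleTime i k j))‖ ≤
      S.p i * (2 * B) := by
  refine (norm_sum_le_of_le _ fun j hj => (norm_sub_le _ _).trans <|
    (add_le_add (he j j hj) (he i j hj)).trans_eq (two_mul B).symm).trans_eq ?_
  rw [Finset.sum_const, nsmul_eq_mul]
  rfl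

variable (S g) in
lemma exists_norm_errorField_le :
    ∃ c : ℝ, 0 ≤ c ∧ ∀ (e : Fin N → ℝ → Fin n → ℝ) (i : Fin N) (k : ℕ) (t B : ℝ),
      ‖e i t‖ ≤ B → (∀ j, ∀ l ∈ nbhd S.graph i, ‖e j (S.sampleTime i k l)‖ ≤ B) →
        ‖errorField g 0 e i k t‖ ≤ c * B := by
  choose a ha hA using fun i => exists_norm_mulVec_le (S.A - g.L i * S.C i)
  choose b hb hK using fun i => exists_norm_mulVec_le (g.K i * S.H i)
  have hc (i : Fin N) : 0 ≤ a i + b i * (S.p i * 2) :=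
    add_nonneg (ha i) (mul_nonneg (hb i) (by positivity))
  refine ⟨∑ i, (a i + b i * (S.p i * 2)), Finset.sum_nonneg fun i _ => hc i,
    fun e i k t B het hes => ?_⟩
  have hB : 0 ≤ B := (norm_nonneg _).trans het
  have hstate : ‖(S.A - g.L i * S.C i) *ᵥ e i t‖ ≤ a i * B :=
    (hA i _).trans (mul_le_mul_of_nonneg_left het (ha i))
  have hcoupling : ‖coupling g e i k‖ ≤ b i * (S.p i * (2 * B)) :=
    (hK i _).trans (mul_le_mul_of_nonneg_left (norm_sum_sub_sampleTime_le hes) (hb i))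
  calc ‖errorField g 0 e i k t‖ ≤ ‖(S.A - g.L i * S.C i) *ᵥ e i t‖ + ‖coupling g e i k‖ := by
        rw [errorField, Pi.zero_apply, Pi.zero_apply, mulVec_zero, add_zero]
        exact norm_add_le _ _
    _ ≤ (a i + b i * (S.p i * 2)) * B := by linarith
    _ ≤ _ := by
        gcongr
        exact Finset.single_le_sum (f := fun i => a i + b i * (S.p i * 2)) (fun i _ => hc i)
          (Finset.mem_univ i)

lemma norm_sampleTime_le (hτ : ∀ i, BddAbove (range (S.pollGap i)))
    (hβ : ∀ i, ∀ s ∈ Icc (s₀ - S.τmax) s₀, ‖e i s‖ ≤ β) {k : ℕ}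
    (ht : t ∈ Ico (S.t k) (S.t (k + 1))) (hst : s₀ ≤ t) (hB : β ≤ B)
    (he : ∀ i, ∀ s ∈ Icc s₀ t, ‖e i s‖ ≤ B) (i j : Fin N) {l : Fin N}
    (hl : l ∈ nbhd S.graph i) : ‖e j (S.sampleTime i k l)‖ ≤ B := by
  have hupper := S.sampleTime_le i k l
  have hlower := S.t_succ_sub_τ_le_sampleTime (hτ i) k hl
  rcases le_total s₀ (S.sampleTime i k l) with h | h
  · exact he j _ ⟨h, hupper.trans ht.1⟩
  · exact (hβ j _ ⟨by linarith [S.τ_le_τmax i, ht.2], h⟩).trans hB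

variable (g) in
lemma exists_norm_holdBeforeDeriv_le (hτ : ∀ i, BddAbove (range (S.pollGap i))) :
    ∃ c : ℝ, 0 ≤ c ∧ ∀ (s₀ : ℝ) (e : Fin N → ℝ → Fin n → ℝ) (β : ℝ), 0 ≤ s₀ →
      (∀ i, ∀ s ∈ Icc (s₀ - S.τmax) s₀, ‖e i s‖ ≤ β) → ∀ B ≥ β, ∀ t ≥ s₀,
        (∀ i, ∀ s ∈ Icc s₀ t, ‖e i s‖ ≤ B) → ∀ i, ‖holdBeforeDeriv g 0 e s₀ i t‖ ≤ c * B := by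
  obtain ⟨c, hc, hfield⟩ := exists_norm_errorField_le S g
  refine ⟨c, hc, fun s₀ e β hs₀ hβ B hB t ht he i => ?_⟩
  have hmem := S.mem_Ico_samplingIndex (hs₀.trans ht)
  rw [holdBeforeDeriv_eq ht hmem]
  exact hfield e i _ t B (he i t ⟨ht, le_rfl⟩) fun j l hl =>
    norm_sampleTime_le hτ hβ hmem ht hB he i j hl

variable (g) in
lemma exists_norm_holdBefore_le_exp (hτ : ∀ i, BddAbove (range (S.pollGap i))) :
    ∃ c : ℝ, 0 ≤ c ∧ ∀ s₀, 0 ≤ s₀ → ∀ e, IsErrorTrajectory S g s₀ 0 e → ∀ β,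
      (∀ i, ∀ s ∈ Icc (s₀ - S.τmax) s₀, ‖e i s‖ ≤ β) → ∀ i, ∀ t ≥ s₀,
        ‖holdBefore e s₀ i t‖ ≤ 2 * β * Real.exp (2 * c * (t - s₀)) ∧
        ‖holdBeforeDeriv g 0 e s₀ i t‖ ≤ c * (2 * β * Real.exp (2 * c * (t - s₀))) := by
  obtain ⟨c, hc, hderiv⟩ := exists_norm_holdBeforeDeriv_le g hτ
  refine ⟨c, hc, fun s₀ hs₀ e he β hβ i t ht => ?_⟩
  have hinit (j : Fin N) : ‖e j s₀‖ ≤ β :=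
    hβ j s₀ ⟨sub_le_self _ ((S.τ_nonneg (hτ j)).trans (S.τ_le_τmax j)), le_rfl⟩
  have hβ₀ : 0 ≤ β := (norm_nonneg _).trans (hinit i)
  have hprim : IsPrimitive (fun t i => holdBefore e s₀ i t)
      fun t i => holdBeforeDeriv g 0 e s₀ i t :=
    .pi fun j => (he.hasL2Deriv hs₀ MemLp.zero).isPrimitive
  have hgrowth (s : ℝ) (hs : s₀ ≤ s) (j : Fin N) :
      ‖e j s‖ ≤ 2 * β * Real.exp (2 * c * (s - s₀)) := by
    rw [← holdBefore_of_le (e := e) hs]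
    refine (norm_le_pi_norm (fun i => holdBefore e s₀ i s) j).trans <|
      hprim.norm_le_of_norm_deriv_le_of_history hc ?_ (fun B hB r hr hz => ?_)
        (right_mem_Icc.2 hs)
    · refine (pi_norm_le_iff_of_nonneg hβ₀).2 fun l => ?_
      rw [holdBefore_of_le le_rfl]
      exact hinit l
    · refine (pi_norm_le_iff_of_nonneg (mul_nonneg hc (hβ₀.trans hB))).2 fun l => ?_
      refine hderiv s₀ e β hs₀ hβ B hB r hr.1 (fun m u hu => ?_) l
      rw [← holdBefore_of_le (e := e) hu.1]
      exact (norm_le_pi_norm (fun i => holdBefore e s₀ i u) m).trans (hz u hu)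
  have hexp (s : ℝ) (hs : s ≤ t) :
      2 * β * Real.exp (2 * c * (s - s₀)) ≤ 2 * β * Real.exp (2 * c * (t - s₀)) := by gcongr
  refine ⟨(holdBefore_of_le ht).symm ▸ hgrowth t ht i, ?_⟩
  refine hderiv s₀ e β hs₀ hβ _ ?_ t ht
    (fun j s hs => (hgrowth s hs.1 j).trans (hexp s hs.2)) i
  have hone : 1 ≤ Real.exp (2 * c * (t - s₀)) :=
    Real.one_le_exp (mul_nonneg (by positivity) (sub_nonneg.2 ht))
  linarith [le_mul_of_one_le_right hβ₀ hone]

lemma sqRate_le {f : Fin N → ℝ → Fin n → ℝ} {c : ℝ} (he : ∀ i, ‖e i t‖ ≤ B)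
    (hf : ∀ i, ‖f i t‖ ≤ c * B) : sqRate e f t ≤ N * (n * (1 + c ^ 2)) * B ^ 2 := by
  have hnode (i : Fin N) : e i t ⬝ᵥ e i t + f i t ⬝ᵥ f i t ≤ n * (1 + c ^ 2) * B ^ 2 := by
    have hstate := dotProduct_self_le_card_mul_sq (he i)
    have hderiv := dotProduct_self_le_card_mul_sq (hf i)
    rw [Fintype.card_fin] at hstate hderiv
    linarith
  refine (Finset.sum_le_card_nsmul _ _ _ fun i _ => hnode i).trans_eq ?_
  rw [nsmul_eq_mul, Finset.card_univ, Fintype.card_fin]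
  ring

variable (g) in
lemma exists_sqRate_holdBefore_le (hτ : ∀ i, BddAbove (range (S.pollGap i))) (hD : 0 ≤ D) :
    ∃ C : ℝ, 0 ≤ C ∧ ∀ s₀, 0 ≤ s₀ → ∀ e, IsErrorTrajectory S g s₀ 0 e → ∀ β,
      (∀ i, ∀ s ∈ Icc (s₀ - S.τmax) s₀, ‖e i s‖ ≤ β) → ∀ t ≤ s₀ + D,
        sqRate (holdBefore e s₀) (holdBeforeDeriv g 0 e s₀) t ≤ C * β ^ 2 := by
  obtain ⟨c, hc, hgrowth⟩ := exists_norm_holdBefore_le_exp g hτ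
  refine ⟨N * (n * (1 + c ^ 2)) * (2 * Real.exp (2 * c * D)) ^ 2, by positivity,
    fun s₀ hs₀ e he β hβ t ht => ?_⟩
  rw [mul_assoc, ← mul_pow, mul_right_comm 2]
  have hbounds (i : Fin N) : ‖holdBefore e s₀ i t‖ ≤ 2 * β * Real.exp (2 * c * D) ∧
      ‖holdBeforeDeriv g 0 e s₀ i t‖ ≤ c * (2 * β * Real.exp (2 * c * D)) := by
    have hinit : ‖e i s₀‖ ≤ β :=
      hβ i s₀ ⟨sub_le_self _ ((S.τ_nonneg (hτ i)).trans (S.τ_le_τmax i)), le_rfl⟩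
    have hβ₀ : 0 ≤ β := (norm_nonneg _).trans hinit
    rcases le_or_gt s₀ t with hst | hts
    · obtain ⟨hstate, hderiv⟩ := hgrowth s₀ hs₀ e he β hβ i t hst
      have hexp : 2 * β * Real.exp (2 * c * (t - s₀)) ≤ 2 * β * Real.exp (2 * c * D) := by
        gcongr
        exact sub_le_iff_le_add'.2 ht
      exact ⟨hstate.trans hexp, hderiv.trans (mul_le_mul_of_nonneg_left hexp hc)⟩
    · rw [holdBefore_of_ge hts.le, holdBeforeDeriv_of_lt hts, norm_zero]
      have hone : 1 ≤ Real.exp (2 * c * D) := Real.one_le_exp (by positivity)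
      exact ⟨by linarith [le_mul_of_one_le_right hβ₀ hone], by positivity⟩
  exact sqRate_le (fun i => (hbounds i).1) fun i => (hbounds i).2

end Growth

/-! ### Exponential stability -/

lemma norm_le_eucl {ι : Type} [Fintype ι] (v : ι → ℝ) : ‖v‖ ≤ eucl v :=
  (pi_norm_le_iff_of_nonneg (norm_nonneg _)).2 fun d => PiLp.norm_apply_le (WithLp.toLp 2 v) d

section Stability

variable {N n mw mv : ℕ} {S : Network N n mw mv} {g : Gains S} {γ ε : ℝ} {V : LMIVars N n}

lemma IsErrorTrajectory.isMotion_add_τmax {s₀ : ℝ} {e : Fin N → ℝ → Fin n → ℝ} (hs₀ : 0 ≤ s₀)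
    (he : IsErrorTrajectory S g s₀ 0 e) (hτ : ∀ i, BddAbove (range (S.pollGap i)))
    (hτmax : 0 ≤ S.τmax) :
    IsMotion S g (s₀ + S.τmax) 0 (holdBefore e s₀) (holdBeforeDeriv g 0 e s₀) :=
  he.isMotion hs₀ (fun _ => MemLp.zero) (le_add_of_nonneg_right hτmax) fun i k t ht hk j hj => by
    linarith [S.t_succ_sub_τ_le_sampleTime (hτ i) k hj, S.τ_le_τmax i]

lemma exists_dotProduct_self_le_exp (hF : Feasible S g γ V ε) :
    ∃ Q : ℝ, 0 ≤ Q ∧ ∃ κ : ℝ, 0 < κ ∧ ∀ s₀, 0 ≤ s₀ → ∀ e, IsErrorTrajectory S g s₀ 0 e → ∀ β,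
      (∀ i, ∀ s ∈ Icc (s₀ - S.τmax) s₀, ‖e i s‖ ≤ β) → ∀ i, ∀ t ≥ s₀,
        e i t ⬝ᵥ e i t ≤ Q * Real.exp (-κ * (t - s₀)) * β ^ 2 := by
  have hτmax : 0 ≤ S.τmax := Real.iSup_nonneg hF.τ_nonneg
  obtain ⟨K, hK, κ, hκ, hdecay⟩ := exists_dotProduct_self_decay hF (h := S.τmax + 1)
    (by positivity) fun i => (S.τ_le_τmax i).trans (le_add_of_nonneg_right zero_le_one)
  obtain ⟨C, hC, hgrowth⟩ := exists_sqRate_holdBefore_le g hF.bddAbove_pollGap hτmax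
  refine ⟨(1 + K * (S.τmax + 1)) * C * Real.exp (κ * S.τmax), by positivity, κ, hκ,
    fun s₀ hs₀ e he β hβ i t ht => ?_⟩
  have hsq := hgrowth s₀ hs₀ e he β hβ
  have hexp : (1 + K * (S.τmax + 1)) * C * Real.exp (κ * S.τmax) * Real.exp (-κ * (t - s₀)) *
      β ^ 2 = (1 + K * (S.τmax + 1)) * Real.exp (-κ * (t - (s₀ + S.τmax))) * (C * β ^ 2) := by
    rw [show -κ * (t - (s₀ + S.τmax)) = κ * S.τmax + -κ * (t - s₀) by ring, Real.exp_add]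
    ring
  rw [hexp, ← holdBefore_of_le (e := e) ht]
  rcases le_total t (s₀ + S.τmax) with hshort | hlong
  · have hone : 1 ≤ (1 + K * (S.τmax + 1)) * Real.exp (-κ * (t - (s₀ + S.τmax))) :=
      one_le_mul_of_one_le_of_one_le (le_add_of_nonneg_right (by positivity))
        (Real.one_le_exp (mul_nonneg_of_nonpos_of_nonpos (neg_nonpos.2 hκ.le)
          (sub_nonpos.2 hshort)))
    exact ((dotProduct_self_le_sqRate (f := holdBeforeDeriv g 0 e s₀) i t).trans
      (hsq t hshort)).trans (le_mul_of_one_le_left (by positivity) hone)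
  · have hm := he.isMotion_add_τmax hs₀ hF.bddAbove_pollGap hτmax
    have hwindow : ∫ u in (s₀ + S.τmax - (S.τmax + 1))..(s₀ + S.τmax),
        sqRate (holdBefore e s₀) (holdBeforeDeriv g 0 e s₀) u ≤
          (S.τmax + 1) * (C * β ^ 2) := by
      have hmono := intervalIntegral.integral_mono_on (μ := volume)
        (sub_le_self (s₀ + S.τmax) (by positivity : 0 ≤ S.τmax + 1))
        (intervalIntegrable_sqRate hm.hasL2Deriv _ _) intervalIntegrable_const
        fun u hu => hsq u hu.2
      rwa [intervalIntegral.integral_const, sub_sub_cancel, smul_eq_mul] at hmono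
    calc _ ≤ K * Real.exp (-κ * (t - (s₀ + S.τmax))) * ((S.τmax + 1) * (C * β ^ 2)) :=
          (hdecay _ (by positivity) _ _ hm i t hlong).trans
            (mul_le_mul_of_nonneg_left hwindow (by positivity))
      _ = K * (S.τmax + 1) * Real.exp (-κ * (t - (s₀ + S.τmax))) * (C * β ^ 2) := by ring
      _ ≤ _ := by
          gcongr
          exact le_add_of_nonneg_left zero_le_one

lemma exponentiallyStable (hF : Feasible S g γ V ε) : ExponentiallyStable S g := by
  obtain ⟨Q, hQ, κ, hκ, hdecay⟩ := exists_dotProduct_self_le_exp hF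
  refine ⟨√Q + 1, by positivity, κ / 2, by positivity, fun s₀ hs₀ e he β hβ i t ht => ?_⟩
  have hinit : eucl (e i s₀) ≤ β :=
    hβ i s₀ ⟨sub_le_self _ ((hF.τ_nonneg i).trans (S.τ_le_τmax i)), le_rfl⟩
  have hβ₀ : 0 ≤ β := (norm_nonneg _).trans hinit
  have hexp : Real.exp (-κ * (t - s₀)) = Real.exp (-(κ / 2) * (t - s₀)) ^ 2 := by
    rw [← Real.exp_nat_mul]
    push_cast
    ring_nf
  have hQ_le : Q ≤ (√Q + 1) ^ 2 := by
    linarith [Real.sq_sqrt hQ, Real.sqrt_nonneg Q]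
  refine le_of_sq_le_sq ?_ (by positivity)
  calc eucl (e i t) ^ 2 ≤ Q * Real.exp (-κ * (t - s₀)) * β ^ 2 := by
        rw [eucl_sq]
        exact hdecay s₀ hs₀ e he β (fun j s hs => (norm_le_eucl _).trans (hβ j s hs)) i t ht
    _ ≤ (√Q + 1) ^ 2 * Real.exp (-κ * (t - s₀)) * β ^ 2 := by gcongr
    _ = ((√Q + 1) * Real.exp (-(κ / 2) * (t - s₀)) * β) ^ 2 := by
        rw [hexp]
        ring

end Stability

end

end RoundRobin

open RoundRobin in
theorem theorem1_general {N n mw mv : ℕ} (hN : N ≠ 0) (S : Network N n mw mv) {γ ε : ℝ}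
    (hγ : γ ≠ 0) (g : Gains S) (V : LMIVars N n) (hF : Feasible S g γ V ε) :
    SolvesEstimationProblem S g γ (weightP S V) :=
  ⟨posDef_weightP hF hN, exponentiallyStable hF, consensusPerformance hF hN hγ⟩

open RoundRobin in
theorem theorem1 {N n mw mv : ℕ} (hN : 1 ≤ N) (S : Network N n mw mv)
    (hτ : ∀ i, BddAbove (Set.range (S.pollGap i)))
    (γ : ℝ) (hγ : 0 < γ) (g : Gains S) (V : LMIVars N n)
    (hY : ∀ i, (V.Y i).PosDef)
    (hW : ∀ i, (V.W i).PosSemidef)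
    (hS : ∀ i, (V.S i).PosSemidef)
    (hR : ∀ i, (V.R i).PosSemidef)
    (hα : ∀ i, 0 < V.α i)
    (hϖ : ∀ i, 0 ≤ V.ϖ i ∧ (S.q i : ℝ) * V.ϖ i < 2 * V.α i)
    (hPark : ∀ i, (Matrix.fromBlocks (V.R i) (V.G i) (V.G i).transpose (V.R i)).PosSemidef)
    (hXi : ∀ i, (-Xi S g γ V i).PosDef) :
    SolvesEstimationProblem S g γ (weightP S V) := by
  obtain ⟨ε, hε, hXi_ge⟩ := exists_smul_dotProduct_le_dotProduct_mulVec_family hXi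
  refine theorem1_general (Nat.one_le_iff_ne_zero.1 hN) S hγ.ne' g V
    ⟨hτ, hY, hW, hS, hα, fun i => (hϖ i).2.le, hPark, hε, fun i v => ?_⟩
  simpa only [neg_mulVec, dotProduct_neg, le_neg] using hXi_ge i v
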